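/- **Setting.** Let $d\in\{2,3\}$. Let $\mathcal T$ be a finite conforming triangulation of an open set $\Omega\subset\mathbb R^d$ into non-degenerate closed simplices: any two simplices meet in the convex hull of their common vertices, and $\Omega$ is the interior of $\bigcup_{T\in\mathcal T}T$ (this covers every triangulated bounded Lipschitz domain). Let $\mathcal F$ be the set of faces, $h=\max_T\operatorname{diam}T$, $n$ the outward unit normal on $\partial T$, and $v_t=v-(v\cdot n)n$. The mesh is called quasi-uniform with constant $\sigma>0$ if every $T\in\mathcal T$ contains a closed ball of radius $h/\sigma$. For $k\ge 1$ let $$V_h=P_k(\mathcal T)^d\cap H_0(\mathrm{div},\Omega),\qquad Q_h=P_{k-1}(\mathcal T),$$ $$\widehat V_h=\{\hat v:\ \hat v|_F\in P_k(F)^d,\ \hat v\cdot n_F=0\ \ \forall F\in\mathcal F,\ \hat v=0\text{ on faces in }\partial\Omega\},$$ where $n_F$ is a unit normal of $F$. With a penalty parameter $\alpha$ set $$a_h((u,\hat u),(v,\hat v))=\sum_{T}\Big[(\nabla u,\nabla v)_T+(\nabla u\,n,(\hat v-v)_t)_{\partial T}+(\nabla v\,n,(\hat u-u)_t)_{\partial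 T}+\tfrac{\alpha k^2}{h}((\hat u-u)_t,(\hat v-v)_t)_{\partial T}\Big],$$ $$c_h(\varrho,u,\lambda)=-\sum_T(\varrho u,\nabla\lambda)_T+\sum_T(u\cdot n\,\varrho^{up},\lambda)_{\partial T},$$ where $\varrho^{up}$ is the upwind value of $\varrho$ with respect to $u$, i.e. the value from the cell out of which $u$ flows. The flow direction may be determined either pointwise, by the sign of $u\cdot n$, or facewise, by the sign of $\int_F u\cdot n$ (in the case of sign zero the mean of both values is taken). The results below hold for both conventions. Let $\nu>0$, $\tau>0$, $c_M\in\mathbb R$, $f\in L^2(\Omega)^d$, $g\in L^\infty(\Omega)^d$. Given $\varrho_h^n\in Q_h$, the *velocity update* seeks $(u_h^{n+1},\hat u_h^{n+1})\in V_h\times\widehat V_h$ with $$\nu\,a_h((u_h^{n+1},\hat u_h^{n+1}),(v_h,\hat v_h))=(f,v_h)+(g,\varrho_h^n v_h)+(c_M\varrho_h^n,\operatorname{div}v_h)\qquad\forall (v_h,\hat v_h)\in V_h\times\widehat V_h,$$ and, given $u_h^{n+1}\in V_h$, the *density update* seeks $\varrho_h^{n+1}\in Q_h$ with $$\tau^{-1}(\varrho_h^{n+1},\lambda_h)+c_h(\varrho_h^{n+1},u_h^{n+1},\lambda_h)=\tau^{-1}(\varrho_h^n,\lambda_h)\qquad\forall\lambda_h\in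 Q_h .$$ **Lemma (Solvability of the sub-systems).** 1. For every $k\ge1$ and $\sigma>0$ there is $\alpha_0>0$, depending only on $d,k,\sigma$, such that on every mesh that is quasi-uniform with constant $\sigma$ and for every $\alpha\ge\alpha_0$, the velocity update has exactly one solution, for all data $\nu,c_M,f,g,\varrho_h^n$ as above. 2. Let $k=1$. For every mesh, every $\tau>0$ and every $u_h^{n+1}\in V_h$, the system matrix of the density update in the basis $(\chi_T)_{T\in\mathcal T}$ of cell indicator functions is an M-matrix (its off-diagonal entries are non-positive, and it is invertible with an entrywise non-negative inverse). For every $\varrho_h^n\in Q_h$ the density update has exactly one solution $\varrho_h^{n+1}$. If $\varrho_h^n>0$, then $\varrho_h^{n+1}>0$, and if $(\varrho_h^n,1)=M$, then $(\varrho_h^{n+1},1)=M$. -/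

import Mathlib

open MeasureTheory
open scoped ContDiff

noncomputable section

namespace HDG

/-- `ℝ^d` with the Euclidean norm. -/
abbrev Eu (d : ℕ) : Type := EuclideanSpace ℝ (Fin d)

/-- A regular (conforming) simplicial triangulation of `Ω ⊆ ℝ^d`. A simplex is given by the finite
set of its vertices. Two simplices meet in the convex hull of their common vertices, and `Ω` is
the interior of the union of all simplices. -/
structure Mesh (d : ℕ) (Ω : Set (Eu d)) where
  cells : Finset (Finset (Eu d))
  card_cell : ∀ T ∈ cells, T.card = d + 1
  indep : ∀ T ∈ cells, AffineIndependent ℝ ((↑) : T → Eu d)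
  conforming : ∀ S ∈ cells, ∀ T ∈ cells,
    convexHull ℝ (S : Set (Eu d)) ∩ convexHull ℝ (T : Set (Eu d)) ⊆
      convexHull ℝ ((S : Set (Eu d)) ∩ (T : Set (Eu d)))
  domain_eq : Ω = interior (⋃ T ∈ cells, convexHull ℝ (T : Set (Eu d)))

/-- The closed simplex with vertex set `S`. -/
def hull {d : ℕ} (S : Finset (Eu d)) : Set (Eu d) := convexHull ℝ (S : Set (Eu d))

/-- The barycentre of the points of `S`. -/
def barycentre {d : ℕ} (S : Finset (Eu d)) : Eu d := (S.card : ℝ)⁻¹ • ∑ x ∈ S, x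

/-- The unit normal vector on the face `F` of the simplex `T` pointing out of `T`: the normalized
component, orthogonal to `F`, of the vector from the barycentre of `T` to the barycentre of `F`. -/
def outwardNormal {d : ℕ} (T F : Finset (Eu d)) : Eu d :=
  let w := (vectorSpan ℝ (F : Set (Eu d)))ᗮ.starProjection (barycentre F - barycentre T)
  ‖w‖⁻¹ • w

/-- The tangential part `v - (v · n) n`. -/
def tang {d : ℕ} (n v : Eu d) : Eu d := v - (inner ℝ v n) • n

/-- `P^k`: real polynomial functions on `ℝ^d` of total degree at most `k`. -/
def polySpace (d k : ℕ) : Submodule ℝ (Eu d → ℝ) where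
  carrier := {f | ∃ p : MvPolynomial (Fin d) ℝ, p.totalDegree ≤ k ∧
    ∀ x : Eu d, f x = MvPolynomial.eval (fun i => x i) p}
  add_mem' := by
    rintro f g ⟨p, hp, hf⟩ ⟨q, hq, hg⟩
    exact ⟨p + q, (MvPolynomial.totalDegree_add p q).trans (max_le hp hq),
      fun x => by simp [hf, hg]⟩
  zero_mem' := ⟨0, by simp, fun x => by simp⟩
  smul_mem' := by
    rintro c f ⟨p, hp, hf⟩
    exact ⟨c • p, (MvPolynomial.totalDegree_smul_le c p).trans hp,
      fun x => by simp [hf, MvPolynomial.smul_eval]⟩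

/-- Vector fields on `ℝ^d` all of whose components lie in `P^k`. -/
def vecPoly (d k : ℕ) : Set (Eu d → Eu d) :=
  {p | ∀ i : Fin d, (fun x => p x i) ∈ polySpace d k}

/-- The divergence of a differentiable vector field. -/
def divergence {d : ℕ} (v : Eu d → Eu d) (x : Eu d) : ℝ :=
  ∑ i : Fin d, (fderiv ℝ v x (EuclideanSpace.single i 1)) i

/-- The Frobenius product of the Jacobian matrices of `u` and `v` at `x`. -/
def gradProd {d : ℕ} (u v : Eu d → Eu d) (x : Eu d) : ℝ :=
  ∑ i : Fin d, inner ℝ (fderiv ℝ u x (EuclideanSpace.single i 1))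
    (fderiv ℝ v x (EuclideanSpace.single i 1))

/-- `H_0(div, Ω)`: square-integrable fields with a weak divergence `q ∈ L²(Ω)` and zero normal trace
on the boundary. Since the test functions `φ` are smooth up to (and beyond) the boundary of `Ω`,
the integration-by-parts formula without boundary term expresses both properties. -/
def HdivZero {d : ℕ} (Ω : Set (Eu d)) : Set (Eu d → Eu d) :=
  {w | MemLp w 2 (volume.restrict Ω) ∧ ∃ q : Eu d → ℝ, MemLp q 2 (volume.restrict Ω) ∧
    ∀ φ : Eu d → ℝ, ContDiff ℝ ∞ φ → HasCompactSupport φ →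
      ∫ x in Ω, inner ℝ (w x) (gradient φ x) = -∫ x in Ω, q x * φ x}

/-- Which of the two usual upwind rules on a face is used: the upwind side is determined by the sign
of the normal velocity at each point of the face, or by the sign of its integral over the face. -/
inductive UpwindRule
  | pointwise
  | facewise

open Classical in
/-- (Nonsingular) M-matrix: non-positive off-diagonal entries, and invertible with an entrywise
non-negative inverse. -/
def IsMMatrix {ι : Type*} [Fintype ι] (A : Matrix ι ι ℝ) : Prop :=
  (∀ i j, i ≠ j → A i j ≤ 0) ∧
    ∃ B : Matrix ι ι ℝ, A * B = 1 ∧ B * A = 1 ∧ ∀ i j, 0 ≤ B i j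

namespace Mesh

variable {d : ℕ} {Ω : Set (Eu d)} (M : Mesh d Ω)

open Classical in
/-- The set `𝓕` of all faces (`(d-1)`-dimensional sub-simplices, given by their vertices). -/
def faces : Finset (Finset (Eu d)) := M.cells.biUnion fun T => T.powersetCard d

open Classical in
/-- The faces that make up the boundary of the cell `T`. -/
def facesOf (T : M.cells) : Finset M.faces :=
  Finset.univ.filter fun F => (F : Finset (Eu d)) ⊆ (T : Finset (Eu d))

/-- The mesh size `h`, the maximum of the cell diameters. -/
def meshSize : ℝ := ⨆ T : M.cells, Metric.diam (hull (T : Finset (Eu d)))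

/-- Shape regularity and quasi-uniformity with constant `σ`: every cell contains a ball of radius
`h / σ`, where `h` is the global mesh size. -/
def IsQuasiUniform (σ : ℝ) : Prop :=
  ∀ T ∈ M.cells, ∃ c : Eu d, Metric.closedBall c (M.meshSize / σ) ⊆ hull T

/-- The `L²`-integrable function on `Ω` represented by a family of functions, one for each cell
(well defined off the faces, which are null sets). -/
def glue (v : M.cells → Eu d → Eu d) (x : Eu d) : Eu d :=
  ∑ T : M.cells, (hull (T : Finset (Eu d))).indicator (v T) x

/-- `V_h = P_k(𝓣)^d ∩ H_0(div, Ω)`. A piecewise polynomial is given by one polynomial per cell. -/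
def Vh (k : ℕ) : Set (M.cells → Eu d → Eu d) :=
  {v | (∀ T, v T ∈ vecPoly d k) ∧ M.glue v ∈ HdivZero Ω}

/-- The space of tangential facet unknowns: one function per face, polynomial of degree `≤ k` on the
face, tangential, and zero on boundary faces. A function on a face `F` is represented by its
extension by zero outside `F`. -/
def Vhat (k : ℕ) : Set (M.faces → Eu d → Eu d) :=
  {v | (∀ F, ∃ p ∈ vecPoly d k, v F = (hull (F : Finset (Eu d))).indicator p) ∧
    (∀ T, ∀ F ∈ M.facesOf T, ∀ x ∈ hull (F : Finset (Eu d)),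
      inner ℝ (v F x) (outwardNormal (T : Finset (Eu d)) F) = 0) ∧
    ∀ F : M.faces, hull (F : Finset (Eu d)) ⊆ frontier Ω → v F = 0}

/-- `Q_h = P_{k-1}(𝓣)`, for `k ≥ 1`. -/
def Qh (k : ℕ) : Set (M.cells → Eu d → ℝ) :=
  {ρ | ∀ T, ρ T ∈ polySpace d (k - 1)}

/-- The `L²(Ω)` inner product of piecewise polynomials. -/
def ip (ρ μ : M.cells → Eu d → ℝ) : ℝ :=
  ∑ T : M.cells, ∫ x in hull (T : Finset (Eu d)), ρ T x * μ T x

/-- The HDG form `a_h`, with interior penalty parameter `α`. -/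
def ah (k : ℕ) (α : ℝ) (u : M.cells → Eu d → Eu d) (uh : M.faces → Eu d → Eu d)
    (v : M.cells → Eu d → Eu d) (vh : M.faces → Eu d → Eu d) : ℝ :=
  ∑ T : M.cells,
    ((∫ x in hull (T : Finset (Eu d)), gradProd (u T) (v T) x) +
      ∑ F ∈ M.facesOf T,
        let n := outwardNormal (T : Finset (Eu d)) F
        ((∫ x in hull (F : Finset (Eu d)),
            inner ℝ (fderiv ℝ (u T) x n) (tang n (vh F x - v T x)) ∂μHE[d - 1]) +
          (∫ x in hull (F : Finset (Eu d)),
            inner ℝ (fderiv ℝ (v T) x n) (tang n (uh F x - u T x)) ∂μHE[d - 1]) +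
          α * (k : ℝ) ^ 2 / M.meshSize *
            ∫ x in hull (F : Finset (Eu d)),
              inner ℝ (tang n (uh F x - u T x)) (tang n (vh F x - v T x)) ∂μHE[d - 1]))

/-- The pressure form `-(p, div v)`. -/
def bform (p : M.cells → Eu d → ℝ) (v : M.cells → Eu d → Eu d) : ℝ :=
  -∑ T : M.cells, ∫ x in hull (T : Finset (Eu d)), p T x * divergence (v T) x

/-- The forcing `F_h(v) = (f, v)`. -/
def Fform (f : Eu d → Eu d) (v : M.cells → Eu d → Eu d) : ℝ :=
  ∑ T : M.cells, ∫ x in hull (T : Finset (Eu d)), inner ℝ (f x) (v T x)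

/-- The gravity term `G_h(ρ, v) = (g, ρ v)`. -/
def Gform (g : Eu d → Eu d) (ρ : M.cells → Eu d → ℝ) (v : M.cells → Eu d → Eu d) : ℝ :=
  ∑ T : M.cells, ∫ x in hull (T : Finset (Eu d)), inner ℝ (g x) (ρ T x • v T x)

open Classical in
/-- The value of `ρ` at `x` from the other side of the face `F` of `T`, i.e. taken from the cell
different from `T` that shares `F`. On boundary faces (where the normal velocity vanishes, so that
the value is irrelevant) it is the value from `T`. -/
def outerValue (ρ : M.cells → Eu d → ℝ) (T : M.cells) (F : M.faces) (x : Eu d) : ℝ :=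
  if h : ∃ S : M.cells, S ≠ T ∧ F ∈ M.facesOf S then ρ h.choose x else ρ T x

/-- The upwind direction indicator on the face `F` of `T`: positive for outflow from `T`. -/
def upwindSign (rule : UpwindRule) (u : M.cells → Eu d → Eu d) (T : M.cells) (F : M.faces)
    (x : Eu d) : ℝ :=
  let n := outwardNormal (T : Finset (Eu d)) F
  match rule with
  | .pointwise => inner ℝ (u T x) n
  | .facewise => ∫ y in hull (F : Finset (Eu d)), inner ℝ (u T y) n ∂μHE[d - 1]

open Classical in
/-- The upwind value of `ρ` on the face `F` of `T`: the value from the side the flow comes from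
(and the mean of both values if there is no flow). -/
def upwind (rule : UpwindRule) (ρ : M.cells → Eu d → ℝ) (u : M.cells → Eu d → Eu d)
    (T : M.cells) (F : M.faces) (x : Eu d) : ℝ :=
  if 0 < M.upwindSign rule u T F x then ρ T x
  else if M.upwindSign rule u T F x < 0 then M.outerValue ρ T F x
  else (ρ T x + M.outerValue ρ T F x) / 2

/-- The upwind transport form `c_h`. -/
def ch (rule : UpwindRule) (ρ : M.cells → Eu d → ℝ) (u : M.cells → Eu d → Eu d)
    (μ : M.cells → Eu d → ℝ) : ℝ :=
  -(∑ T : M.cells, ∫ x in hull (T : Finset (Eu d)), inner ℝ (ρ T x • u T x) (gradient (μ T) x)) +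
    ∑ T : M.cells, ∑ F ∈ M.facesOf T, ∫ x in hull (F : Finset (Eu d)),
      inner ℝ (u T x) (outwardNormal (T : Finset (Eu d)) F) * M.upwind rule ρ u T F x * μ T x
        ∂μHE[d - 1]

/-- `(u, uh)` solves the velocity update for the previous density `ρ`, with the equation of state
`p(ρ) = cM ρ`. -/
def IsVelocityUpdate (k : ℕ) (α ν cM : ℝ) (f g : Eu d → Eu d) (ρ : M.cells → Eu d → ℝ)
    (u : M.cells → Eu d → Eu d) (uh : M.faces → Eu d → Eu d) : Prop :=
  u ∈ M.Vh k ∧ uh ∈ M.Vhat k ∧ ∀ v ∈ M.Vh k, ∀ vh ∈ M.Vhat k,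
    ν * M.ah k α u uh v vh = M.Fform f v + M.Gform g ρ v - M.bform (fun T x => cM * ρ T x) v

/-- `ρ'` solves the implicit upwind density update for the velocity `u` and previous density
`ρ`. -/
def IsDensityUpdate (k : ℕ) (rule : UpwindRule) (τ : ℝ) (u : M.cells → Eu d → Eu d)
    (ρ ρ' : M.cells → Eu d → ℝ) : Prop :=
  ρ' ∈ M.Qh k ∧ ∀ μ ∈ M.Qh k, τ⁻¹ * M.ip ρ' μ + M.ch rule ρ' u μ = τ⁻¹ * M.ip ρ μ

/-- The total mass `(ρ, 1)`. -/
def mass (ρ : M.cells → Eu d → ℝ) : ℝ := M.ip ρ fun _ _ => 1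

/-- `ρ > 0` on every (closed) cell. -/
def IsPositive (ρ : M.cells → Eu d → ℝ) : Prop :=
  ∀ T : M.cells, ∀ x ∈ hull (T : Finset (Eu d)), 0 < ρ T x

open Classical in
/-- The indicator function of the cell `T`, an element of `Q_h`. -/
def chi (T : M.cells) : M.cells → Eu d → ℝ := fun S _ => if S = T then 1 else 0

/-- The system matrix of the density update for `k = 1`, in the basis of cell indicators. -/
def densityMatrix (rule : UpwindRule) (τ : ℝ) (u : M.cells → Eu d → Eu d) :
    Matrix M.cells M.cells ℝ :=
  Matrix.of fun T S => τ⁻¹ * M.ip (M.chi S) (M.chi T) + M.ch rule (M.chi S) u (M.chi T)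

end Mesh

end HDG

end

/-! Testing the weak divergence with functions concentrated near a point of a face shows that the
normal component of a piecewise polynomial field in `H_0(div)` is continuous across interior faces
and vanishes on the boundary.

*Velocity.* The energy of a polynomial gradient on a small ball bounds its values on a larger ball,
because polynomials of bounded degree form a finite-dimensional space; scaling turns this into a
discrete trace inequality on quasi-uniform meshes. A penalty parameter beyond the resulting constant
absorbs the consistency terms, so zero energy forces a velocity to be piecewise constant with no
tangential jumps. Its normal jumps vanish as well, hence it is continuous across faces; a nonzero
constant would have to occupy a set of cells with no exposed face, which is impossible for a bounded
set. On the finite-dimensional space of unknowns uniqueness gives existence.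

*Density.* The fluxes of the upwind scheme leaving one cell enter another, so the off-diagonal
entries of the density matrix are non-positive while every column sums to `|T| / τ > 0`. Such a
matrix is an M-matrix, it preserves strict positivity, and summing the equations over all cells
shows that the mass does not change.
-/

noncomputable section

namespace HDG

/-! ### Polynomial functions -/

/-- Evaluation of polynomials at the points of `ℝ^d`, as a linear map. -/
def polyEval (d : ℕ) : MvPolynomial (Fin d) ℝ →ₗ[ℝ] (Eu d → ℝ) where
  toFun p x := MvPolynomial.eval (fun i => x i) p
  map_add' p q := by ext x; simp
  map_smul' c p := by ext x; simp [MvPolynomial.smul_eval]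

/-- The set `vecPoly d k` as a submodule. -/
def vecPolySubmodule (d k : ℕ) : Submodule ℝ (Eu d → Eu d) where
  carrier := vecPoly d k
  add_mem' := fun {_ _} hu hv i => (polySpace d k).add_mem (hu i) (hv i)
  zero_mem' := fun _ => (polySpace d k).zero_mem
  smul_mem' := fun c _ hu i => (polySpace d k).smul_mem c (hu i)

section Polynomials

variable {d k : ℕ}

lemma polySpace_eq_map :
    polySpace d k = (MvPolynomial.restrictTotalDegree (Fin d) ℝ k).map (polyEval d) := by
  ext f
  constructor
  · rintro ⟨p, hp, h⟩
    exact ⟨p, (MvPolynomial.mem_restrictTotalDegree _ _ _).2 hp, (funext h).symm⟩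
  · rintro ⟨p, hp, rfl⟩
    exact ⟨p, (MvPolynomial.mem_restrictTotalDegree _ _ _).1 hp, fun _ => rfl⟩

instance finiteDimensional_polySpace : FiniteDimensional ℝ (polySpace d k) := by
  rw [polySpace_eq_map]
  infer_instance

instance finiteDimensional_vecPolySubmodule : FiniteDimensional ℝ (vecPolySubmodule d k) := by
  let components : vecPolySubmodule d k →ₗ[ℝ] (Fin d → polySpace d k) :=
    { toFun := fun u i => ⟨fun x => u.1 x i, u.2 i⟩
      map_add' := fun u v => by ext; simp
      map_smul' := fun c v => by ext; simp }
  refine FiniteDimensional.of_injective components fun u v h => ?_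
  ext x i
  exact congrFun (congrArg Subtype.val (congrFun h i)) x

lemma const_mem_polySpace (c : ℝ) : (fun _ : Eu d => c) ∈ polySpace d k :=
  ⟨MvPolynomial.C c, by simp, by simp⟩

lemma eq_const_of_mem_polySpace_zero {f : Eu d → ℝ} (hf : f ∈ polySpace d 0) :
    ∃ c : ℝ, f = fun _ => c := by
  obtain ⟨p, hp, h⟩ := hf
  rw [Nat.le_zero, MvPolynomial.totalDegree_eq_zero_iff_eq_C] at hp
  refine ⟨p.coeff 0, funext fun x => ?_⟩
  rw [h, hp]
  simp

lemma analyticOnNhd_of_mem_polySpace {f : Eu d → ℝ} (hf : f ∈ polySpace d k) :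
    AnalyticOnNhd ℝ f Set.univ := by
  obtain ⟨p, -, h⟩ := hf
  rw [funext h]
  exact AnalyticOnNhd.aeval_mvPolynomial (A := ℝ) (f := fun (x : Eu d) (i : Fin d) => x i)
    (fun i x _ => (EuclideanSpace.proj (𝕜 := ℝ) i).analyticAt x) p

lemma analyticOnNhd_of_mem_vecPoly {u : Eu d → Eu d} (hu : u ∈ vecPoly d k) :
    AnalyticOnNhd ℝ u Set.univ :=
  ((EuclideanSpace.equiv (Fin d) ℝ).symm.toContinuousLinearMap.analyticOnNhd Set.univ).comp
    (AnalyticOnNhd.pi fun i => analyticOnNhd_of_mem_polySpace (hu i)) fun _ _ => Set.mem_univ _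

lemma contDiff_of_mem_polySpace {f : Eu d → ℝ} (hf : f ∈ polySpace d k) : ContDiff ℝ ∞ f :=
  (analyticOnNhd_of_mem_polySpace hf).contDiff

lemma contDiff_of_mem_vecPoly {u : Eu d → Eu d} (hu : u ∈ vecPoly d k) : ContDiff ℝ ∞ u :=
  (analyticOnNhd_of_mem_vecPoly hu).contDiff

lemma continuous_of_mem_vecPoly {u : Eu d → Eu d} (hu : u ∈ vecPoly d k) : Continuous u :=
  (contDiff_of_mem_vecPoly hu).continuous

lemma differentiable_of_mem_vecPoly {u : Eu d → Eu d} (hu : u ∈ vecPoly d k) :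
    Differentiable ℝ u :=
  (contDiff_of_mem_vecPoly hu).differentiable (by simp)

lemma continuous_fderiv_of_mem_vecPoly {u : Eu d → Eu d} (hu : u ∈ vecPoly d k) :
    Continuous (fderiv ℝ u) :=
  (contDiff_of_mem_vecPoly hu).continuous_fderiv (by simp)

lemma comp_add_smul_mem_polySpace {f : Eu d → ℝ} (hf : f ∈ polySpace d k) (c : Eu d) (h : ℝ) :
    (fun y => f (c + h • y)) ∈ polySpace d k := by
  obtain ⟨p, hp, hpf⟩ := hf
  let l : Fin d → MvPolynomial (Fin d) ℝ :=
    fun i => MvPolynomial.C (c i) + MvPolynomial.C h * MvPolynomial.X i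
  have hl : ∀ i, (l i).totalDegree ≤ 1 := fun i =>
    (MvPolynomial.totalDegree_add _ _).trans (max_le (by simp)
      ((MvPolynomial.totalDegree_mul _ _).trans (by simp)))
  refine ⟨MvPolynomial.aeval l p, ?_, fun y => ?_⟩
  · rw [MvPolynomial.aeval_def, MvPolynomial.eval₂_eq]
    refine MvPolynomial.totalDegree_finsetSum_le fun s hs => ?_
    rw [MvPolynomial.algebraMap_eq]
    calc (MvPolynomial.C (p.coeff s) * ∏ i ∈ s.support, l i ^ s i).totalDegree
        ≤ (∏ i ∈ s.support, l i ^ s i).totalDegree := by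
          simpa using MvPolynomial.totalDegree_mul (MvPolynomial.C (p.coeff s)) _
      _ ≤ ∑ i ∈ s.support, (l i ^ s i).totalDegree := MvPolynomial.totalDegree_finsetProd _ _
      _ ≤ ∑ i ∈ s.support, s i := Finset.sum_le_sum fun i _ =>
          (MvPolynomial.totalDegree_pow _ _).trans (by simpa using Nat.mul_le_mul_left (s i) (hl i))
      _ ≤ k := (MvPolynomial.le_totalDegree hs).trans hp
  · change f (c + h • y) = _
    rw [hpf, MvPolynomial.aeval_def, MvPolynomial.eval₂_eq, MvPolynomial.eval_eq]
    simp [l]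

end Polynomials

/-! ### The Jacobian and its inverse estimate -/

/-- The Jacobian matrix of `u` at `x`, as a list of partial derivatives, in the Hilbert space of
matrices with the Frobenius norm. -/
def jacobian {d : ℕ} (u : Eu d → Eu d) (x : Eu d) : PiLp 2 fun _ : Fin d => Eu d :=
  WithLp.toLp 2 fun i => fderiv ℝ u x (EuclideanSpace.single i 1)

section Jacobian

variable {d k : ℕ} {u u' v : Eu d → Eu d}

lemma gradProd_eq_inner (u v : Eu d → Eu d) (x : Eu d) :
    gradProd u v x = inner ℝ (jacobian u x) (jacobian v x) :=
  (PiLp.inner_apply (jacobian u x) (jacobian v x)).symm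

lemma gradProd_self_eq_norm_sq (u : Eu d → Eu d) (x : Eu d) :
    gradProd u u x = ‖jacobian u x‖ ^ 2 := by
  rw [gradProd_eq_inner, real_inner_self_eq_norm_sq]

lemma gradProd_self_nonneg (u : Eu d → Eu d) (x : Eu d) : 0 ≤ gradProd u u x := by
  rw [gradProd_self_eq_norm_sq]
  positivity

lemma jacobian_add (hu : Differentiable ℝ u) (hv : Differentiable ℝ v) (x : Eu d) :
    jacobian (u + v) x = jacobian u x + jacobian v x := by
  ext i
  simp [jacobian, fderiv_add (hu x) (hv x)]

lemma jacobian_smul (hu : Differentiable ℝ u) (c : ℝ) (x : Eu d) :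
    jacobian (c • u) x = c • jacobian u x := by
  ext i
  simp [jacobian, fderiv_const_smul (hu x) c]

/-- The Jacobian of polynomial vector fields, as a linear map. -/
def jacobianₗ : vecPolySubmodule d k →ₗ[ℝ] (Eu d → PiLp 2 fun _ : Fin d => Eu d) where
  toFun u := jacobian u
  map_add' u v := funext (jacobian_add (differentiable_of_mem_vecPoly u.2)
    (differentiable_of_mem_vecPoly v.2))
  map_smul' c u := funext (jacobian_smul (differentiable_of_mem_vecPoly u.2) c)

lemma jacobian_comp_add_smul (hu : Differentiable ℝ u) (c : Eu d) (h : ℝ) (y : Eu d) :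
    jacobian (fun z => u (c + h • z)) y = h • jacobian u (c + h • y) := by
  have hderiv : HasFDerivAt (fun z => u (c + h • z))
      ((fderiv ℝ u (c + h • y)).comp (h • ContinuousLinearMap.id ℝ (Eu d))) y :=
    (hu _).hasFDerivAt.comp y (((hasFDerivAt_id y).const_smul h).const_add c)
  ext i
  simp [jacobian, hderiv.fderiv]

lemma norm_fderiv_apply_sq_le (u : Eu d → Eu d) (x : Eu d) {n : Eu d} (hn : ‖n‖ = 1) :
    ‖fderiv ℝ u x n‖ ^ 2 ≤ gradProd u u x := by
  set e : Fin d → Eu d := fun i => EuclideanSpace.single i 1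
  have hsum : fderiv ℝ u x n = ∑ i, n i • fderiv ℝ u x (e i) := by
    conv_lhs => rw [← (EuclideanSpace.basisFun (Fin d) ℝ).sum_repr n]
    simp [e]
  have hnorm : ∑ i, ‖n i‖ ^ 2 = 1 := by rw [← EuclideanSpace.norm_sq_eq, hn, one_pow]
  calc ‖fderiv ℝ u x n‖ ^ 2
      ≤ (∑ i, ‖n i‖ * ‖fderiv ℝ u x (e i)‖) ^ 2 := by
        rw [hsum]
        gcongr
        exact (norm_sum_le _ _).trans_eq (Finset.sum_congr rfl fun i _ => norm_smul _ _)
    _ ≤ (∑ i, ‖n i‖ ^ 2) * ∑ i, ‖fderiv ℝ u x (e i)‖ ^ 2 := Finset.sum_mul_sq_le_sq_mul_sq _ _ _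
    _ = gradProd u u x := by
        rw [hnorm, one_mul]
        exact Finset.sum_congr rfl fun i _ => (real_inner_self_eq_norm_sq _).symm

lemma analyticOnNhd_jacobian (hu : u ∈ vecPoly d k) : AnalyticOnNhd ℝ (jacobian u) Set.univ :=
  ((PiLp.continuousLinearEquiv 2 ℝ fun _ : Fin d => Eu d).symm.toContinuousLinearMap.analyticOnNhd
    Set.univ).comp (AnalyticOnNhd.pi fun i x hx =>
      ((ContinuousLinearMap.apply ℝ (Eu d) (EuclideanSpace.single i (1 : ℝ))).analyticAt _).comp
        ((analyticOnNhd_of_mem_vecPoly hu).fderiv x hx)) fun _ _ => Set.mem_univ _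

lemma continuous_gradProd (hu : u ∈ vecPoly d k) (hv : v ∈ vecPoly d k) :
    Continuous (gradProd u v) := by
  rw [funext (gradProd_eq_inner u v)]
  exact (continuousOn_univ.1 (analyticOnNhd_jacobian hu).continuousOn).inner
    (continuousOn_univ.1 (analyticOnNhd_jacobian hv).continuousOn)

end Jacobian

lemma exists_norm_le_mul_norm_of_injective {V E F : Type*} [AddCommGroup V] [Module ℝ V]
    [FiniteDimensional ℝ V] [NormedAddCommGroup E] [NormedSpace ℝ E] [NormedAddCommGroup F]
    [NormedSpace ℝ F] (A : V →ₗ[ℝ] E) (B : V →ₗ[ℝ] F) (hB : Function.Injective B) :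
    ∃ C : ℝ, 0 ≤ C ∧ ∀ v, ‖A v‖ ≤ C * ‖B v‖ := by
  let e := LinearEquiv.ofInjective B hB
  let G : LinearMap.range B →L[ℝ] E := LinearMap.toContinuousLinearMap (A ∘ₗ e.symm.toLinearMap)
  refine ⟨‖G‖, norm_nonneg G, fun v => ?_⟩
  have hG : G (e v) = A v := congrArg A (e.symm_apply_apply v)
  exact hG ▸ G.le_opNorm (e v)

section AnalyticFunctions

variable {E H : Type*} [NormedAddCommGroup E] [NormedSpace ℝ E] [MeasurableSpace E]
  [NormedAddCommGroup H] [InnerProductSpace ℝ H]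

lemma eq_zero_of_analyticOnNhd_of_ae_eq_zero {μ : Measure E} [μ.IsOpenPosMeasure] {B : Set E}
    (hB : (interior B).Nonempty) {f : E → H} (hf : AnalyticOnNhd ℝ f Set.univ)
    (h : f =ᵐ[μ.restrict B] 0) : f = 0 := by
  obtain ⟨z, hz⟩ := hB
  have hzero : Set.EqOn f 0 (interior B) := Measure.eqOn_open_of_ae_eq
    (ae_restrict_of_ae_restrict_of_subset interior_subset h) isOpen_interior
    (hf.continuousOn.mono (Set.subset_univ _)) continuousOn_const
  exact hf.eq_of_eventuallyEq analyticOnNhd_const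
    (Filter.eventually_of_mem (isOpen_interior.mem_nhds hz) hzero)

variable [OpensMeasurableSpace E] [SecondCountableTopologyEither E H]

/-- `L²(B)` is a norm on `P` because a non-zero analytic function cannot vanish on an open set, and
any two norms on a finite-dimensional space are equivalent. -/
lemma exists_norm_sq_le_integral_norm_sq (P : Submodule ℝ (E → H)) [FiniteDimensional ℝ P]
    (hP : ∀ f ∈ P, AnalyticOnNhd ℝ f Set.univ) (μ : Measure E) [μ.IsOpenPosMeasure]
    [IsFiniteMeasureOnCompacts μ] {K B : Set E} (hK : IsCompact K) (hB : IsCompact B)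
    (hBint : (interior B).Nonempty) :
    ∃ C : ℝ, 0 ≤ C ∧ ∀ f ∈ P, ∀ x ∈ K, ‖f x‖ ^ 2 ≤ C * ∫ y in B, ‖f y‖ ^ 2 ∂μ := by
  have hcont : ∀ f ∈ P, Continuous f := fun f hf => continuousOn_univ.1 (hP f hf).continuousOn
  have hmem : ∀ f ∈ P, MemLp f 2 (μ.restrict B) := fun f hf =>
    (memLp_two_iff_integrable_sq_norm (hcont f hf).aestronglyMeasurable).2
      (((hcont f hf).norm.pow 2).continuousOn.integrableOn_compact hB)
  let toL2 : P →ₗ[ℝ] Lp H 2 (μ.restrict B) :=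
    { toFun := fun f => (hmem f f.2).toLp
      map_add' := fun f g => MemLp.toLp_add (hmem f f.2) (hmem g g.2)
      map_smul' := fun c f => MemLp.toLp_const_smul c (hmem f f.2) }
  let restrict : P →ₗ[ℝ] C(K, H) :=
    { toFun := fun f => ⟨fun x => f.1 x, (hcont f.1 f.2).comp continuous_subtype_val⟩
      map_add' := fun f g => by ext; simp
      map_smul' := fun c f => by ext; simp }
  have hinj : Function.Injective toL2 := by
    rw [injective_iff_map_eq_zero]
    exact fun f hf => Subtype.ext (eq_zero_of_analyticOnNhd_of_ae_eq_zero hBint (hP f f.2)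
      ((hmem f f.2).coeFn_toLp.symm.trans (Lp.eq_zero_iff_ae_eq_zero.1 hf)))
  have hnorm : ∀ f : P, ‖toL2 f‖ ^ 2 = ∫ y in B, ‖f.1 y‖ ^ 2 ∂μ := fun f => by
    rw [← real_inner_self_eq_norm_sq, L2.inner_def]
    refine integral_congr_ae ((hmem f f.2).coeFn_toLp.mono fun y hy => ?_)
    exact (real_inner_self_eq_norm_sq _).trans (congrArg (‖·‖ ^ 2) hy)
  have : CompactSpace K := isCompact_iff_compactSpace.1 hK
  obtain ⟨C, -, hC⟩ := exists_norm_le_mul_norm_of_injective restrict toL2 hinj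
  refine ⟨C ^ 2, by positivity, fun f hf x hx => ?_⟩
  have hx_le : ‖f x‖ ≤ C * ‖toL2 ⟨f, hf⟩‖ :=
    ((restrict ⟨f, hf⟩).norm_coe_le_norm ⟨x, hx⟩).trans (hC ⟨f, hf⟩)
  calc ‖f x‖ ^ 2 ≤ (C * ‖toL2 ⟨f, hf⟩‖) ^ 2 := by gcongr
    _ = C ^ 2 * ∫ y in B, ‖f y‖ ^ 2 ∂μ := by rw [mul_pow, hnorm]

end AnalyticFunctions

lemma setIntegral_closedBall_comp_add_smul {d : ℕ} (f : Eu d → ℝ) (c : Eu d) {h : ℝ} (hh : 0 < h)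
    (r : ℝ) : ∫ y in Metric.closedBall 0 r, f (c + h • y)
      = (h ^ d)⁻¹ * ∫ y in Metric.closedBall c (h * r), f y := by
  have hpre : (fun y : Eu d => c + h • y) ⁻¹' Metric.closedBall c (h * r)
      = Metric.closedBall 0 r := by
    ext y
    simp [norm_smul, abs_of_pos hh, hh]
  set g : Eu d → ℝ := (Metric.closedBall c (h * r)).indicator f with hg
  calc ∫ y in Metric.closedBall 0 r, f (c + h • y)
      = ∫ y, g (c + h • y) := by
        rw [← hpre, ← integral_indicator (measurableSet_closedBall.preimage (by fun_prop))]
        rfl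
    _ = (h ^ d)⁻¹ * ∫ y, g (c + y) := by
        rw [Measure.integral_comp_smul volume (fun z => g (c + z)) h]
        simp [abs_of_pos (pow_pos hh d)]
    _ = (h ^ d)⁻¹ * ∫ y in Metric.closedBall c (h * r), f y := by
        rw [integral_add_left_eq_self, hg, integral_indicator measurableSet_closedBall]

section InverseEstimate

variable (d k : ℕ)

lemma exists_gradProd_le_integral_gradProd {K B : Set (Eu d)} (hK : IsCompact K)
    (hB : IsCompact B) (hBint : (interior B).Nonempty) :
    ∃ C : ℝ, 0 ≤ C ∧ ∀ u ∈ vecPoly d k, ∀ x ∈ K,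
      gradProd u u x ≤ C * ∫ y in B, gradProd u u y := by
  obtain ⟨C, hC0, hC⟩ := exists_norm_sq_le_integral_norm_sq (LinearMap.range jacobianₗ)
    (by rintro _ ⟨u, rfl⟩; exact analyticOnNhd_jacobian u.2) volume hK hB hBint
  refine ⟨C, hC0, fun u hu x hx => ?_⟩
  simpa only [gradProd_self_eq_norm_sq] using hC (jacobian u) ⟨⟨u, hu⟩, rfl⟩ x hx

/-- The power of `h` comes from pulling back to the unit ball with `y ↦ c + h y`. -/
lemma exists_gradProd_le_integral_closedBall {σ : ℝ} (hσ : 0 < σ) :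
    ∃ C : ℝ, 0 ≤ C ∧ ∀ u ∈ vecPoly d k, ∀ (c : Eu d) (h : ℝ), 0 < h →
      ∀ x ∈ Metric.closedBall c h,
      gradProd u u x ≤ C / h ^ d * ∫ y in Metric.closedBall c (h / σ), gradProd u u y := by
  obtain ⟨C, hC0, hC⟩ := exists_gradProd_le_integral_gradProd d k
    (isCompact_closedBall (0 : Eu d) 1) (isCompact_closedBall 0 σ⁻¹)
    ⟨0, mem_interior_iff_mem_nhds.2 (Metric.closedBall_mem_nhds 0 (inv_pos.2 hσ))⟩
  refine ⟨C, hC0, fun u hu c h hh x hx => ?_⟩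
  have hscaled : ∀ y, gradProd (fun z => u (c + h • z)) (fun z => u (c + h • z)) y
      = h ^ 2 * gradProd u u (c + h • y) := fun y => by
    rw [gradProd_self_eq_norm_sq, jacobian_comp_add_smul (differentiable_of_mem_vecPoly hu),
      norm_smul, mul_pow, Real.norm_of_nonneg hh.le, gradProd_self_eq_norm_sq]
  have hx' : h⁻¹ • (x - c) ∈ Metric.closedBall (0 : Eu d) 1 := by
    rw [mem_closedBall_zero_iff, norm_smul, Real.norm_of_nonneg (by positivity),
      inv_mul_le_iff₀ hh, mul_one, ← dist_eq_norm]
    exact hx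
  have hunit := hC _ (fun i => comp_add_smul_mem_polySpace (hu i) c h) _ hx'
  simp only [hscaled] at hunit
  rw [integral_const_mul, setIntegral_closedBall_comp_add_smul (gradProd u u) c hh,
    smul_inv_smul₀ hh.ne', add_sub_cancel, ← div_eq_mul_inv] at hunit
  refine le_of_mul_le_mul_left (hunit.trans_eq ?_) (pow_pos hh 2)
  field_simp

end InverseEstimate

/-! ### Geometry of a simplex -/

lemma affineMap_map_sum_smul {k V W ι : Type*} [Ring k] [AddCommGroup V] [Module k V]
    [AddCommGroup W] [Module k W] (f : V →ᵃ[k] W) (s : Finset ι) (p : ι → V) {w : ι → k}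
    (hw : ∑ i ∈ s, w i = 1) : f (∑ i ∈ s, w i • p i) = ∑ i ∈ s, w i • f (p i) := by
  rw [← s.affineCombination_eq_linear_combination p w hw, s.map_affineCombination p w hw f,
    s.affineCombination_eq_linear_combination _ w hw]
  rfl

/-- The relative interior of the simplex with vertex set `F`: the points all of whose barycentric
coordinates are positive. -/
def relInt {d : ℕ} (F : Finset (Eu d)) : Set (Eu d) :=
  {x | ∃ w : Eu d → ℝ, (∀ u ∈ F, 0 < w u) ∧ ∑ u ∈ F, w u = 1 ∧ ∑ u ∈ F, w u • u = x}

section Hull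

variable {d : ℕ} {F T : Finset (Eu d)}

lemma isCompact_hull (F : Finset (Eu d)) : IsCompact (hull F) :=
  F.finite_toSet.isCompact_convexHull ℝ

lemma isClosed_hull (F : Finset (Eu d)) : IsClosed (hull F) := (isCompact_hull F).isClosed

lemma convex_hull (F : Finset (Eu d)) : Convex ℝ (hull F) := convex_convexHull ℝ _

lemma subset_hull (F : Finset (Eu d)) : (F : Set (Eu d)) ⊆ hull F := subset_convexHull ℝ _

lemma hull_mono (hFT : F ⊆ T) : hull F ⊆ hull T := convexHull_mono (Finset.coe_subset.2 hFT)

lemma mem_hull_iff {x : Eu d} :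
    x ∈ hull F ↔ ∃ w : Eu d → ℝ, (∀ u ∈ F, 0 ≤ w u) ∧ ∑ u ∈ F, w u = 1 ∧ ∑ u ∈ F, w u • u = x :=
  Finset.mem_convexHull'

lemma hull_ae_eq_interior (F : Finset (Eu d)) : hull F =ᵐ[volume] interior (hull F) :=
  (interior_ae_eq_of_null_frontier ((convex_hull F).addHaar_frontier volume)).symm

lemma relInt_subset_hull (F : Finset (Eu d)) : relInt F ⊆ hull F :=
  fun _ ⟨w, hw, hsum, hx⟩ => mem_hull_iff.2 ⟨w, fun u hu => (hw u hu).le, hsum, hx⟩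

lemma sum_inv_card (hF : F.Nonempty) : ∑ _u ∈ F, (F.card : ℝ)⁻¹ = 1 := by
  rw [Finset.sum_const, nsmul_eq_mul,
    mul_inv_cancel₀ (Nat.cast_ne_zero.2 hF.card_pos.ne')]

lemma barycentre_mem_relInt (hF : F.Nonempty) : barycentre F ∈ relInt F :=
  ⟨fun _ => (F.card : ℝ)⁻¹, fun _ _ => inv_pos.2 (Nat.cast_pos.2 hF.card_pos), sum_inv_card hF,
    Finset.smul_sum.symm⟩

lemma openSegment_subset_relInt {x y : Eu d} (hx : x ∈ hull F) (hy : y ∈ relInt F) :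
    openSegment ℝ x y ⊆ relInt F := by
  obtain ⟨w, hw, hw_sum, rfl⟩ := mem_hull_iff.1 hx
  obtain ⟨w', hw', hw'_sum, rfl⟩ := hy
  rintro _ ⟨a, b, ha, hb, hab, rfl⟩
  refine ⟨fun u => a * w u + b * w' u, fun u hu => ?_, ?_, ?_⟩
  · exact add_pos_of_nonneg_of_pos (mul_nonneg ha.le (hw u hu)) (mul_pos hb (hw' u hu))
  · rw [Finset.sum_add_distrib, ← Finset.mul_sum, ← Finset.mul_sum, hw_sum, hw'_sum, mul_one,
      mul_one, hab]
  · simp only [add_smul, mul_smul, Finset.sum_add_distrib, ← Finset.smul_sum]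

lemma hull_subset_closure_relInt (hF : F.Nonempty) : hull F ⊆ closure (relInt F) := fun x hx =>
  closure_mono (openSegment_subset_relInt hx (barycentre_mem_relInt hF))
    (segment_subset_closure_openSegment (left_mem_segment ℝ x (barycentre F)))

end Hull

/-- `T` is the vertex set of a non-degenerate `d`-simplex in `ℝ^d`. -/
structure IsCell {d : ℕ} (T : Finset (Eu d)) : Prop where
  card_eq : T.card = d + 1
  indep : AffineIndependent ℝ ((↑) : T → Eu d)

namespace IsCell

variable {d : ℕ} {F T : Finset (Eu d)} (h : IsCell T)

include h in
lemma nonempty : T.Nonempty := Finset.card_pos.1 (h.card_eq ▸ Nat.succ_pos d)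

/-- The vertices of a non-degenerate simplex as an affine basis of `ℝ^d`. -/
def basis : AffineBasis T ℝ (Eu d) :=
  ⟨(↑), h.indep, by
    rw [h.indep.affineSpan_eq_top_iff_card_eq_finrank_add_one]
    simp [h.card_eq]⟩

open Classical in
/-- The barycentric coordinate of the simplex `T` that belongs to its vertex `v`; it is `0` if `v`
is not a vertex. -/
def coord (v : Eu d) : Eu d →ᵃ[ℝ] ℝ := if hv : v ∈ T then h.basis.coord ⟨v, hv⟩ else 0

lemma coord_of_mem {v : Eu d} (hv : v ∈ T) : h.coord v = h.basis.coord ⟨v, hv⟩ := dif_pos hv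

lemma continuous_coord (v : Eu d) : Continuous (h.coord v) :=
  (h.coord v).continuous_of_finiteDimensional

lemma coord_apply_self {v : Eu d} (hv : v ∈ T) : h.coord v v = 1 := by
  rw [h.coord_of_mem hv]
  exact h.basis.coord_apply_eq ⟨v, hv⟩

lemma coord_apply_of_ne {v w : Eu d} (hw : w ∈ T) (hne : v ≠ w) : h.coord v w = 0 := by
  by_cases hv : v ∈ T
  · rw [h.coord_of_mem hv]
    exact h.basis.coord_apply_ne (i := ⟨v, hv⟩) (j := ⟨w, hw⟩) (by simpa using hne)
  · rw [coord, dif_neg hv, AffineMap.coe_zero, Pi.zero_apply]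

lemma sum_coord (x : Eu d) : ∑ v ∈ T, h.coord v x = 1 := by
  rw [← h.basis.sum_coord_apply_eq_one x, ← Finset.sum_coe_sort]
  exact Finset.sum_congr rfl fun v _ => by rw [h.coord_of_mem v.2]

lemma sum_coord_smul (x : Eu d) : ∑ v ∈ T, h.coord v x • v = x := by
  conv_rhs => rw [← h.basis.linear_combination_coord_eq_self x]
  rw [← Finset.sum_coe_sort]
  exact Finset.sum_congr rfl fun v _ => by rw [h.coord_of_mem v.2]; rfl

lemma coord_sum_smul (hFT : F ⊆ T) {w : Eu d → ℝ} (hw : ∑ u ∈ F, w u = 1) (v : Eu d)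
    [Decidable (v ∈ F)] : h.coord v (∑ u ∈ F, w u • u) = if v ∈ F then w v else 0 := by
  rw [affineMap_map_sum_smul _ _ _ hw]
  split_ifs with hv
  · rw [Finset.sum_eq_single_of_mem v hv, h.coord_apply_self (hFT hv), smul_eq_mul, mul_one]
    intro u hu hne
    rw [h.coord_apply_of_ne (hFT hu) hne.symm, smul_zero]
  · refine Finset.sum_eq_zero fun u hu => ?_
    rw [h.coord_apply_of_ne (hFT hu) (ne_of_mem_of_not_mem hu hv).symm, smul_zero]

lemma sum_coord_of_subset (hFT : F ⊆ T) {x : Eu d} (hx : ∀ v ∈ T, v ∉ F → h.coord v x = 0) :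
    ∑ v ∈ F, h.coord v x = 1 := by
  rw [← h.sum_coord x]
  exact Finset.sum_subset hFT hx

lemma sum_coord_smul_of_subset (hFT : F ⊆ T) {x : Eu d}
    (hx : ∀ v ∈ T, v ∉ F → h.coord v x = 0) : ∑ v ∈ F, h.coord v x • v = x := by
  conv_rhs => rw [← h.sum_coord_smul x]
  exact Finset.sum_subset hFT fun v hv hv' => by rw [hx v hv hv', zero_smul]

lemma exists_weights_iff (hFT : F ⊆ T) (p : ℝ → Prop) {x : Eu d} :
    (∃ w : Eu d → ℝ, (∀ u ∈ F, p (w u)) ∧ ∑ u ∈ F, w u = 1 ∧ ∑ u ∈ F, w u • u = x) ↔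
      (∀ v ∈ F, p (h.coord v x)) ∧ ∀ v ∈ T, v ∉ F → h.coord v x = 0 := by
  classical
  constructor
  · rintro ⟨w, hw, hsum, rfl⟩
    refine ⟨fun v hv => ?_, fun v _ hv => ?_⟩
    · rw [h.coord_sum_smul hFT hsum, if_pos hv]
      exact hw v hv
    · rw [h.coord_sum_smul hFT hsum, if_neg hv]
  · rintro ⟨hp, hx⟩
    exact ⟨fun v => h.coord v x, hp, h.sum_coord_of_subset hFT hx,
      h.sum_coord_smul_of_subset hFT hx⟩

lemma mem_hull_subset_iff (hFT : F ⊆ T) {x : Eu d} :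
    x ∈ hull F ↔ (∀ v ∈ F, 0 ≤ h.coord v x) ∧ ∀ v ∈ T, v ∉ F → h.coord v x = 0 :=
  mem_hull_iff.trans (h.exists_weights_iff hFT (0 ≤ ·))

lemma mem_relInt_iff (hFT : F ⊆ T) {x : Eu d} :
    x ∈ relInt F ↔ (∀ v ∈ F, 0 < h.coord v x) ∧ ∀ v ∈ T, v ∉ F → h.coord v x = 0 :=
  h.exists_weights_iff hFT (0 < ·)

lemma mem_hull_iff {x : Eu d} : x ∈ hull T ↔ ∀ v ∈ T, 0 ≤ h.coord v x :=
  (h.mem_hull_subset_iff subset_rfl).trans (and_iff_left fun _ hv hv' => absurd hv hv')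

lemma mem_interior_iff {x : Eu d} : x ∈ interior (hull T) ↔ ∀ v ∈ T, 0 < h.coord v x := by
  have hrange : Set.range h.basis = (T : Set (Eu d)) := Subtype.range_coe
  have hinterior := h.basis.interior_convexHull
  rw [hrange] at hinterior
  rw [hull, hinterior]
  simp only [Set.mem_ofPred_eq, Subtype.forall]
  exact forall₂_congr fun v hv => by rw [h.coord_of_mem hv]

include h in
lemma interior_nonempty : (interior (hull T)).Nonempty :=
  ⟨barycentre T, h.mem_interior_iff.2
    ((h.mem_relInt_iff subset_rfl).1 (barycentre_mem_relInt h.nonempty)).1⟩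

include h in
lemma hull_subset_closure_interior : hull T ⊆ closure (interior (hull T)) := by
  rw [(convex_hull T).closure_interior_eq_closure_of_nonempty_interior h.interior_nonempty]
  exact subset_closure

include h in
lemma notMem_hull_of_mem_interior (hFT : F ⊂ T) {x : Eu d} (hx : x ∈ interior (hull T)) :
    x ∉ hull F := fun hxF =>
  let ⟨v, hv, hv'⟩ := Finset.exists_of_ssubset hFT
  (h.mem_interior_iff.1 hx v hv).ne' (((h.mem_hull_subset_iff hFT.subset).1 hxF).2 v hv hv')

lemma coord_barycentre (hFT : F ⊆ T) (hF : F.Nonempty) (v : Eu d) [Decidable (v ∈ F)] :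
    h.coord v (barycentre F) = if v ∈ F then (F.card : ℝ)⁻¹ else 0 := by
  rw [barycentre, Finset.smul_sum]
  exact h.coord_sum_smul hFT (sum_inv_card hF) v

end IsCell

/-- `F` is the face, assumed non-empty, of the simplex `T` opposite to its vertex `v`. -/
structure IsFace {d : ℕ} (T F : Finset (Eu d)) (v : Eu d) : Prop where
  nonempty : F.Nonempty
  subset : F ⊆ T
  mem : v ∈ T
  notMem : v ∉ F
  eq_or_mem : ∀ u ∈ T, u = v ∨ u ∈ F

lemma IsCell.exists_isFace {d : ℕ} {T F : Finset (Eu d)} (h : IsCell T) (hFT : F ⊆ T)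
    (hc : F.card = d) (hF : F.Nonempty) : ∃ v, IsFace T F v := by
  classical
  have hcard : (T \ F).card = 1 := by
    rw [Finset.card_sdiff_of_subset hFT, h.card_eq, hc, Nat.add_sub_cancel_left]
  obtain ⟨v, hv⟩ := Finset.card_eq_one.1 hcard
  have hv_iff : ∀ u, u ∈ T ∧ u ∉ F ↔ u = v := fun u => by
    rw [← Finset.mem_sdiff, hv, Finset.mem_singleton]
  exact ⟨v, hF, hFT, ((hv_iff v).2 rfl).1, ((hv_iff v).2 rfl).2, fun u hu =>
    or_iff_not_imp_right.2 fun hu' => (hv_iff u).1 ⟨hu, hu'⟩⟩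

lemma outwardNormal_mem_orthogonal {d : ℕ} (T F : Finset (Eu d)) :
    outwardNormal T F ∈ (vectorSpan ℝ (F : Set (Eu d)))ᗮ :=
  Submodule.smul_mem _ _ (Submodule.starProjection_apply_mem _ _)

namespace IsFace

variable {d : ℕ} {T F : Finset (Eu d)} {v : Eu d} (h : IsCell T) (hF : IsFace T F v)

include hF

lemma forall_mem_cell {p : Eu d → Prop} : (∀ u ∈ T, p u) ↔ p v ∧ ∀ u ∈ F, p u := by
  refine ⟨fun hp => ⟨hp v hF.mem, fun u hu => hp u (hF.subset hu)⟩, fun hp u hu => ?_⟩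
  rcases hF.eq_or_mem u hu with rfl | huF
  · exact hp.1
  · exact hp.2 u huF

lemma coord_of_notMem {x : Eu d} (hx : h.coord v x = 0) : ∀ u ∈ T, u ∉ F → h.coord u x = 0 :=
  hF.forall_mem_cell.2 ⟨fun _ => hx, fun _ hu hu' => absurd hu hu'⟩

lemma coord_apply_of_mem {u : Eu d} (hu : u ∈ F) : h.coord v u = 0 :=
  h.coord_apply_of_ne (hF.subset hu) (ne_of_mem_of_not_mem hu hF.notMem).symm

lemma mem_relInt_iff {x : Eu d} :
    x ∈ relInt F ↔ (∀ u ∈ F, 0 < h.coord u x) ∧ h.coord v x = 0 := by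
  rw [h.mem_relInt_iff hF.subset]
  exact and_congr_right fun _ => ⟨fun hx => hx v hF.mem hF.notMem, hF.coord_of_notMem h⟩

lemma vectorSpan_eq_ker : vectorSpan ℝ (F : Set (Eu d)) = LinearMap.ker (h.coord v).linear := by
  apply le_antisymm
  · rw [vectorSpan_def, Submodule.span_le]
    rintro _ ⟨a, ha, b, hb, rfl⟩
    rw [SetLike.mem_coe, LinearMap.mem_ker]
    exact ((h.coord v).linearMap_vsub a b).trans (by
      rw [hF.coord_apply_of_mem h ha, hF.coord_apply_of_mem h hb, vsub_self])
  · intro y hy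
    obtain ⟨p, hp⟩ := hF.nonempty
    have hpy : h.coord v (p + y) = 0 := by
      rw [add_comm, ← vadd_eq_add, (h.coord v).map_vadd, LinearMap.mem_ker.1 hy, zero_vadd,
        hF.coord_apply_of_mem h hp]
    have hzero := hF.coord_of_notMem h hpy
    have hy_eq : y = ∑ u ∈ F, h.coord u (p + y) • (u - p) := by
      simp_rw [smul_sub, Finset.sum_sub_distrib, ← Finset.sum_smul,
        h.sum_coord_of_subset hF.subset hzero, h.sum_coord_smul_of_subset hF.subset hzero, one_smul,
        add_sub_cancel_left]
    rw [hy_eq]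
    exact Submodule.sum_mem _ fun u hu => Submodule.smul_mem _ _ (vsub_mem_vectorSpan ℝ hu hp)

lemma linear_coord_starProjection_orthogonal (y : Eu d) :
    (h.coord v).linear ((vectorSpan ℝ (F : Set (Eu d)))ᗮ.starProjection y)
      = (h.coord v).linear y := by
  have hmem := Submodule.sub_starProjection_mem_orthogonal
    (K := (vectorSpan ℝ (F : Set (Eu d)))ᗮ) y
  rw [Submodule.orthogonal_orthogonal, hF.vectorSpan_eq_ker h, LinearMap.mem_ker, map_sub,
    sub_eq_zero, ← hF.vectorSpan_eq_ker h] at hmem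
  exact hmem.symm

lemma linear_coord_barycentre_sub :
    (h.coord v).linear (barycentre F - barycentre T) = -(T.card : ℝ)⁻¹ := by
  classical
  refine ((h.coord v).linearMap_vsub (barycentre F) (barycentre T)).trans ?_
  rw [h.coord_barycentre hF.subset hF.nonempty, h.coord_barycentre subset_rfl h.nonempty,
    if_neg hF.notMem, if_pos hF.mem, vsub_eq_sub, zero_sub]

include h

lemma starProjection_barycentre_sub_ne_zero :
    (vectorSpan ℝ (F : Set (Eu d)))ᗮ.starProjection (barycentre F - barycentre T) ≠ 0 := by
  intro hzero
  have hval := hF.linear_coord_starProjection_orthogonal h (barycentre F - barycentre T)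
  rw [hF.linear_coord_barycentre_sub h, hzero, map_zero, eq_comm, neg_eq_zero, inv_eq_zero,
    Nat.cast_eq_zero] at hval
  exact h.nonempty.card_pos.ne' hval

lemma norm_outwardNormal : ‖outwardNormal T F‖ = 1 :=
  norm_smul_inv_norm (𝕜 := ℝ) (hF.starProjection_barycentre_sub_ne_zero h)

lemma linear_coord_outwardNormal_neg : (h.coord v).linear (outwardNormal T F) < 0 := by
  rw [outwardNormal, map_smul, hF.linear_coord_starProjection_orthogonal h,
    hF.linear_coord_barycentre_sub h]
  exact mul_neg_of_pos_of_neg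
    (inv_pos.2 (norm_pos_iff.2 (hF.starProjection_barycentre_sub_ne_zero h)))
    (neg_neg_of_pos (inv_pos.2 (Nat.cast_pos.2 h.nonempty.card_pos)))

/-- The kernel of the derivative of the barycentric coordinate is the hyperplane orthogonal to the
normal. -/
lemma linear_coord_eq_mul_inner (y : Eu d) :
    (h.coord v).linear y
      = (h.coord v).linear (outwardNormal T F) * inner ℝ y (outwardNormal T F) := by
  have ha := (hF.linear_coord_outwardNormal_neg h).ne
  set n := outwardNormal T F with hn
  set a := (h.coord v).linear n
  have hmem : y - (a⁻¹ * (h.coord v).linear y) • n ∈ vectorSpan ℝ (F : Set (Eu d)) := by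
    rw [hF.vectorSpan_eq_ker h, LinearMap.mem_ker, map_sub, map_smul, smul_eq_mul,
      mul_right_comm, inv_mul_cancel₀ ha, one_mul, sub_self]
  have horth := Submodule.inner_right_of_mem_orthogonal hmem (outwardNormal_mem_orthogonal T F)
  rw [← hn, inner_sub_left, real_inner_smul_left, real_inner_self_eq_norm_sq,
    hF.norm_outwardNormal h, one_pow, mul_one, sub_eq_zero] at horth
  rw [horth, mul_inv_cancel_left₀ ha]

lemma coord_eq_mul_inner {x₀ : Eu d} (hx₀ : x₀ ∈ relInt F) (x : Eu d) :
    h.coord v x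
      = (h.coord v).linear (outwardNormal T F) * inner ℝ (x - x₀) (outwardNormal T F) := by
  have hsub := (h.coord v).linearMap_vsub x x₀
  rw [vsub_eq_sub, vsub_eq_sub, ((hF.mem_relInt_iff h).1 hx₀).2, sub_zero] at hsub
  rw [← hsub, hF.linear_coord_eq_mul_inner h]

lemma eventually_coord_pos {x₀ : Eu d} (hx₀ : x₀ ∈ relInt F) :
    ∀ᶠ x in nhds x₀, ∀ u ∈ F, 0 < h.coord u x :=
  (Filter.eventually_all_finset F).2 fun u hu =>
    (h.continuous_coord u).continuousAt.eventually_const_lt (((hF.mem_relInt_iff h).1 hx₀).1 u hu)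

lemma eventually_mem_hull_iff {x₀ : Eu d} (hx₀ : x₀ ∈ relInt F) :
    ∀ᶠ x in nhds x₀, (x ∈ hull T ↔ inner ℝ (x - x₀) (outwardNormal T F) ≤ 0) := by
  filter_upwards [hF.eventually_coord_pos h hx₀] with x hx
  rw [h.mem_hull_iff, hF.forall_mem_cell, and_iff_left fun u hu => (hx u hu).le,
    hF.coord_eq_mul_inner h hx₀ x]
  have ha := hF.linear_coord_outwardNormal_neg h
  exact ⟨fun H => nonpos_of_mul_nonneg_right H ha, mul_nonneg_of_nonpos_of_nonpos ha.le⟩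

lemma eventually_mem_interior_iff {x₀ : Eu d} (hx₀ : x₀ ∈ relInt F) :
    ∀ᶠ x in nhds x₀, (x ∈ interior (hull T) ↔ inner ℝ (x - x₀) (outwardNormal T F) < 0) := by
  filter_upwards [hF.eventually_coord_pos h hx₀] with x hx
  rw [h.mem_interior_iff, hF.forall_mem_cell, and_iff_left hx, hF.coord_eq_mul_inner h hx₀ x]
  exact smul_pos_iff_of_neg_left (hF.linear_coord_outwardNormal_neg h)

lemma eq_inner_smul_outwardNormal {m : Eu d} (hm : m ∈ (vectorSpan ℝ (F : Set (Eu d)))ᗮ) :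
    m = inner ℝ m (outwardNormal T F) • outwardNormal T F := by
  set n := outwardNormal T F with hn
  have hmem : m - inner ℝ m n • n ∈ vectorSpan ℝ (F : Set (Eu d)) := by
    rw [hF.vectorSpan_eq_ker h, LinearMap.mem_ker, hF.linear_coord_eq_mul_inner h, ← hn,
      inner_sub_left, real_inner_smul_left, real_inner_self_eq_norm_sq, hF.norm_outwardNormal h,
      one_pow, mul_one, sub_self, mul_zero]
  have horth : m - inner ℝ m n • n ∈ (vectorSpan ℝ (F : Set (Eu d)))ᗮ :=
    Submodule.sub_mem _ hm (Submodule.smul_mem _ _ (outwardNormal_mem_orthogonal T F))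
  exact sub_eq_zero.1 (inner_self_eq_zero.1 (Submodule.inner_right_of_mem_orthogonal hmem horth))

lemma eq_or_eq_neg_outwardNormal {m : Eu d} (hm : m ∈ (vectorSpan ℝ (F : Set (Eu d)))ᗮ)
    (hm1 : ‖m‖ = 1) : m = outwardNormal T F ∨ m = -outwardNormal T F := by
  have hm_eq := hF.eq_inner_smul_outwardNormal h hm
  have habs : |inner ℝ m (outwardNormal T F)| = 1 := by
    rw [hm_eq, norm_smul, hF.norm_outwardNormal h, mul_one, Real.norm_eq_abs] at hm1
    exact hm1
  rcases eq_or_eq_neg_of_abs_eq habs with hone | hone <;> rw [hone] at hm_eq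
  · exact Or.inl (hm_eq.trans (one_smul ℝ _))
  · exact Or.inr (hm_eq.trans (neg_one_smul ℝ _))

end IsFace

/-! ### The surface measure of a face -/

/-- The isometric parametrization of the hyperplane through the face `F` and its vertex `p`. -/
def faceParam {d : ℕ} (F : Finset (Eu d)) (p : Eu d) (y : vectorSpan ℝ (F : Set (Eu d))) : Eu d :=
  p + y

lemma isometry_faceParam {d : ℕ} (F : Finset (Eu d)) (p : Eu d) : Isometry (faceParam F p) :=
  (isometry_vadd (Eu d) p).comp isometry_subtype_coe

lemma hull_subset_range_faceParam {d : ℕ} {F : Finset (Eu d)} {p : Eu d} (hp : p ∈ F) :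
    hull F ⊆ Set.range (faceParam F p) := by
  intro x hx
  have hxp := AffineSubspace.vsub_mem_direction (convexHull_subset_affineSpan _ hx)
    (subset_affineSpan ℝ (F : Set (Eu d)) hp)
  rw [direction_affineSpan] at hxp
  exact ⟨⟨x -ᵥ p, hxp⟩, add_sub_cancel p x⟩

lemma volume_closedBall_eq_of_finrank_eq {E : Type*} [NormedAddCommGroup E]
    [InnerProductSpace ℝ E] [FiniteDimensional ℝ E] [MeasurableSpace E] [BorelSpace E] {n : ℕ}
    (hn : Module.finrank ℝ E = n) (r : ℝ) :
    volume (Metric.closedBall (0 : E) r) = volume (Metric.closedBall (0 : Eu n) r) := by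
  let e := (stdOrthonormalBasis ℝ E).reindex (finCongr hn)
  rw [← e.measurePreserving_repr.measure_preimage
    Metric.isClosed_closedBall.measurableSet.nullMeasurableSet]
  congr 1
  ext x
  rw [Set.mem_preimage, mem_closedBall_zero_iff, mem_closedBall_zero_iff,
    LinearIsometryEquiv.norm_map]

namespace IsFace

variable {d : ℕ} {T F : Finset (Eu d)} {v : Eu d} (h : IsCell T) (hF : IsFace T F v)

include h hF

lemma card_eq : F.card = d := by
  classical
  have hT : T = insert v F := by
    ext u
    rw [Finset.mem_insert]
    exact ⟨hF.eq_or_mem u, fun hu => hu.elim (fun huv => huv ▸ hF.mem) fun huF => hF.subset huF⟩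
  have hcard := h.card_eq
  rw [hT, Finset.card_insert_of_notMem hF.notMem] at hcard
  exact Nat.succ_injective hcard

lemma finrank_vectorSpan : Module.finrank ℝ (vectorSpan ℝ (F : Set (Eu d))) = d - 1 := by
  have hindep : AffineIndependent ℝ ((↑) : F → Eu d) :=
    AffineIndependent.mono (k := ℝ) (t := (T : Set (Eu d))) (s := (F : Set (Eu d))) h.indep
      (Finset.coe_subset.2 hF.subset)
  have hpos : 0 < d := hF.card_eq h ▸ hF.nonempty.card_pos
  have hcard : Fintype.card F = d - 1 + 1 := by
    rw [Fintype.card_coe, hF.card_eq h, Nat.sub_add_cancel hpos]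
  have hrange : Set.range ((↑) : F → Eu d) = (F : Set (Eu d)) := Subtype.range_coe
  have hfinrank := hindep.finrank_vectorSpan hcard
  rwa [hrange] at hfinrank

lemma euclideanHausdorffMeasure_eq_volume :
    (μHE[d - 1] : Measure (vectorSpan ℝ (F : Set (Eu d)))) = volume := by
  rw [← hF.finrank_vectorSpan h]
  exact InnerProductSpace.euclideanHausdorffMeasure_eq_volume

lemma restrict_hull_eq_map {p : Eu d} (hp : p ∈ F) :
    (μHE[d - 1] : Measure (Eu d)).restrict (hull F) =
      (volume.restrict (faceParam F p ⁻¹' hull F)).map (faceParam F p) := by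
  rw [← hF.euclideanHausdorffMeasure_eq_volume h,
    ← Measure.restrict_map (isometry_faceParam F p).continuous.measurable
      (isClosed_hull F).measurableSet,
    (isometry_faceParam F p).map_euclideanHausdorffMeasure,
    Measure.restrict_restrict (isClosed_hull F).measurableSet,
    Set.inter_eq_left.2 (hull_subset_range_faceParam hp)]

lemma measure_hull_eq {p : Eu d} (hp : p ∈ F) :
    (μHE[d - 1] : Measure (Eu d)) (hull F) = volume (faceParam F p ⁻¹' hull F) := by
  rw [← Measure.restrict_apply_univ (s := hull F), hF.restrict_hull_eq_map h hp,
    Measure.map_apply (isometry_faceParam F p).continuous.measurable MeasurableSet.univ,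
    Set.preimage_univ, Measure.restrict_apply_univ]

lemma measure_hull_le : (μHE[d - 1] : Measure (Eu d)) (hull F) ≤
    volume (Metric.closedBall (0 : Eu (d - 1)) (Metric.diam (hull F))) := by
  obtain ⟨p, hp⟩ := hF.nonempty
  rw [hF.measure_hull_eq h hp, ← volume_closedBall_eq_of_finrank_eq (hF.finrank_vectorSpan h)]
  refine measure_mono fun y hy => mem_closedBall_zero_iff.2 ?_
  have hdist := Metric.dist_le_diam_of_mem (isCompact_hull F).isBounded hy (subset_hull F hp)
  rwa [dist_eq_norm, faceParam, add_sub_cancel_left] at hdist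

lemma measure_hull_lt_top : (μHE[d - 1] : Measure (Eu d)) (hull F) < ⊤ :=
  (hF.measure_hull_le h).trans_lt measure_closedBall_lt_top

lemma integrableOn_hull {E : Type*} [NormedAddCommGroup E] [SecondCountableTopology E]
    {f : Eu d → E} (hf : ContinuousOn f (hull F)) :
    IntegrableOn f (hull F) (μHE[d - 1] : Measure (Eu d)) := by
  borelize E
  obtain ⟨C, hC⟩ := (isCompact_hull F).exists_bound_of_continuousOn hf
  exact IntegrableOn.of_bound (hF.measure_hull_lt_top h)
    (hf.aestronglyMeasurable (isClosed_hull F).measurableSet) C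
    ((ae_restrict_iff' (isClosed_hull F).measurableSet).2 (Filter.Eventually.of_forall hC))

lemma coord_faceParam {p : Eu d} (hp : p ∈ F) (y : vectorSpan ℝ (F : Set (Eu d))) :
    h.coord v (faceParam F p y) = 0 := by
  have hy : (h.coord v).linear y = 0 := by
    rw [← LinearMap.mem_ker, ← hF.vectorSpan_eq_ker h]
    exact y.2
  rw [faceParam, add_comm, ← vadd_eq_add, (h.coord v).map_vadd, hy, hF.coord_apply_of_mem h hp,
    zero_vadd]

lemma isOpen_faceParam_preimage_relInt {p : Eu d} (hp : p ∈ F) :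
    IsOpen (faceParam F p ⁻¹' relInt F) := by
  have hpre : faceParam F p ⁻¹' relInt F = ⋂ u ∈ F, {y | 0 < h.coord u (faceParam F p y)} := by
    ext y
    rw [Set.mem_preimage, hF.mem_relInt_iff h, and_iff_left (hF.coord_faceParam h hp y)]
    simp only [Set.mem_iInter, Set.mem_ofPred_eq]
  rw [hpre]
  exact isOpen_biInter_finset fun u _ => isOpen_lt continuous_const
    ((h.continuous_coord u).comp (isometry_faceParam F p).continuous)

lemma eqOn_zero_of_ae_eq_zero {f : Eu d → ℝ} (hf : ContinuousOn f (hull F))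
    (hf0 : f =ᵐ[(μHE[d - 1] : Measure (Eu d)).restrict (hull F)] 0) :
    Set.EqOn f 0 (hull F) := by
  obtain ⟨p, hp⟩ := hF.nonempty
  have hcont := (isometry_faceParam F p).continuous
  rw [hF.restrict_hull_eq_map h hp] at hf0
  have hae := ae_restrict_of_ae_restrict_of_subset (Set.preimage_mono (relInt_subset_hull F))
    (ae_of_ae_map hcont.measurable.aemeasurable hf0)
  have hparam : Set.EqOn (f ∘ faceParam F p) (fun _ => 0) (faceParam F p ⁻¹' relInt F) :=
    Measure.eqOn_open_of_ae_eq (μ := volume) hae (hF.isOpen_faceParam_preimage_relInt h hp)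
      (hf.comp hcont.continuousOn fun y hy => relInt_subset_hull F hy) continuousOn_const
  have hrelInt : Set.EqOn f 0 (relInt F) := fun x hx => by
    obtain ⟨y, rfl⟩ := hull_subset_range_faceParam hp (relInt_subset_hull F hx)
    exact hparam hx
  exact hrelInt.of_subset_closure hf continuousOn_const (relInt_subset_hull F)
    (hull_subset_closure_relInt hF.nonempty)

lemma eqOn_zero_of_integral_eq_zero {f : Eu d → ℝ} (hf : ContinuousOn f (hull F))
    (hf0 : ∀ x ∈ hull F, 0 ≤ f x) (h_int : ∫ x in hull F, f x ∂μHE[d - 1] = 0) :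
    Set.EqOn f 0 (hull F) :=
  hF.eqOn_zero_of_ae_eq_zero h hf <| (setIntegral_eq_zero_iff_of_nonneg_ae
    ((ae_restrict_iff' (isClosed_hull F).measurableSet).2 (Filter.Eventually.of_forall hf0))
    (hF.integrableOn_hull h hf)).1 h_int

end IsFace

/-! ### Weak divergence and normal components -/

section Divergence

variable {d : ℕ}

lemma inner_gradient_eq_fderiv (φ : Eu d → ℝ) (x y : Eu d) :
    inner ℝ y (gradient φ x) = fderiv ℝ φ x y := by
  rw [real_inner_comm, gradient, InnerProductSpace.toDual_symm_apply]

lemma continuous_divergence {w : Eu d → Eu d} (hw : ContDiff ℝ 1 w) :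
    Continuous (divergence w) := by
  have := hw.continuous_fderiv one_ne_zero
  unfold divergence
  fun_prop

lemma divergence_sub {w w' : Eu d → Eu d} (hw : Differentiable ℝ w) (hw' : Differentiable ℝ w')
    (x : Eu d) : divergence (w - w') x = divergence w x - divergence w' x := by
  simp only [divergence, fderiv_sub (hw x) (hw' x), sub_apply, PiLp.sub_apply,
    Finset.sum_sub_distrib]

lemma divergence_neg (w : Eu d → Eu d) (x : Eu d) : divergence (-w) x = -divergence w x := by
  simp only [divergence, fderiv_neg, neg_apply, PiLp.neg_apply, Finset.sum_neg_distrib]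

lemma divergence_smul {φ : Eu d → ℝ} {w : Eu d → Eu d} (hφ : Differentiable ℝ φ)
    (hw : Differentiable ℝ w) (x : Eu d) :
    divergence (φ • w) x = φ x * divergence w x + fderiv ℝ φ x (w x) := by
  have hwx : w x = ∑ i, w x i • EuclideanSpace.single i (1 : ℝ) :=
    ((EuclideanSpace.basisFun (Fin d) ℝ).sum_repr (w x)).symm.trans
      (Finset.sum_congr rfl fun i _ => by
        rw [EuclideanSpace.basisFun_repr, EuclideanSpace.basisFun_apply])
  conv_rhs => rw [hwx, map_sum]
  simp only [divergence, fderiv_smul (hφ x) (hw x), map_smul, smul_eq_mul, Finset.mul_sum,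
    ← Finset.sum_add_distrib]
  refine Finset.sum_congr rfl fun i _ => ?_
  simp [mul_comm]

lemma support_divergence_subset (w : Eu d → Eu d) :
    Function.support (divergence w) ⊆ tsupport w := by
  intro x hx
  by_contra hx'
  refine hx (Finset.sum_eq_zero fun i _ => ?_)
  rw [fderiv_of_notMem_tsupport (𝕜 := ℝ) hx', zero_apply, PiLp.zero_apply]

lemma integrable_divergence {w : Eu d → Eu d} (hw : ContDiff ℝ 1 w) (hs : HasCompactSupport w) :
    Integrable (divergence w) :=
  (continuous_divergence hw).integrable_of_hasCompactSupport
    (hs.mono' (support_divergence_subset w))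

lemma integral_fderiv_apply_eq_zero {E : Type*} [NormedAddCommGroup E] [NormedSpace ℝ E]
    [FiniteDimensional ℝ E] [MeasurableSpace E] [BorelSpace E] {μ : Measure E} [μ.IsAddHaarMeasure]
    {f : E → ℝ} (hf : ContDiff ℝ 1 f) (hs : HasCompactSupport f) (v : E) :
    ∫ x, fderiv ℝ f x v ∂μ = 0 := by
  have := hf.continuous_fderiv one_ne_zero
  have hs' : HasCompactSupport fun x => fderiv ℝ f x v := hs.fderiv_apply (𝕜 := ℝ) v
  have h_int : Integrable (fun x => fderiv ℝ f x v) μ :=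
    Continuous.integrable_of_hasCompactSupport (by fun_prop) hs'
  have hparts := integral_mul_fderiv_eq_neg_fderiv_mul_of_integrable (𝕜 := ℝ) (μ := μ)
    (f := fun _ => (1 : ℝ)) (g := f) (v := v) (by simp) (by simpa using h_int)
    (by simpa using hf.continuous.integrable_of_hasCompactSupport hs)
    (fun x _ => differentiableAt_const _) (fun x _ => hf.differentiable one_ne_zero x)
  simpa using hparts

lemma integral_divergence_eq_zero {w : Eu d → Eu d} (hw : ContDiff ℝ 1 w)
    (hs : HasCompactSupport w) : ∫ x, divergence w x = 0 := by
  have hw_coord (i : Fin d) : ContDiff ℝ 1 fun x => w x i := contDiff_euclidean.1 hw i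
  have hs_coord (i : Fin d) : HasCompactSupport fun x => w x i :=
    hs.comp_left (g := fun y : Eu d => y i) rfl
  have hfderiv (x : Eu d) (i : Fin d) (y : Eu d) :
      fderiv ℝ w x y i = fderiv ℝ (fun z => w z i) x y :=
    congrArg (· y) (((EuclideanSpace.proj (𝕜 := ℝ) i).hasFDerivAt.comp x
      (hw.differentiable one_ne_zero x).hasFDerivAt).fderiv).symm
  simp only [divergence, hfderiv]
  rw [integral_finsetSum]
  · exact Finset.sum_eq_zero fun i _ => integral_fderiv_apply_eq_zero (hw_coord i) (hs_coord i) _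
  · intro i _
    have := (hw_coord i).continuous_fderiv one_ne_zero
    exact Continuous.integrable_of_hasCompactSupport (by fun_prop)
      ((hs_coord i).fderiv_apply (𝕜 := ℝ) _)

end Divergence

section HalfSpace

variable {d : ℕ}

lemma hasDerivAt_expNegInvGlue (s : ℝ) :
    HasDerivAt expNegInvGlue ((s⁻¹) ^ 2 * expNegInvGlue s) s := by
  simpa using expNegInvGlue.hasDerivAt_polynomial_eval_inv_mul 1 s

/-- The function `x ↦ ε + ⟨x - x₀, n⟩ - K |x - x₀|²`. It is positive on a ball that reaches only
`√(ε / K)` deep into the half-space `⟨x - x₀, n⟩ ≤ 0`, and there increases in the direction `n`. -/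
def capFunction (n x₀ : Eu d) (K ε : ℝ) (x : Eu d) : ℝ :=
  ε + inner ℝ (x - x₀) n - K * ‖x - x₀‖ ^ 2

lemma contDiff_capFunction (n x₀ : Eu d) (K ε : ℝ) : ContDiff ℝ ∞ (capFunction n x₀ K ε) := by
  have hsub : ContDiff ℝ ∞ fun x : Eu d => x - x₀ := contDiff_id.sub contDiff_const
  exact (contDiff_const.add (hsub.inner ℝ contDiff_const)).sub
    (contDiff_const.mul (hsub.norm_sq ℝ))

lemma fderiv_capFunction (n x₀ : Eu d) (K ε : ℝ) (x y : Eu d) :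
    fderiv ℝ (capFunction n x₀ K ε) x y = inner ℝ y n - 2 * K * inner ℝ (x - x₀) y := by
  have hsub : HasFDerivAt (fun x => x - x₀) (ContinuousLinearMap.id ℝ (Eu d)) x :=
    (hasFDerivAt_id x).sub_const x₀
  have hcap := ((hsub.inner ℝ (hasFDerivAt_const n x)).const_add ε).sub
    (hsub.norm_sq.const_mul K)
  refine (congrArg (· y) hcap.fderiv).trans ?_
  simp only [sub_apply, smul_apply, ContinuousLinearMap.comp_apply, ContinuousLinearMap.prod_apply,
    ContinuousLinearMap.id_apply, zero_apply, fderivInnerCLM_apply, inner_zero_right, zero_add,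
    innerSL_apply_apply, nsmul_eq_mul, smul_eq_mul]
  ring

lemma divergence_expNegInvGlue_capFunction_smul (n x₀ : Eu d) (K ε : ℝ) {w : Eu d → Eu d}
    (hw : Differentiable ℝ w) (x : Eu d) :
    divergence ((expNegInvGlue ∘ capFunction n x₀ K ε) • w) x =
      expNegInvGlue (capFunction n x₀ K ε x) * (divergence w x +
        ((capFunction n x₀ K ε x)⁻¹) ^ 2 * (inner ℝ (w x) n - 2 * K * inner ℝ (x - x₀) (w x))) := by
  have hcap := (contDiff_capFunction n x₀ K ε).differentiable (by simp)
  have hglue (y : Eu d) := (hasDerivAt_expNegInvGlue (capFunction n x₀ K ε y)).comp_hasFDerivAt y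
    (hcap y).hasFDerivAt
  rw [divergence_smul (fun y => (hglue y).differentiableAt) hw, (hglue x).fderiv, smul_apply,
    smul_eq_mul, fderiv_capFunction, Function.comp_apply]
  ring

lemma norm_lt_of_capFunction_nonneg {n x₀ : Eu d} {r ε : ℝ} (hr : 0 < r) (hε : ε < r) {x : Eu d}
    (hx : 0 ≤ capFunction n x₀ ((‖n‖ + 1) / r) ε x) : ‖x - x₀‖ < r := by
  by_contra! hrx
  have hinner := (le_abs_self _).trans (abs_real_inner_le_norm (x - x₀) n)
  have hsq : (‖n‖ + 1) * ‖x - x₀‖ ≤ (‖n‖ + 1) / r * ‖x - x₀‖ ^ 2 := by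
    rw [div_mul_eq_mul_div, le_div_iff₀ hr, sq, ← mul_assoc]
    gcongr
  rw [capFunction] at hx
  linarith

lemma tsupport_expNegInvGlue_capFunction_subset (n x₀ : Eu d) {r ε : ℝ} (hr : 0 < r)
    (hε : ε < r) :
    tsupport (expNegInvGlue ∘ capFunction n x₀ ((‖n‖ + 1) / r) ε) ⊆ Metric.ball x₀ r := by
  have hclosed : IsClosed {x | 0 ≤ capFunction n x₀ ((‖n‖ + 1) / r) ε x} :=
    isClosed_le continuous_const (contDiff_capFunction _ _ _ _).continuous
  refine (closure_minimal (fun x hx => ?_) hclosed).trans fun x hx =>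
    mem_ball_iff_norm.2 (norm_lt_of_capFunction_nonneg hr hε hx)
  rw [Function.mem_support, Function.comp_apply, Ne, expNegInvGlue.zero_iff_nonpos, not_le] at hx
  exact hx.le

/-- Multiplied by `s ^ 2`, where `s` is the value of `capFunction n x₀ K ε` at `x`, the expression
tends to `⟨w x₀, n⟩ > 0` as `s → 0` and `x → x₀`, and both are small together with `ε`. -/
lemma exists_forall_capFunction_pos {n x₀ : Eu d} {w : Eu d → Eu d} (hw : ContDiff ℝ 1 w)
    (hpos : 0 < inner ℝ (w x₀) n) {K r : ℝ} (hK : 0 < K) (hr : 0 < r) :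
    ∃ ε, 0 < ε ∧ ε < r ∧ ∀ x, inner ℝ (x - x₀) n ≤ 0 → 0 < capFunction n x₀ K ε x →
      0 < divergence w x +
        ((capFunction n x₀ K ε x)⁻¹) ^ 2 * (inner ℝ (w x) n - 2 * K * inner ℝ (x - x₀) (w x)) := by
  have hcont : Continuous fun p : ℝ × Eu d => p.1 ^ 2 * divergence w p.2 +
      (inner ℝ (w p.2) n - 2 * K * inner ℝ (p.2 - x₀) (w p.2)) := by
    have := continuous_divergence hw
    have := hw.continuous
    fun_prop
  obtain ⟨δ, hδ, hball⟩ := Metric.eventually_nhds_iff.1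
    ((hcont.tendsto (0, x₀)).eventually (lt_mem_nhds (a := 0) (by simpa using hpos)))
  have hmin : 0 < min r (min δ (K * δ ^ 2)) := by positivity
  obtain ⟨ε, hε, hε'⟩ := exists_between hmin
  obtain ⟨hεr, hεδ, hεK⟩ : ε < r ∧ ε < δ ∧ ε < K * δ ^ 2 := by
    simpa only [lt_min_iff] using hε'
  refine ⟨ε, hε, hεr, fun x hx hcap => ?_⟩
  set s := capFunction n x₀ K ε x with hs
  have hsum : s + K * ‖x - x₀‖ ^ 2 = ε + inner ℝ (x - x₀) n := by rw [hs, capFunction]; ring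
  have hsε : s < δ := by nlinarith [sq_nonneg ‖x - x₀‖]
  have hxδ : ‖x - x₀‖ < δ :=
    lt_of_pow_lt_pow_left₀ 2 hδ.le (lt_of_mul_lt_mul_left (by linarith) hK.le)
  have hs_pos := hball (y := (s, x)) (by
    rw [Prod.dist_eq, max_lt_iff, Real.dist_0_eq_abs, abs_of_pos hcap, dist_eq_norm]
    exact ⟨hsε, hxδ⟩)
  refine pos_of_mul_pos_right (a := s ^ 2) ?_ (sq_nonneg s)
  rwa [mul_add, ← mul_assoc, ← mul_pow, mul_inv_cancel₀ hcap.ne', one_pow, one_mul]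

lemma halfSpace_subset_closure_interior {n : Eu d} (hn : n ≠ 0) (x₀ : Eu d) :
    {x : Eu d | inner ℝ (x - x₀) n ≤ 0} ⊆ closure (interior {x | inner ℝ (x - x₀) n ≤ 0}) := by
  have hconvex : Convex ℝ {x : Eu d | inner ℝ (x - x₀) n ≤ 0} := by
    intro x hx y hy a b ha hb hab
    have hcomb : a • x + b • y - x₀ = a • (x - x₀) + b • (y - x₀) := by
      rw [smul_sub, smul_sub, sub_add_sub_comm, ← add_smul, hab, one_smul]
    rw [Set.mem_ofPred_eq] at hx hy ⊢
    rw [hcomb, inner_add_left, real_inner_smul_left, real_inner_smul_left]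
    exact add_nonpos (mul_nonpos_of_nonneg_of_nonpos ha hx) (mul_nonpos_of_nonneg_of_nonpos hb hy)
  have hopen : IsOpen {x : Eu d | inner ℝ (x - x₀) n < 0} :=
    isOpen_lt (by fun_prop) continuous_const
  have hmem : x₀ - n ∈ {x : Eu d | inner ℝ (x - x₀) n < 0} := by
    simpa using real_inner_self_pos.2 hn
  rw [hconvex.closure_interior_eq_closure_of_nonempty_interior
    ⟨_, interior_maximal (fun x (hx : inner ℝ (x - x₀) n < 0) => hx.le) hopen hmem⟩]
  exact subset_closure

lemma inner_nonpos_of_forall_halfSpace {n x₀ : Eu d} {r : ℝ} (hr : 0 < r) {w : Eu d → Eu d}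
    (hw : ContDiff ℝ 1 w)
    (H : ∀ φ : Eu d → ℝ, ContDiff ℝ ∞ φ → HasCompactSupport φ → tsupport φ ⊆ Metric.ball x₀ r →
      ∫ x in {x : Eu d | inner ℝ (x - x₀) n ≤ 0}, divergence (φ • w) x = 0) :
    inner ℝ (w x₀) n ≤ 0 := by
  by_contra! hpos
  have hn : n ≠ 0 := by
    rintro rfl
    exact hpos.ne' (inner_zero_right _)
  set S := {x : Eu d | inner ℝ (x - x₀) n ≤ 0}
  have hS : MeasurableSet S := (isClosed_le (by fun_prop) continuous_const).measurableSet
  obtain ⟨ε, hε, hεr, hcap⟩ :=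
    exists_forall_capFunction_pos hw hpos (K := (‖n‖ + 1) / r) (by positivity) hr
  set φ := expNegInvGlue ∘ capFunction n x₀ ((‖n‖ + 1) / r) ε
  have hφ : ContDiff ℝ ∞ φ := expNegInvGlue.contDiff.comp (contDiff_capFunction _ _ _ _)
  have hφw : ContDiff ℝ 1 (φ • w) := (hφ.of_le (by simp)).smul hw
  have hsub := tsupport_expNegInvGlue_capFunction_subset n x₀ hr hεr
  have hs : HasCompactSupport φ :=
    (isCompact_closedBall x₀ r).of_isClosed_subset (isClosed_tsupport φ)
      (hsub.trans Metric.ball_subset_closedBall)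
  have hdiv := divergence_expNegInvGlue_capFunction_smul n x₀ ((‖n‖ + 1) / r) ε
    (hw.differentiable one_ne_zero)
  have hnonneg : ∀ x ∈ S, 0 ≤ divergence (φ • w) x := fun x hx => by
    rw [hdiv]
    rcases le_or_gt (capFunction n x₀ ((‖n‖ + 1) / r) ε x) 0 with hle | hlt
    · rw [expNegInvGlue.zero_of_nonpos hle, zero_mul]
    · exact mul_nonneg (expNegInvGlue.nonneg _) (hcap x hx hlt).le
  have hae := (setIntegral_eq_zero_iff_of_nonneg_ae
    ((ae_restrict_iff' hS).2 (Filter.Eventually.of_forall hnonneg))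
    (integrable_divergence hφw hs.smul_right).integrableOn).1 (H φ hφ hs hsub)
  have hx₀ : x₀ ∈ S := by simp [S]
  have hcap₀ : 0 < capFunction n x₀ ((‖n‖ + 1) / r) ε x₀ := by simpa [capFunction] using hε
  have hzero := Measure.eqOn_of_ae_eq hae (continuous_divergence hφw).continuousOn
    continuousOn_const (halfSpace_subset_closure_interior hn x₀) hx₀
  rw [hdiv] at hzero
  exact (mul_pos (expNegInvGlue.pos_of_pos hcap₀) (hcap x₀ hx₀ hcap₀)).ne' hzero

lemma inner_eq_zero_of_forall_halfSpace {n x₀ : Eu d} {r : ℝ} (hr : 0 < r) {w : Eu d → Eu d}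
    (hw : ContDiff ℝ 1 w)
    (H : ∀ φ : Eu d → ℝ, ContDiff ℝ ∞ φ → HasCompactSupport φ → tsupport φ ⊆ Metric.ball x₀ r →
      ∫ x in {x : Eu d | inner ℝ (x - x₀) n ≤ 0}, divergence (φ • w) x = 0) :
    inner ℝ (w x₀) n = 0 := by
  refine le_antisymm (inner_nonpos_of_forall_halfSpace hr hw H) ?_
  have hneg := inner_nonpos_of_forall_halfSpace (n := n) (x₀ := x₀) (w := -w) hr hw.neg
    fun φ hφ hs hsub => by
      simp only [smul_neg, divergence_neg, integral_neg, H φ hφ hs hsub, neg_zero]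
  rwa [Pi.neg_apply, inner_neg_left, neg_nonpos] at hneg

end HalfSpace

/-! ### Geometry of a mesh -/

lemma affineSpan_ne_top_of_card_le {d : ℕ} {G : Finset (Eu d)} (hG : G.Nonempty)
    (hcard : G.card ≤ d) : affineSpan ℝ (G : Set (Eu d)) ≠ ⊤ := by
  classical
  intro htop
  have hcard_eq : G.card = (G.card - 1) + 1 := (Nat.sub_add_cancel hG.card_pos).symm
  have hrank := finrank_vectorSpan_image_finset_le ℝ (id : Eu d → Eu d) G hcard_eq
  rw [Finset.image_id, ← direction_affineSpan, htop, AffineSubspace.direction_top, finrank_top,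
    finrank_euclideanSpace_fin] at hrank
  omega

lemma tendsto_add_smul_nhdsGT {E : Type*} [AddCommGroup E] [Module ℝ E] [TopologicalSpace E]
    [ContinuousAdd E] [ContinuousSMul ℝ E] (x y : E) :
    Filter.Tendsto (fun t : ℝ => x + t • y) (nhdsWithin 0 (Set.Ioi 0)) (nhds x) := by
  have hcont : Continuous fun t : ℝ => x + t • y := by fun_prop
  simpa using (hcont.tendsto 0).mono_left nhdsWithin_le_nhds

lemma exists_pos_add_smul_mem_frontier {E : Type*} [NormedAddCommGroup E] [NormedSpace ℝ E]
    {U : Set E} (hU : Bornology.IsBounded U) {x e : E} (hx : x ∈ interior U) (he : e ≠ 0) :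
    ∃ t : ℝ, 0 < t ∧ x + t • e ∈ frontier U := by
  by_contra! H
  have hray : IsPreconnected ((fun t : ℝ => x + t • e) '' Set.Ici 0) :=
    isPreconnected_Ici.image _ (by fun_prop)
  obtain ⟨R, hR⟩ := hU.closure.subset_closedBall x
  have hfar : x + ((|R| + 1) / ‖e‖) • e ∉ closure U := fun hmem => by
    have hle := hR hmem
    rw [mem_closedBall_iff_norm, add_sub_cancel_left, norm_smul, norm_div, norm_norm,
      div_mul_cancel₀ _ (norm_ne_zero_iff.2 he), Real.norm_of_nonneg (by positivity)] at hle
    linarith [le_abs_self R]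
  have hcover : (fun t : ℝ => x + t • e) '' Set.Ici 0 ⊆ interior U ∪ (closure U)ᶜ := by
    rintro - ⟨t, ht, rfl⟩
    rcases (Set.mem_Ici.1 ht).eq_or_lt with rfl | ht
    · exact Or.inl (by simpa using hx)
    · exact or_iff_not_imp_left.2 fun h_int hcl => H t ht ⟨hcl, h_int⟩
  obtain ⟨z, -, hz, hz'⟩ := hray (interior U) (closure U)ᶜ isOpen_interior
    isClosed_closure.isOpen_compl hcover ⟨x, ⟨0, Set.self_mem_Ici, by simp⟩, hx⟩
    ⟨_, ⟨_, Set.mem_Ici.2 (by positivity), rfl⟩, hfar⟩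
  exact hz' (interior_subset_closure hz)

lemma IsCell.mem_relInt_erase_or_mem_hull_erase {d : ℕ} {T : Finset (Eu d)} (h : IsCell T)
    [DecidableEq (Eu d)] {x : Eu d} (hx : x ∈ hull T) (hx' : x ∉ interior (hull T)) :
    ∃ a ∈ T, x ∈ relInt (T.erase a) ∨ ∃ b ∈ T, a ≠ b ∧ x ∈ hull ((T.erase a).erase b) := by
  rw [h.mem_hull_iff] at hx
  rw [h.mem_interior_iff] at hx'
  push Not at hx'
  obtain ⟨a, ha, ha_nonpos⟩ := hx'
  have ha_zero : h.coord a x = 0 := ha_nonpos.antisymm (hx a ha)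
  refine ⟨a, ha, or_iff_not_imp_right.2 fun hno => ?_⟩
  push Not at hno
  rw [h.mem_relInt_iff (Finset.erase_subset a T)]
  refine ⟨fun b hb => (hx b (Finset.mem_of_mem_erase hb)).lt_of_ne' fun hb_zero => ?_, ?_⟩
  · refine hno b (Finset.mem_of_mem_erase hb) (Finset.ne_of_mem_erase hb).symm ?_
    rw [h.mem_hull_subset_iff ((Finset.erase_subset _ _).trans (Finset.erase_subset _ _))]
    refine ⟨fun v hv => hx v (Finset.mem_of_mem_erase (Finset.mem_of_mem_erase hv)), ?_⟩
    intro v hv hv'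
    rcases eq_or_ne v b with rfl | hvb
    · exact hb_zero
    · exact (not_imp_comm.1 fun hva => Finset.mem_erase.2 ⟨hvb, Finset.mem_erase.2 ⟨hva, hv⟩⟩) hv' ▸
        ha_zero
  · intro v hv hv'
    exact (not_imp_comm.1 fun hva => Finset.mem_erase.2 ⟨hva, hv⟩) hv' ▸ ha_zero

namespace Mesh

variable {d : ℕ} {Ω : Set (Eu d)} (M : Mesh d Ω)

lemma isCell (T : M.cells) : IsCell (T : Finset (Eu d)) :=
  ⟨M.card_cell T T.2, M.indep T T.2⟩

lemma mem_facesOf {T : M.cells} {F : M.faces} :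
    F ∈ M.facesOf T ↔ (F : Finset (Eu d)) ⊆ (T : Finset (Eu d)) := by
  simp [facesOf]

lemma mem_faces {F : Finset (Eu d)} : F ∈ M.faces ↔ ∃ T ∈ M.cells, F ⊆ T ∧ F.card = d := by
  simp only [faces, Finset.mem_biUnion, Finset.mem_powersetCard]

lemma card_face (F : M.faces) : (F : Finset (Eu d)).card = d := by
  obtain ⟨T, -, -, hcard⟩ := M.mem_faces.1 F.2
  exact hcard

lemma face_nonempty (hd : 1 ≤ d) (F : M.faces) : (F : Finset (Eu d)).Nonempty :=
  Finset.card_pos.1 ((M.card_face F).symm ▸ hd)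

lemma exists_isFace (hd : 1 ≤ d) {T : M.cells} {F : M.faces} (hF : F ∈ M.facesOf T) :
    ∃ v, IsFace (T : Finset (Eu d)) (F : Finset (Eu d)) v :=
  (M.isCell T).exists_isFace (M.mem_facesOf.1 hF) (M.card_face F) (M.face_nonempty hd F)

lemma exists_cell (F : M.faces) : ∃ T : M.cells, F ∈ M.facesOf T := by
  obtain ⟨T, hT, hFT, -⟩ := M.mem_faces.1 F.2
  exact ⟨⟨T, hT⟩, M.mem_facesOf.2 hFT⟩

lemma exists_face_eq_erase [DecidableEq (Eu d)] (T : M.cells) {v : Eu d}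
    (hv : v ∈ (T : Finset (Eu d))) :
    ∃ F ∈ M.facesOf T, (F : Finset (Eu d)) = (T : Finset (Eu d)).erase v := by
  have hmem : (T : Finset (Eu d)).erase v ∈ M.faces :=
    M.mem_faces.2 ⟨T, T.2, Finset.erase_subset _ _, by
      rw [Finset.card_erase_of_mem hv, (M.isCell T).card_eq, Nat.add_sub_cancel]⟩
  exact ⟨⟨_, hmem⟩, M.mem_facesOf.2 (Finset.erase_subset _ _), rfl⟩

lemma mem_hull_inter [DecidableEq (Eu d)] {S T : M.cells} {x : Eu d}
    (hS : x ∈ hull (S : Finset (Eu d))) (hT : x ∈ hull (T : Finset (Eu d))) :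
    x ∈ hull ((S : Finset (Eu d)) ∩ (T : Finset (Eu d))) := by
  rw [hull, Finset.coe_inter]
  exact M.conforming S S.2 T T.2 ⟨hS, hT⟩

lemma disjoint_hull_interior {S T : M.cells} (hne : S ≠ T) :
    Disjoint (hull (S : Finset (Eu d))) (interior (hull (T : Finset (Eu d)))) := by
  classical
  refine Set.disjoint_left.2 fun x hS hT => ?_
  refine (M.isCell T).notMem_hull_of_mem_interior
    (Finset.inter_subset_right.ssubset_of_ne fun hinter => hne ?_) hT
    (M.mem_hull_inter hS (interior_subset hT))
  exact (Subtype.ext (Finset.eq_of_subset_of_card_le (Finset.inter_eq_right.1 hinter)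
    (by rw [(M.isCell S).card_eq, (M.isCell T).card_eq]))).symm

lemma mem_facesOf_of_mem_hull {S T : M.cells} {F : M.faces} (hF : F ∈ M.facesOf T) {x : Eu d}
    (hx : x ∈ relInt (F : Finset (Eu d))) (hS : x ∈ hull (S : Finset (Eu d))) :
    F ∈ M.facesOf S := by
  classical
  have hFT := M.mem_facesOf.1 hF
  have hinter := M.mem_hull_inter hS (hull_mono hFT (relInt_subset_hull _ hx))
  rw [(M.isCell T).mem_hull_subset_iff Finset.inter_subset_right] at hinter
  rw [(M.isCell T).mem_relInt_iff hFT] at hx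
  refine M.mem_facesOf.2 fun u hu => by_contra fun hu' => (hx.1 u hu).ne' ?_
  exact hinter.2 u (hFT hu) fun hmem => hu' (Finset.mem_inter.1 hmem).1

lemma eventually_notMem_hull {T : M.cells} {F : M.faces} (hF : F ∈ M.facesOf T) {x₀ : Eu d}
    (hx₀ : x₀ ∈ relInt (F : Finset (Eu d))) :
    ∀ᶠ x in nhds x₀, ∀ S : M.cells, F ∉ M.facesOf S → x ∉ hull (S : Finset (Eu d)) :=
  Filter.eventually_all.2 fun _ => Filter.eventually_imp_distrib_left.2 fun hS =>
    (isClosed_hull _).isOpen_compl.mem_nhds fun hx => hS (M.mem_facesOf_of_mem_hull hF hx₀ hx)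

lemma outwardNormal_eq_neg (hd : 1 ≤ d) {S T : M.cells} (hne : S ≠ T) {F : M.faces}
    (hS : F ∈ M.facesOf S) (hT : F ∈ M.facesOf T) :
    outwardNormal (S : Finset (Eu d)) F = -outwardNormal (T : Finset (Eu d)) F := by
  obtain ⟨v, hv⟩ := M.exists_isFace hd hT
  obtain ⟨v', hv'⟩ := M.exists_isFace hd hS
  have hnorm := hv.norm_outwardNormal (M.isCell T)
  refine (hv.eq_or_eq_neg_outwardNormal (M.isCell T) (outwardNormal_mem_orthogonal _ _)
    (hv'.norm_outwardNormal (M.isCell S))).resolve_left fun heq => ?_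
  -- If the normals agreed, the points just inside `F` would lie in both cells.
  have hx₀ := barycentre_mem_relInt hv.nonempty
  obtain ⟨t, ⟨htT, htS⟩, ht⟩ := (((tendsto_add_smul_nhdsGT _
    (-outwardNormal (T : Finset (Eu d)) F)).eventually
    ((hv.eventually_mem_hull_iff (M.isCell T) hx₀).and
      (hv'.eventually_mem_interior_iff (M.isCell S) hx₀))).and self_mem_nhdsWithin).exists
  rw [add_sub_cancel_left, real_inner_smul_left, inner_neg_left] at htT htS
  rw [heq] at htS
  rw [real_inner_self_eq_norm_sq, hnorm, one_pow, mul_neg_one] at htT htS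
  exact Set.disjoint_left.1 (M.disjoint_hull_interior hne.symm) (htT.2 (neg_neg_of_pos ht).le)
    (htS.2 (neg_neg_of_pos ht))

lemma eq_of_ne_of_ne (hd : 1 ≤ d) {S S' T : M.cells} {F : M.faces} (hT : F ∈ M.facesOf T)
    (hS : F ∈ M.facesOf S) (hS' : F ∈ M.facesOf S') (hne : S ≠ T) (hne' : S' ≠ T) : S = S' := by
  by_contra hSS'
  have hneg := M.outwardNormal_eq_neg hd hSS' hS hS'
  rw [M.outwardNormal_eq_neg hd hne hS hT, M.outwardNormal_eq_neg hd hne' hS' hT,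
    neg_neg, neg_eq_iff_add_eq_zero, ← two_smul ℝ, smul_eq_zero_iff_right two_ne_zero] at hneg
  obtain ⟨v, hv⟩ := M.exists_isFace hd hT
  exact zero_ne_one (norm_zero.symm.trans (hneg ▸ hv.norm_outwardNormal (M.isCell T)))

include M in
lemma isOpen_domain : IsOpen Ω := by
  rw [M.domain_eq]
  exact isOpen_interior

lemma interior_hull_subset (T : M.cells) : interior (hull (T : Finset (Eu d))) ⊆ Ω := by
  conv_rhs => rw [M.domain_eq]
  exact interior_mono (Set.subset_biUnion_of_mem (u := fun T : Finset (Eu d) =>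
    convexHull ℝ (T : Set (Eu d))) T.2)

lemma domain_subset : Ω ⊆ ⋃ T : M.cells, hull (T : Finset (Eu d)) := by
  conv_lhs => rw [M.domain_eq]
  refine interior_subset.trans (Set.iUnion₂_subset fun T hT => ?_)
  exact Set.subset_iUnion (fun T : M.cells => hull (T : Finset (Eu d))) ⟨T, hT⟩

lemma hull_subset_closure (T : M.cells) : hull (T : Finset (Eu d)) ⊆ closure Ω :=
  (M.isCell T).hull_subset_closure_interior.trans (closure_mono (M.interior_hull_subset T))

include M in
lemma volume_domain_lt_top : volume Ω < ⊤ :=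
  (measure_mono M.domain_subset).trans_lt
    (isCompact_iUnion fun T : M.cells => isCompact_hull (T : Finset (Eu d))).measure_lt_top

lemma hull_ae_le_domain (T : M.cells) : hull (T : Finset (Eu d)) ≤ᵐ[volume] Ω :=
  (hull_ae_eq_interior _).le.trans (M.interior_hull_subset T).eventuallyLE

lemma domain_ae_eq : Ω =ᵐ[volume] ⋃ T : M.cells, interior (hull (T : Finset (Eu d))) :=
  Filter.EventuallyLE.antisymm
    (M.domain_subset.eventuallyLE.trans
      (Filter.EventuallyEq.countable_iUnion fun _ => hull_ae_eq_interior _).le)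
    (Set.iUnion_subset fun T => M.interior_hull_subset T).eventuallyLE

lemma setIntegral_domain {f : Eu d → ℝ} (hf : IntegrableOn f Ω) :
    ∫ x in Ω, f x = ∑ T : M.cells, ∫ x in hull (T : Finset (Eu d)), f x := by
  rw [setIntegral_congr_set M.domain_ae_eq, integral_iUnion_fintype
    (fun T => isOpen_interior.measurableSet)
    (fun S T hne => (M.disjoint_hull_interior hne).mono_left interior_subset)
    fun T => hf.mono_set (M.interior_hull_subset T)]
  exact Finset.sum_congr rfl fun T _ => (setIntegral_congr_set (hull_ae_eq_interior _)).symm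

lemma hull_face_subset_frontier (hd : 1 ≤ d) {T : M.cells} {F : M.faces} (hF : F ∈ M.facesOf T)
    (hone : ∀ S : M.cells, F ∈ M.facesOf S → S = T) :
    hull (F : Finset (Eu d)) ⊆ frontier Ω := by
  obtain ⟨v, hv⟩ := M.exists_isFace hd hF
  refine (hull_subset_closure_relInt hv.nonempty).trans
    (closure_minimal (fun x hx => ?_) isClosed_frontier)
  rw [M.isOpen_domain.frontier_eq]
  refine ⟨M.hull_subset_closure T (hull_mono hv.subset (relInt_subset_hull _ hx)), fun hxΩ => ?_⟩
  -- The points just outside `F` are not in `T`, nor in any cell without the face `F`.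
  obtain ⟨t, ⟨⟨htT, htS⟩, htΩ⟩, ht⟩ := (((tendsto_add_smul_nhdsGT x
    (outwardNormal (T : Finset (Eu d)) F)).eventually
    (((hv.eventually_mem_hull_iff (M.isCell T) hx).and (M.eventually_notMem_hull hF hx)).and
      (M.isOpen_domain.mem_nhds hxΩ))).and self_mem_nhdsWithin).exists
  obtain ⟨S, hS⟩ := Set.mem_iUnion.1 (M.domain_subset htΩ)
  rw [hone S (by_contra fun hFS => htS S hFS hS), htT, add_sub_cancel_left, real_inner_smul_left,
    real_inner_self_eq_norm_sq, hv.norm_outwardNormal (M.isCell T), one_pow, mul_one] at hS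
  exact hS.not_gt ht

lemma hull_union_hull_mem_nhds (hd : 1 ≤ d) {S T : M.cells} (hne : S ≠ T) {F : M.faces}
    (hS : F ∈ M.facesOf S) (hT : F ∈ M.facesOf T) {x₀ : Eu d}
    (hx₀ : x₀ ∈ relInt (F : Finset (Eu d))) :
    hull (S : Finset (Eu d)) ∪ hull (T : Finset (Eu d)) ∈ nhds x₀ := by
  obtain ⟨v, hv⟩ := M.exists_isFace hd hS
  obtain ⟨v', hv'⟩ := M.exists_isFace hd hT
  filter_upwards [hv.eventually_mem_hull_iff (M.isCell S) hx₀,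
    hv'.eventually_mem_hull_iff (M.isCell T) hx₀] with x hxS hxT
  rw [M.outwardNormal_eq_neg hd hne hS hT, inner_neg_right, neg_nonpos] at hxS
  exact (le_total 0 _).imp hxS.2 hxT.2

lemma ae_notMem_affineSpan_insert [DecidableEq (Eu d)] (hd : 1 ≤ d) (x₀ : Eu d) :
    ∀ᵐ y : Eu d, ∀ T ∈ M.cells, ∀ a ∈ T, ∀ b ∈ T, a ≠ b →
      y ∉ affineSpan ℝ ((insert x₀ ((T.erase a).erase b) : Finset (Eu d)) : Set (Eu d)) := by
  simp only [Filter.eventually_all_finset, Filter.eventually_imp_distrib_left]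
  intro T hT a ha b hb hab
  refine measure_eq_zero_iff_ae_notMem.1 (Measure.addHaar_affineSubspace volume _
    (affineSpan_ne_top_of_card_le (Finset.insert_nonempty _ _)
      ((Finset.card_insert_le _ _).trans ?_)))
  rw [Finset.card_erase_of_mem (Finset.mem_erase.2 ⟨hab.symm, hb⟩),
    Finset.card_erase_of_mem ha, M.card_cell T hT]
  omega

lemma exists_facesOf_forall_eq (hd : 1 ≤ d) {C : Set M.cells} (hC : C.Nonempty) :
    ∃ T ∈ C, ∃ F ∈ M.facesOf T, ∀ S ∈ C, F ∈ M.facesOf S → S = T := by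
  classical
  obtain ⟨T₀, hT₀⟩ := hC
  obtain ⟨x₀, hx₀⟩ := (M.isCell T₀).interior_nonempty
  -- The ray from `x₀` through `y` avoids all `(d - 2)`-dimensional faces.
  obtain ⟨y, hy⟩ := (M.ae_notMem_affineSpan_insert hd x₀).exists
  have hyx : y ≠ x₀ := by
    rintro rfl
    obtain ⟨a, ha, b, hb, hab⟩ := Finset.one_lt_card.1
      ((M.isCell T₀).card_eq.symm ▸ Nat.lt_succ_of_le hd : 1 < (T₀ : Finset (Eu d)).card)
    exact hy T₀ T₀.2 a ha b hb hab (subset_affineSpan ℝ _ (by simp))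
  set U : Set (Eu d) := ⋃ T ∈ C, hull (T : Finset (Eu d))
  have hU : IsCompact U := C.toFinite.isCompact_biUnion fun T _ => isCompact_hull _
  have hsub {T : M.cells} (hT : T ∈ C) : hull (T : Finset (Eu d)) ⊆ U :=
    Set.subset_biUnion_of_mem (u := fun T : M.cells => hull (T : Finset (Eu d))) hT
  obtain ⟨t, ht, htU⟩ := exists_pos_add_smul_mem_frontier hU.isBounded
    (interior_mono (hsub hT₀) hx₀) (sub_ne_zero.2 hyx)
  obtain ⟨T, hT, htT⟩ := Set.mem_iUnion₂.1 (hU.isClosed.frontier_subset htU)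
  obtain ⟨a, ha, hrel | ⟨b, hb, hab, hmem⟩⟩ := (M.isCell T).mem_relInt_erase_or_mem_hull_erase htT
    fun htint => htU.2 (interior_mono (hsub hT) htint)
  · obtain ⟨F, hF, hFa⟩ := M.exists_face_eq_erase T ha
    refine ⟨T, hT, F, hF, fun S hS hFS => by_contra fun hne => htU.2 ?_⟩
    exact mem_interior_iff_mem_nhds.2 (Filter.mem_of_superset
      (M.hull_union_hull_mem_nhds hd hne hFS hF (hFa ▸ hrel))
      (Set.union_subset (hsub hS) (hsub hT)))
  · refine absurd ?_ (hy T T.2 a ha b hb hab)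
    have hline := AffineMap.lineMap_mem t⁻¹
      (subset_affineSpan ℝ _ (Finset.mem_insert_self x₀ _))
      (convexHull_subset_affineSpan _ (hull_mono (Finset.subset_insert x₀ _) hmem))
    rwa [AffineMap.lineMap_apply, vsub_eq_sub, add_sub_cancel_left, smul_smul,
      inv_mul_cancel₀ ht.ne', one_smul, vadd_eq_add, sub_add_cancel] at hline

end Mesh

/-! ### Normal continuity of discrete velocities -/

section WeakDivergence

variable {d : ℕ}

lemma integral_fderiv_apply_eq_neg {ψ : Eu d → ℝ} (hψ : ContDiff ℝ 1 ψ)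
    (hs : HasCompactSupport ψ) {w : Eu d → Eu d} (hw : ContDiff ℝ 1 w) :
    ∫ x, fderiv ℝ ψ x (w x) = -∫ x, ψ x * divergence w x := by
  have := hψ.continuous_fderiv one_ne_zero
  have := hψ.continuous
  have := hw.continuous
  have hdiv := continuous_divergence hw
  have h_int : Integrable fun x => ψ x * divergence w x :=
    Continuous.integrable_of_hasCompactSupport (by fun_prop) hs.mul_right
  have h_int' : Integrable fun x => fderiv ℝ ψ x (w x) := by
    refine Continuous.integrable_of_hasCompactSupport (by fun_prop)
      (HasCompactSupport.intro hs fun x hx => ?_)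
    rw [fderiv_of_notMem_tsupport (𝕜 := ℝ) hx, zero_apply]
  have hzero := integral_divergence_eq_zero (hψ.smul hw) hs.smul_right
  change ∫ x, divergence (ψ • w) x = 0 at hzero
  simp only [divergence_smul (hψ.differentiable one_ne_zero) (hw.differentiable one_ne_zero)]
    at hzero
  rw [integral_add h_int h_int'] at hzero
  exact (neg_eq_of_add_eq_zero_right hzero).symm

lemma ae_eq_divergence_of_forall_integral {O : Set (Eu d)} (hO : IsOpen O) {q : Eu d → ℝ}
    (hq : LocallyIntegrableOn q O) {w : Eu d → Eu d} (hw : ContDiff ℝ 1 w)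
    (H : ∀ ψ : Eu d → ℝ, ContDiff ℝ ∞ ψ → HasCompactSupport ψ → tsupport ψ ⊆ O →
      ∫ x, fderiv ℝ ψ x (w x) = -∫ x, ψ x * q x) :
    ∀ᵐ x, x ∈ O → q x = divergence w x := by
  have hdiv := continuous_divergence hw
  have hzero := hO.ae_eq_zero_of_integral_contDiff_smul_eq_zero (f := fun x => q x - divergence w x)
    (hq.sub (hdiv.locallyIntegrable.locallyIntegrableOn _)) fun ψ hψ hs hsub => ?_
  · filter_upwards [hzero] with x hx hxO using sub_eq_zero.1 (hx hxO)
  have hψc := hψ.continuous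
  have h_int : Integrable fun x => ψ x * divergence w x :=
    Continuous.integrable_of_hasCompactSupport (by fun_prop) hs.mul_right
  have h_int' : Integrable fun x => ψ x * q x :=
    (integrableOn_iff_integrable_of_support_subset fun x hx =>
      subset_tsupport ψ (left_ne_zero_of_mul hx)).1
      ((hq.integrableOn_compact_subset hsub hs).continuousOn_mul hψc.continuousOn hs)
  have hparts := integral_fderiv_apply_eq_neg (hψ.of_le (by simp)) hs hw
  rw [H ψ hψ hs hsub, neg_inj] at hparts
  simp only [smul_eq_mul, mul_sub]
  rw [integral_sub h_int' h_int, hparts, sub_self]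

lemma setIntegral_congr_of_support {X E : Type*} [MeasurableSpace X] {μ : Measure X}
    [NormedAddCommGroup E] [NormedSpace ℝ E] {f : X → E} {A B : Set X} (hA : MeasurableSet A)
    (hB : MeasurableSet B) (hAB : ∀ x ∈ Function.support f, x ∈ A ↔ x ∈ B) :
    ∫ x in A, f x ∂μ = ∫ x in B, f x ∂μ := by
  rw [← integral_indicator hA, ← integral_indicator hB]
  congr 1
  ext x
  by_cases hx : f x = 0
  · rw [Set.indicator_apply_eq_zero.2 fun _ => hx, Set.indicator_apply_eq_zero.2 fun _ => hx]
  · by_cases hxA : x ∈ A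
    · rw [Set.indicator_of_mem hxA, Set.indicator_of_mem ((hAB x hx).1 hxA)]
    · rw [Set.indicator_of_notMem hxA, Set.indicator_of_notMem fun hxB => hxA ((hAB x hx).2 hxB)]

lemma IsFace.eventually_setIntegral_hull_eq {T F : Finset (Eu d)} {v : Eu d} (hF : IsFace T F v)
    (h : IsCell T) {x₀ : Eu d} (hx₀ : x₀ ∈ relInt F) :
    ∀ᶠ s in (nhds x₀).smallSets, ∀ f : Eu d → ℝ, Function.support f ⊆ s →
      ∫ x in hull T, f x = ∫ x in {x | inner ℝ (x - x₀) (outwardNormal T F) ≤ 0}, f x := by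
  filter_upwards [Filter.eventually_smallSets_forall.2 (hF.eventually_mem_hull_iff h hx₀)]
    with s hs f hf
  exact setIntegral_congr_of_support (isClosed_hull _).measurableSet
    (isClosed_le (by fun_prop) continuous_const).measurableSet fun x hx => hs x (hf hx)

lemma IsFace.eventually_setIntegral_hull_eq_neg {T F : Finset (Eu d)} {v : Eu d}
    (hF : IsFace T F v) (h : IsCell T) {x₀ : Eu d} (hx₀ : x₀ ∈ relInt F) :
    ∀ᶠ s in (nhds x₀).smallSets, ∀ f : Eu d → ℝ, Function.support f ⊆ s → Integrable f →
      ∫ x, f x = 0 →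
      ∫ x in hull T, f x = -∫ x in {x | inner ℝ (x - x₀) (-outwardNormal T F) ≤ 0}, f x := by
  have hmeas : MeasurableSet {x | inner ℝ (x - x₀) (-outwardNormal T F) ≤ 0} :=
    (isClosed_le (by fun_prop) continuous_const).measurableSet
  filter_upwards [Filter.eventually_smallSets_forall.2 (hF.eventually_mem_interior_iff h hx₀)]
    with s hs f hf h_int hzero
  rw [← integral_add_compl hmeas h_int, add_eq_zero_iff_neg_eq] at hzero
  rw [hzero, setIntegral_congr_set (hull_ae_eq_interior T)]
  refine setIntegral_congr_of_support isOpen_interior.measurableSet hmeas.compl fun x hx => ?_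
  rw [hs x (hf hx), Set.mem_compl_iff, Set.mem_ofPred_eq, inner_neg_right, neg_nonpos, not_le]

end WeakDivergence

namespace Mesh

variable {d : ℕ} {Ω : Set (Eu d)} (M : Mesh d Ω)

lemma inner_glue_gradient (u : M.cells → Eu d → Eu d) (φ : Eu d → ℝ) (x : Eu d) :
    inner ℝ (M.glue u x) (gradient φ x) = ∑ T : M.cells,
      (hull (T : Finset (Eu d))).indicator (fun y => fderiv ℝ φ y (u T y)) x := by
  rw [glue, sum_inner]
  refine Finset.sum_congr rfl fun T _ => ?_
  by_cases hx : x ∈ hull (T : Finset (Eu d))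
  · rw [Set.indicator_of_mem hx, Set.indicator_of_mem hx, inner_gradient_eq_fderiv]
  · rw [Set.indicator_of_notMem hx, Set.indicator_of_notMem hx, inner_zero_left]

lemma setIntegral_inner_glue_gradient {u : M.cells → Eu d → Eu d} (hu : ∀ T, Continuous (u T))
    {φ : Eu d → ℝ} (hφ : ContDiff ℝ 1 φ) :
    ∫ x in Ω, inner ℝ (M.glue u x) (gradient φ x) =
      ∑ T : M.cells, ∫ x in hull (T : Finset (Eu d)), fderiv ℝ φ x (u T x) := by
  have := hφ.continuous_fderiv one_ne_zero
  have hcont (T : M.cells) : Continuous fun x => fderiv ℝ φ x (u T x) := by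
    have := hu T
    fun_prop
  have hmeas (T : M.cells) : MeasurableSet (hull (T : Finset (Eu d))) :=
    (isClosed_hull _).measurableSet
  simp_rw [M.inner_glue_gradient]
  rw [integral_finsetSum _ fun T _ => ((integrable_indicator_iff (hmeas T)).2
    ((hcont T).continuousOn.integrableOn_compact (isCompact_hull _))).integrableOn]
  refine Finset.sum_congr rfl fun T _ => ?_
  rw [setIntegral_indicator (hmeas T)]
  refine setIntegral_congr_set ?_
  filter_upwards [M.hull_ae_le_domain T] with x hx
  exact propext ⟨fun hxT => hxT.2, fun hxT => ⟨hx hxT, hxT⟩⟩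

lemma ae_eq_divergence_of_glue {u : M.cells → Eu d → Eu d} (hu : ∀ T, ContDiff ℝ 1 (u T))
    {q : Eu d → ℝ} (hq : IntegrableOn q Ω)
    (H : ∀ φ : Eu d → ℝ, ContDiff ℝ ∞ φ → HasCompactSupport φ →
      ∫ x in Ω, inner ℝ (M.glue u x) (gradient φ x) = -∫ x in Ω, q x * φ x) (T : M.cells) :
    ∀ᵐ x, x ∈ interior (hull (T : Finset (Eu d))) → q x = divergence (u T) x := by
  refine ae_eq_divergence_of_forall_integral isOpen_interior
    (hq.mono_set (M.interior_hull_subset T)).locallyIntegrableOn (hu T) fun ψ hψ hs hsub => ?_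
  have hψ_zero (x : Eu d) (hx : x ∉ interior (hull (T : Finset (Eu d)))) : ψ x = 0 :=
    image_eq_zero_of_notMem_tsupport fun hxs => hx (hsub hxs)
  have hfderiv_zero (S : M.cells) (x : Eu d) (hx : x ∉ interior (hull (T : Finset (Eu d)))) :
      fderiv ℝ ψ x (u S x) = 0 := by
    rw [fderiv_of_notMem_tsupport (𝕜 := ℝ) fun hxs => hx (hsub hxs), zero_apply]
  have hother (S : M.cells) (hST : S ≠ T) :
      ∫ x in hull (S : Finset (Eu d)), fderiv ℝ ψ x (u S x) = 0 :=
    setIntegral_eq_zero_of_forall_eq_zero fun x hx =>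
      hfderiv_zero S x (Set.disjoint_left.1 (M.disjoint_hull_interior hST) hx)
  have hglue := H ψ hψ hs
  rw [M.setIntegral_inner_glue_gradient (fun S => (hu S).continuous) (hψ.of_le (by simp)),
    Finset.sum_eq_single_of_mem T (Finset.mem_univ T) fun S _ => hother S,
    setIntegral_eq_integral_of_forall_compl_eq_zero fun x hx =>
      hfderiv_zero T x fun hxT => hx (interior_subset hxT),
    setIntegral_eq_integral_of_forall_compl_eq_zero fun x hx => by
      rw [hψ_zero x fun hxT => hx (M.interior_hull_subset T hxT), mul_zero]] at hglue
  simpa only [mul_comm] using hglue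

lemma sum_integral_divergence_smul_eq_zero {u : M.cells → Eu d → Eu d}
    (hu : ∀ T, ContDiff ℝ 1 (u T)) (hglue : M.glue u ∈ HdivZero Ω) {φ : Eu d → ℝ}
    (hφ : ContDiff ℝ ∞ φ) (hs : HasCompactSupport φ) :
    ∑ T : M.cells, ∫ x in hull (T : Finset (Eu d)), divergence (φ • u T) x = 0 := by
  obtain ⟨-, q, hq, H⟩ := hglue
  have : IsFiniteMeasure (volume.restrict Ω) := ⟨by simpa using M.volume_domain_lt_top⟩
  have hqφ : IntegrableOn (fun x => q x * φ x) Ω :=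
    hq.integrable_mul ((hφ.continuous.memLp_of_hasCompactSupport (p := 2) hs).restrict Ω)
  have hφ' := hφ.continuous_fderiv (by simp)
  have hφc := hφ.continuous
  have hcell (T : M.cells) : ∫ x in hull (T : Finset (Eu d)), divergence (φ • u T) x =
      (∫ x in hull (T : Finset (Eu d)), q x * φ x) +
        ∫ x in hull (T : Finset (Eu d)), fderiv ℝ φ x (u T x) := by
    have huc := (hu T).continuous
    have hdiv := continuous_divergence (hu T)
    simp only [divergence_smul (hφ.differentiable (by simp)) ((hu T).differentiable one_ne_zero)]
    rw [integral_add (ContinuousOn.integrableOn_compact (isCompact_hull _) (by fun_prop))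
      (ContinuousOn.integrableOn_compact (isCompact_hull _) (by fun_prop)),
      setIntegral_congr_set (hull_ae_eq_interior (T : Finset (Eu d))),
      setIntegral_congr_set (f := fun x => q x * φ x) (hull_ae_eq_interior (T : Finset (Eu d)))]
    congr 1
    refine setIntegral_congr_ae isOpen_interior.measurableSet ?_
    filter_upwards [M.ae_eq_divergence_of_glue hu (hq.integrable one_le_two) H T] with x hx hxT
    rw [hx hxT, mul_comm]
  rw [Finset.sum_congr rfl fun T _ => hcell T, Finset.sum_add_distrib, ← M.setIntegral_domain hqφ,
    ← M.setIntegral_inner_glue_gradient (fun T => (hu T).continuous) (hφ.of_le (by simp)),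
    H φ hφ hs, add_neg_cancel]

lemma eventually_integral_hull_eq_zero {T : M.cells} {F : M.faces} (hT : F ∈ M.facesOf T)
    {x₀ : Eu d} (hx₀ : x₀ ∈ relInt (F : Finset (Eu d))) :
    ∀ᶠ s in (nhds x₀).smallSets, ∀ f : Eu d → ℝ, Function.support f ⊆ s →
      ∀ R : M.cells, F ∉ M.facesOf R → ∫ x in hull (R : Finset (Eu d)), f x = 0 := by
  filter_upwards [Filter.eventually_smallSets_forall.2 (M.eventually_notMem_hull hT hx₀)]
    with s hs f hf R hR
  exact setIntegral_eq_zero_of_forall_eq_zero fun x hx =>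
    by_contra fun hfx => hs x (hf hfx) R hR hx

lemma inner_sub_outwardNormal_of_mem_relInt (hd : 1 ≤ d) {u : M.cells → Eu d → Eu d}
    (hu : ∀ T, ContDiff ℝ 1 (u T)) (hglue : M.glue u ∈ HdivZero Ω) {S T : M.cells} {F : M.faces}
    (hne : S ≠ T) (hS : F ∈ M.facesOf S) (hT : F ∈ M.facesOf T) {x₀ : Eu d}
    (hx₀ : x₀ ∈ relInt (F : Finset (Eu d))) :
    inner ℝ (u T x₀ - u S x₀) (outwardNormal (T : Finset (Eu d)) F) = 0 := by
  obtain ⟨v, hv⟩ := M.exists_isFace hd hT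
  obtain ⟨v', hv'⟩ := M.exists_isFace hd hS
  obtain ⟨s, hs_nhds, hs⟩ := Filter.eventually_smallSets.1
    (((hv.eventually_setIntegral_hull_eq (M.isCell T) hx₀).and
      (hv'.eventually_setIntegral_hull_eq_neg (M.isCell S) hx₀)).and
      (M.eventually_integral_hull_eq_zero hT hx₀))
  obtain ⟨⟨hT_half, hS_half⟩, hother⟩ := hs s subset_rfl
  obtain ⟨r, hr, hrs⟩ := Metric.mem_nhds_iff.1 hs_nhds
  refine inner_eq_zero_of_forall_halfSpace (w := u T - u S) hr ((hu T).sub (hu S))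
    fun φ hφ hφc hφr => ?_
  have hφu (R : M.cells) : ContDiff ℝ 1 (φ • u R) := (hφ.of_le (by simp)).smul (hu R)
  have h_int (R : M.cells) : Integrable (divergence (φ • u R)) :=
    integrable_divergence (hφu R) hφc.smul_right
  have hsupp (R : M.cells) : Function.support (divergence (φ • u R)) ⊆ s := fun x hx =>
    hrs (hφr (tsupport_smul_subset_left φ (u R) (support_divergence_subset _ hx)))
  have hsum := M.sum_integral_divergence_smul_eq_zero hu hglue hφ hφc
  rw [Finset.sum_eq_add_of_mem T S (Finset.mem_univ _) (Finset.mem_univ _) hne.symm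
    fun R _ hR => hother _ (hsupp R) R fun hFR =>
      hR.2 (M.eq_of_ne_of_ne hd hT hFR hS hR.1 hne), hT_half _ (hsupp T),
    hS_half _ (hsupp S) (h_int S) (integral_divergence_eq_zero (hφu S) hφc.smul_right),
    M.outwardNormal_eq_neg hd hne hS hT, neg_neg, ← sub_eq_add_neg,
    ← integral_sub (h_int T).integrableOn (h_int S).integrableOn] at hsum
  simpa only [smul_sub, divergence_sub ((hφu T).differentiable one_ne_zero)
    ((hφu S).differentiable one_ne_zero)] using hsum

lemma inner_outwardNormal_eq_zero_of_mem_relInt (hd : 1 ≤ d) {u : M.cells → Eu d → Eu d}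
    (hu : ∀ T, ContDiff ℝ 1 (u T)) (hglue : M.glue u ∈ HdivZero Ω) {T : M.cells} {F : M.faces}
    (hT : F ∈ M.facesOf T) (hone : ∀ S : M.cells, F ∈ M.facesOf S → S = T) {x₀ : Eu d}
    (hx₀ : x₀ ∈ relInt (F : Finset (Eu d))) :
    inner ℝ (u T x₀) (outwardNormal (T : Finset (Eu d)) F) = 0 := by
  obtain ⟨v, hv⟩ := M.exists_isFace hd hT
  obtain ⟨s, hs_nhds, hs⟩ := Filter.eventually_smallSets.1
    ((hv.eventually_setIntegral_hull_eq (M.isCell T) hx₀).and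
      (M.eventually_integral_hull_eq_zero hT hx₀))
  obtain ⟨hT_half, hother⟩ := hs s subset_rfl
  obtain ⟨r, hr, hrs⟩ := Metric.mem_nhds_iff.1 hs_nhds
  refine inner_eq_zero_of_forall_halfSpace hr (hu T) fun φ hφ hφc hφr => ?_
  have hsupp (R : M.cells) : Function.support (divergence (φ • u R)) ⊆ s := fun x hx =>
    hrs (hφr (tsupport_smul_subset_left φ (u R) (support_divergence_subset _ hx)))
  rw [← hT_half _ (hsupp T), ← M.sum_integral_divergence_smul_eq_zero hu hglue hφ hφc]
  exact (Finset.sum_eq_single_of_mem T (Finset.mem_univ T) fun R _ hne =>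
    hother _ (hsupp R) R fun hFR => hne (hone R hFR)).symm

lemma inner_outwardNormal_eq_neg {k : ℕ} (hd : 1 ≤ d) {u : M.cells → Eu d → Eu d}
    (hu : u ∈ M.Vh k) {S T : M.cells} {F : M.faces} (hne : S ≠ T) (hS : F ∈ M.facesOf S)
    (hT : F ∈ M.facesOf T) {x : Eu d} (hx : x ∈ hull (F : Finset (Eu d))) :
    inner ℝ (u S x) (outwardNormal (S : Finset (Eu d)) F) =
      -inner ℝ (u T x) (outwardNormal (T : Finset (Eu d)) F) := by
  have hcont := fun T => continuous_of_mem_vecPoly (hu.1 T)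
  have hzero : Set.EqOn
      (fun x => inner ℝ (u T x - u S x) (outwardNormal (T : Finset (Eu d)) F)) (fun _ => 0)
      (relInt (F : Finset (Eu d))) := fun y hy =>
    M.inner_sub_outwardNormal_of_mem_relInt hd
      (fun T => (contDiff_of_mem_vecPoly (hu.1 T)).of_le (by simp)) hu.2 hne hS hT hy
  have hx_zero := hzero.closure (by fun_prop) continuous_const
    (hull_subset_closure_relInt (M.face_nonempty hd F) hx)
  rw [M.outwardNormal_eq_neg hd hne hS hT, inner_neg_right, neg_inj, eq_comm, ← sub_eq_zero,
    ← inner_sub_left]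
  exact hx_zero

lemma inner_outwardNormal_eq_zero {k : ℕ} (hd : 1 ≤ d) {u : M.cells → Eu d → Eu d}
    (hu : u ∈ M.Vh k) {T : M.cells} {F : M.faces} (hT : F ∈ M.facesOf T)
    (hone : ∀ S : M.cells, F ∈ M.facesOf S → S = T) {x : Eu d}
    (hx : x ∈ hull (F : Finset (Eu d))) :
    inner ℝ (u T x) (outwardNormal (T : Finset (Eu d)) F) = 0 := by
  have hcont := continuous_of_mem_vecPoly (hu.1 T)
  have hzero : Set.EqOn (fun x => inner ℝ (u T x) (outwardNormal (T : Finset (Eu d)) F))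
      (fun _ => 0) (relInt (F : Finset (Eu d))) := fun y hy =>
    M.inner_outwardNormal_eq_zero_of_mem_relInt hd
      (fun T => (contDiff_of_mem_vecPoly (hu.1 T)).of_le (by simp)) hu.2 hT hone hy
  exact hzero.closure (by fun_prop) continuous_const
    (hull_subset_closure_relInt (M.face_nonempty hd F) hx)

end Mesh

/-! ### M-matrices -/

section MMatrix

open Matrix

variable {ι R : Type*} [Fintype ι] [Ring R] [LinearOrder R] [IsStrictOrderedRing R]
  {A : Matrix ι ι R}

lemma nonneg_of_mulVec_nonneg (hoff : ∀ i j, i ≠ j → A i j ≤ 0) (hcol : ∀ j, 0 < ∑ i, A i j)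
    {x : ι → R} (hx : ∀ i, 0 ≤ (A *ᵥ x) i) (i : ι) : 0 ≤ x i := by
  classical
  by_contra! hi
  -- Summing the rows `i` with `x i < 0` makes every column contribute a non-positive amount.
  let I : Finset ι := {i | x i < 0}
  have hmem (j : ι) : j ∈ I ↔ x j < 0 := by simp [I]
  have hin (j : ι) (hj : j ∈ I) : 0 < ∑ i ∈ I, A i j := by
    refine (hcol j).trans_le ?_
    rw [← Finset.sum_add_sum_compl I]
    exact add_le_of_nonpos_right (Finset.sum_nonpos fun i hi =>
      hoff i j (ne_of_mem_of_not_mem hj (Finset.mem_compl.1 hi)).symm)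
  have hout (j : ι) (hj : j ∉ I) : ∑ i ∈ I, A i j ≤ 0 :=
    Finset.sum_nonpos fun i hi => hoff i j (ne_of_mem_of_not_mem hi hj)
  have hneg : ∑ j, (∑ i ∈ I, A i j) * x j < 0 := by
    refine Finset.sum_neg' (fun j _ => ?_)
      ⟨i, Finset.mem_univ i, mul_neg_of_pos_of_neg (hin i ((hmem i).2 hi)) hi⟩
    by_cases hj : j ∈ I
    · exact (mul_neg_of_pos_of_neg (hin j hj) ((hmem j).1 hj)).le
    · exact mul_nonpos_of_nonpos_of_nonneg (hout j hj) (not_lt.1 fun h => hj ((hmem j).2 h))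
  refine hneg.not_ge ?_
  simp only [Finset.sum_mul]
  rw [Finset.sum_comm]
  exact Finset.sum_nonneg fun i _ => hx i

lemma pos_of_mulVec_pos (hoff : ∀ i j, i ≠ j → A i j ≤ 0) (hcol : ∀ j, 0 < ∑ i, A i j)
    {x : ι → R} (hx : ∀ i, 0 < (A *ᵥ x) i) (i : ι) : 0 < x i := by
  have hnonneg := nonneg_of_mulVec_nonneg hoff hcol fun i => (hx i).le
  refine (hnonneg i).lt_of_ne fun hi => (hx i).not_ge (Finset.sum_nonpos fun j _ => ?_)
  obtain rfl | hij := eq_or_ne i j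
  · rw [← hi, mul_zero]
  · exact mul_nonpos_of_nonpos_of_nonneg (hoff i j hij) (hnonneg j)

lemma mulVec_injective_of_colSum_pos (hoff : ∀ i j, i ≠ j → A i j ≤ 0)
    (hcol : ∀ j, 0 < ∑ i, A i j) : Function.Injective A.mulVec := by
  intro x y hxy
  refine le_antisymm (fun i => ?_) fun i => ?_ <;> rw [← sub_nonneg]
  · exact nonneg_of_mulVec_nonneg hoff hcol (x := y - x) (fun i => by simp [mulVec_sub, hxy]) i
  · exact nonneg_of_mulVec_nonneg hoff hcol (x := x - y) (fun i => by simp [mulVec_sub, hxy]) i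

lemma isMMatrix_of_colSum_pos {A : Matrix ι ι ℝ} (hoff : ∀ i j, i ≠ j → A i j ≤ 0)
    (hcol : ∀ j, 0 < ∑ i, A i j) : IsMMatrix A := by
  classical
  have hdet : IsUnit A.det := (isUnit_iff_isUnit_det A).1
    (mulVec_injective_iff_isUnit.1 (mulVec_injective_of_colSum_pos hoff hcol))
  have hmul := mul_nonsing_inv A hdet
  refine ⟨hoff, A⁻¹, by convert hmul, by convert nonsing_inv_mul A hdet, fun i j => ?_⟩
  refine nonneg_of_mulVec_nonneg hoff hcol (x := A⁻¹.col j) (fun i => ?_) i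
  change 0 ≤ (A * A⁻¹) i j
  rw [hmul, one_apply]
  split_ifs <;> norm_num

end MMatrix

/-! ### The lowest order density update -/

/-- The upwind choice between the inner value `a` and the outer value `b` when `s` is the sign of
the outflow. -/
def upwindValue (s a b : ℝ) : ℝ := if 0 < s then a else if s < 0 then b else (a + b) / 2

lemma mul_upwindValue (s a b : ℝ) : s * upwindValue s a b = max s 0 * a - max (-s) 0 * b := by
  unfold upwindValue
  split_ifs with hpos hneg
  · rw [max_eq_left hpos.le, max_eq_right (neg_nonpos.2 hpos.le), zero_mul, sub_zero]
  · rw [max_eq_right hneg.le, max_eq_left (neg_nonneg.2 hneg.le)]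
    ring
  · simp [le_antisymm (not_lt.1 hpos) (not_lt.1 hneg)]

namespace Mesh

variable {d : ℕ} {Ω : Set (Eu d)} (M : Mesh d Ω)

/-- The flux of `u` through the face `F` out of the cell `T`, leaving out what flows into `T`, with
the flow direction given by the upwind rule. The corresponding flux into `T` is that of `-u`. -/
def outflow (rule : UpwindRule) (u : M.cells → Eu d → Eu d) (T : M.cells) (F : M.faces) : ℝ :=
  let n := outwardNormal (T : Finset (Eu d)) F
  match rule with
  | .pointwise => ∫ x in hull (F : Finset (Eu d)), max (inner ℝ (u T x) n) 0 ∂μHE[d - 1]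
  | .facewise => max (∫ x in hull (F : Finset (Eu d)), inner ℝ (u T x) n ∂μHE[d - 1]) 0

lemma outflow_nonneg (rule : UpwindRule) (u : M.cells → Eu d → Eu d) (T : M.cells) (F : M.faces) :
    0 ≤ M.outflow rule u T F := by
  cases rule
  · exact integral_nonneg fun x => le_max_right _ _
  · exact le_max_right _ _

lemma outflow_neg_eq {k : ℕ} (hd : 1 ≤ d) (rule : UpwindRule) {u : M.cells → Eu d → Eu d}
    (hu : u ∈ M.Vh k) {S T : M.cells} {F : M.faces} (hne : S ≠ T) (hS : F ∈ M.facesOf S)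
    (hT : F ∈ M.facesOf T) : M.outflow rule (-u) T F = M.outflow rule u S F := by
  have hface : Set.EqOn (fun x => inner ℝ ((-u) T x) (outwardNormal (T : Finset (Eu d)) F))
      (fun x => inner ℝ (u S x) (outwardNormal (S : Finset (Eu d)) F))
      (hull (F : Finset (Eu d))) := fun x hx => by
    simp only [Pi.neg_apply, inner_neg_left, M.inner_outwardNormal_eq_neg hd hu hne hS hT hx]
  have hmeas : MeasurableSet (hull (F : Finset (Eu d))) := (isClosed_hull _).measurableSet
  cases rule
  · exact setIntegral_congr_fun hmeas fun x hx => congrArg (max · 0) (hface hx)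
  · exact congrArg (max · 0) (setIntegral_congr_fun hmeas hface)

lemma outflow_eq_zero (rule : UpwindRule) {u : M.cells → Eu d → Eu d} {T : M.cells} {F : M.faces}
    (hu : ∀ x ∈ hull (F : Finset (Eu d)),
      inner ℝ (u T x) (outwardNormal (T : Finset (Eu d)) F) = 0) : M.outflow rule u T F = 0 := by
  cases rule
  · exact setIntegral_eq_zero_of_forall_eq_zero fun x hx => by rw [hu x hx, max_self]
  · simp only [outflow, setIntegral_eq_zero_of_forall_eq_zero hu, max_self]

/-- The cell across the face `F` of `T`, and `T` itself on boundary faces. -/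
def neighbour (T : M.cells) (F : M.faces) : M.cells :=
  open Classical in if h : ∃ S : M.cells, S ≠ T ∧ F ∈ M.facesOf S then h.choose else T

lemma outerValue_eq_neighbour (ρ : M.cells → Eu d → ℝ) (T : M.cells) (F : M.faces) (x : Eu d) :
    M.outerValue ρ T F x = ρ (M.neighbour T F) x := by
  unfold outerValue neighbour
  split_ifs <;> rfl

lemma neighbour_eq (hd : 1 ≤ d) {S T : M.cells} {F : M.faces} (hne : S ≠ T)
    (hS : F ∈ M.facesOf S) (hT : F ∈ M.facesOf T) : M.neighbour T F = S := by
  have h : ∃ S : M.cells, S ≠ T ∧ F ∈ M.facesOf S := ⟨S, hne, hS⟩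
  rw [neighbour, dif_pos h, M.eq_of_ne_of_ne hd hT hS h.choose_spec.2 hne h.choose_spec.1]

lemma integrableOn_face (F : M.faces) {f : Eu d → ℝ}
    (hf : ContinuousOn f (hull (F : Finset (Eu d)))) :
    IntegrableOn f (hull (F : Finset (Eu d))) μHE[d - 1] := by
  obtain ⟨T, hT⟩ := M.exists_cell F
  obtain rfl | hd := d.eq_zero_or_pos
  · simp [hull, Finset.card_eq_zero.1 (M.card_face F)]
  obtain ⟨v, hv⟩ := M.exists_isFace hd hT
  exact hv.integrableOn_hull (M.isCell T) hf

lemma upwind_const (rule : UpwindRule) (u : M.cells → Eu d → Eu d) (r : M.cells → ℝ) (T : M.cells)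
    (F : M.faces) (x : Eu d) : M.upwind rule (fun T _ => r T) u T F x =
      upwindValue (M.upwindSign rule u T F x) (r T) (r (M.neighbour T F)) := by
  rw [upwind, outerValue_eq_neighbour]
  rfl

lemma integral_inner_outwardNormal_mul_upwind (rule : UpwindRule)
    {u : M.cells → Eu d → Eu d} {T : M.cells} (hu : Continuous (u T)) (r : M.cells → ℝ)
    (F : M.faces) :
    ∫ x in hull (F : Finset (Eu d)), inner ℝ (u T x) (outwardNormal (T : Finset (Eu d)) F) *
      M.upwind rule (fun T _ => r T) u T F x ∂μHE[d - 1] =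
    M.outflow rule u T F * r T - M.outflow rule (-u) T F * r (M.neighbour T F) := by
  simp only [upwind_const]
  cases rule
  · simp only [upwindSign, outflow, mul_upwindValue, Pi.neg_apply, inner_neg_left]
    rw [integral_sub (Integrable.mul_const (M.integrableOn_face F (by fun_prop)) _)
      (Integrable.mul_const (M.integrableOn_face F (by fun_prop)) _), integral_mul_const,
      integral_mul_const]
  · simp only [upwindSign, outflow, Pi.neg_apply, inner_neg_left, integral_mul_const, integral_neg,
      mul_upwindValue]

/-- The discrete divergence of the mass flux `ρ u` for a piecewise constant density `ρ`: the net
upwind flux out of each cell. -/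
def upwindDivergence (rule : UpwindRule) (u : M.cells → Eu d → Eu d) :
    (M.cells → ℝ) →ₗ[ℝ] (M.cells → ℝ) :=
  LinearMap.pi fun T => ∑ F ∈ M.facesOf T, (M.outflow rule u T F • LinearMap.proj T -
    M.outflow rule (-u) T F • LinearMap.proj (M.neighbour T F))

lemma upwindDivergence_apply (rule : UpwindRule) (u : M.cells → Eu d → Eu d) (r : M.cells → ℝ)
    (T : M.cells) : M.upwindDivergence rule u r T = ∑ F ∈ M.facesOf T,
      (M.outflow rule u T F * r T - M.outflow rule (-u) T F * r (M.neighbour T F)) := by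
  simp [upwindDivergence]

lemma ch_const (rule : UpwindRule) {u : M.cells → Eu d → Eu d}
    (hu : ∀ T, Continuous (u T)) (r m : M.cells → ℝ) :
    M.ch rule (fun T _ => r T) u (fun T _ => m T) = ∑ T, m T * M.upwindDivergence rule u r T := by
  have hgrad (T : M.cells) (x : Eu d) : gradient (fun _ : Eu d => m T) x = 0 := gradient_const x _
  simp only [ch, hgrad, inner_zero_right, integral_zero, Finset.sum_const_zero, neg_zero, zero_add,
    integral_mul_const, M.integral_inner_outwardNormal_mul_upwind rule (hu _), ← Finset.sum_mul]
  simp only [upwindDivergence_apply, mul_comm]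

lemma sum_upwindDivergence {k : ℕ} (hd : 1 ≤ d) (rule : UpwindRule) {u : M.cells → Eu d → Eu d}
    (hu : u ∈ M.Vh k) (r : M.cells → ℝ) : ∑ T, M.upwindDivergence rule u r T = 0 := by
  classical
  simp only [upwindDivergence_apply]
  rw [Finset.sum_comm' (t' := Finset.univ)
    (s' := fun F => Finset.univ.filter fun T => F ∈ M.facesOf T) (by simp)]
  refine Finset.sum_eq_zero fun F _ => ?_
  obtain ⟨T, hT⟩ := M.exists_cell F
  by_cases hone : ∀ S : M.cells, F ∈ M.facesOf S → S = T
  · have hflux (x) (hx : x ∈ hull (F : Finset (Eu d))) :=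
      M.inner_outwardNormal_eq_zero hd hu hT hone hx
    rw [Finset.sum_eq_single_of_mem T (by simpa using hT) fun S hS hne =>
        absurd (hone S (by simpa using hS)) hne, M.outflow_eq_zero rule hflux,
      M.outflow_eq_zero rule fun x hx => by
        rw [Pi.neg_apply, Pi.neg_apply, inner_neg_left, hflux x hx, neg_zero],
      zero_mul, zero_mul, sub_zero]
  · push Not at hone
    obtain ⟨S, hS, hne⟩ := hone
    rw [Finset.sum_eq_add_of_mem T S (by simpa using hT) (by simpa using hS) hne.symm fun R hR h =>
        absurd (M.eq_of_ne_of_ne hd hT (by simpa using hR) hS h.1 hne) h.2,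
      M.neighbour_eq hd hne hS hT, M.neighbour_eq hd hne.symm hT hS,
      M.outflow_neg_eq hd rule hu hne hS hT, M.outflow_neg_eq hd rule hu hne.symm hT hS]
    ring

lemma measureReal_hull_pos (T : M.cells) : 0 < volume.real (hull (T : Finset (Eu d))) :=
  ENNReal.toReal_pos
    (Measure.measure_pos_of_nonempty_interior volume (M.isCell T).interior_nonempty).ne'
    (isCompact_hull _).measure_lt_top.ne

lemma ip_const (r m : M.cells → ℝ) :
    M.ip (fun T _ => r T) (fun T _ => m T) =
      ∑ T : M.cells, m T * (volume.real (hull (T : Finset (Eu d))) * r T) := by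
  refine Finset.sum_congr rfl fun T _ => ?_
  rw [setIntegral_const, smul_eq_mul]
  ring

lemma densityMatrix_eq [DecidableEq M.cells] (rule : UpwindRule) (τ : ℝ)
    {u : M.cells → Eu d → Eu d} (hu : ∀ T, Continuous (u T)) :
    M.densityMatrix rule τ u =
      Matrix.diagonal (fun T : M.cells => τ⁻¹ * volume.real (hull (T : Finset (Eu d)))) +
        LinearMap.toMatrix' (M.upwindDivergence rule u) := by
  have hchi (S : M.cells) : M.chi S = fun T _ => (Pi.single S 1 : M.cells → ℝ) T := by
    ext T x
    simp only [chi, Pi.single_apply]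
    congr
  ext T S
  rw [densityMatrix, Matrix.of_apply, hchi, hchi, M.ip_const, M.ch_const rule hu,
    Finset.sum_eq_single_of_mem T (Finset.mem_univ T) fun R _ hR => by
      rw [Pi.single_eq_of_ne hR, zero_mul],
    Finset.sum_eq_single_of_mem T (Finset.mem_univ T) fun R _ hR => by
      rw [Pi.single_eq_of_ne hR, zero_mul], Pi.single_eq_same, one_mul, one_mul, Matrix.add_apply,
    LinearMap.toMatrix'_apply, Matrix.diagonal_apply, Pi.single_apply, mul_ite, mul_one, mul_zero,
    mul_ite, mul_zero]

open Matrix in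
lemma densityMatrix_mulVec (rule : UpwindRule) (τ : ℝ) {u : M.cells → Eu d → Eu d}
    (hu : ∀ T, Continuous (u T)) (r : M.cells → ℝ) (T : M.cells) :
    (M.densityMatrix rule τ u *ᵥ r) T =
      τ⁻¹ * (volume.real (hull (T : Finset (Eu d))) * r T) + M.upwindDivergence rule u r T := by
  classical
  rw [M.densityMatrix_eq rule τ hu, add_mulVec, Pi.add_apply, mulVec_diagonal,
    LinearMap.toMatrix'_mulVec, mul_assoc]

lemma densityMatrix_nonpos_of_ne (rule : UpwindRule) (τ : ℝ)
    {u : M.cells → Eu d → Eu d} (hu : ∀ T, Continuous (u T)) (T S : M.cells) (hne : T ≠ S) :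
    M.densityMatrix rule τ u T S ≤ 0 := by
  classical
  rw [M.densityMatrix_eq rule τ hu, Matrix.add_apply, Matrix.diagonal_apply_ne _ hne, zero_add,
    LinearMap.toMatrix'_apply, upwindDivergence_apply, Pi.single_eq_of_ne hne]
  have hsingle : (0 : M.cells → ℝ) ≤ Pi.single S 1 := Pi.single_nonneg.2 zero_le_one
  refine Finset.sum_nonpos fun F _ => ?_
  rw [mul_zero, zero_sub, neg_nonpos]
  exact mul_nonneg (M.outflow_nonneg rule (-u) T F) (hsingle (M.neighbour T F))

lemma sum_densityMatrix {k : ℕ} (hd : 1 ≤ d) (rule : UpwindRule) (τ : ℝ)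
    {u : M.cells → Eu d → Eu d} (hu : u ∈ M.Vh k) (S : M.cells) :
    ∑ T, M.densityMatrix rule τ u T S = τ⁻¹ * volume.real (hull (S : Finset (Eu d))) := by
  classical
  rw [M.densityMatrix_eq rule τ fun T => continuous_of_mem_vecPoly (hu.1 T)]
  simp only [Matrix.add_apply, LinearMap.toMatrix'_apply, Finset.sum_add_distrib,
    M.sum_upwindDivergence hd rule hu, add_zero, Matrix.diagonal_apply, Finset.sum_ite_eq',
    Finset.mem_univ, if_true]

lemma sum_densityMatrix_pos {k : ℕ} (hd : 1 ≤ d) (rule : UpwindRule) {τ : ℝ} (hτ : 0 < τ)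
    {u : M.cells → Eu d → Eu d} (hu : u ∈ M.Vh k) (S : M.cells) :
    0 < ∑ T, M.densityMatrix rule τ u T S := by
  rw [M.sum_densityMatrix hd rule τ hu]
  exact mul_pos (inv_pos.2 hτ) (M.measureReal_hull_pos S)

lemma const_mem_Qh (k : ℕ) (r : M.cells → ℝ) : (fun T _ => r T) ∈ M.Qh k :=
  fun T => const_mem_polySpace (r T)

lemma exists_eq_const_of_mem_Qh {ρ : M.cells → Eu d → ℝ} (hρ : ρ ∈ M.Qh 1) :
    ∃ r : M.cells → ℝ, ρ = fun T _ => r T := by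
  choose r hr using fun T => eq_const_of_mem_polySpace_zero (hρ T)
  exact ⟨r, funext hr⟩

open Matrix in
lemma isDensityUpdate_const_iff (rule : UpwindRule) (τ : ℝ)
    {u : M.cells → Eu d → Eu d} (hu : ∀ T, Continuous (u T)) (r r' : M.cells → ℝ) :
    M.IsDensityUpdate 1 rule τ u (fun T _ => r T) (fun T _ => r' T) ↔
      M.densityMatrix rule τ u *ᵥ r' =
        fun T : M.cells => τ⁻¹ * (volume.real (hull (T : Finset (Eu d))) * r T) := by
  classical
  have htest (m : M.cells → ℝ) : (τ⁻¹ * M.ip (fun T _ => r' T) (fun T _ => m T) +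
      M.ch rule (fun T _ => r' T) u (fun T _ => m T) =
        τ⁻¹ * M.ip (fun T _ => r T) (fun T _ => m T)) ↔
      m ⬝ᵥ (M.densityMatrix rule τ u *ᵥ r') =
        m ⬝ᵥ fun T : M.cells => τ⁻¹ * (volume.real (hull (T : Finset (Eu d))) * r T) := by
    simp only [dotProduct, M.densityMatrix_mulVec rule τ hu, M.ip_const, M.ch_const rule hu,
      mul_add, Finset.sum_add_distrib, Finset.mul_sum, mul_left_comm]
  constructor
  · rintro ⟨-, h⟩
    exact dotProduct_eq _ _ fun m => by
      rw [dotProduct_comm, (htest m).1 (h _ (M.const_mem_Qh 1 m)), dotProduct_comm]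
  · refine fun h => ⟨M.const_mem_Qh 1 r', fun μ hμ => ?_⟩
    obtain ⟨m, rfl⟩ := M.exists_eq_const_of_mem_Qh hμ
    exact (htest m).2 (congrArg _ h)

theorem isMMatrix_densityMatrix {k : ℕ} (hd : 1 ≤ d) (rule : UpwindRule) {τ : ℝ} (hτ : 0 < τ)
    {u : M.cells → Eu d → Eu d} (hu : u ∈ M.Vh k) : IsMMatrix (M.densityMatrix rule τ u) :=
  isMMatrix_of_colSum_pos
    (M.densityMatrix_nonpos_of_ne rule τ fun T => continuous_of_mem_vecPoly (hu.1 T))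
    (M.sum_densityMatrix_pos hd rule hτ hu)

theorem existsUnique_densityUpdate {k : ℕ} (hd : 1 ≤ d) (rule : UpwindRule) {τ : ℝ} (hτ : 0 < τ)
    {u : M.cells → Eu d → Eu d} (hu : u ∈ M.Vh k) {ρ : M.cells → Eu d → ℝ} (hρ : ρ ∈ M.Qh 1) :
    ∃! ρ' : M.cells → Eu d → ℝ, M.IsDensityUpdate 1 rule τ u ρ ρ' := by
  classical
  have huc := fun T => continuous_of_mem_vecPoly (hu.1 T)
  have hinj := mulVec_injective_of_colSum_pos (M.densityMatrix_nonpos_of_ne rule τ huc)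
    (M.sum_densityMatrix_pos hd rule hτ hu)
  obtain ⟨r, rfl⟩ := M.exists_eq_const_of_mem_Qh hρ
  obtain ⟨r', hr'⟩ := Matrix.mulVec_surjective_iff_isUnit.2
    (Matrix.mulVec_injective_iff_isUnit.1 hinj)
    fun T : M.cells => τ⁻¹ * (volume.real (hull (T : Finset (Eu d))) * r T)
  refine ⟨fun T _ => r' T, (M.isDensityUpdate_const_iff rule τ huc r r').2 hr',
    fun ρ' hρ' => ?_⟩
  obtain ⟨s, rfl⟩ := M.exists_eq_const_of_mem_Qh hρ'.1
  rw [hinj (((M.isDensityUpdate_const_iff rule τ huc r s).1 hρ').trans hr'.symm)]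

variable {M}

theorem IsDensityUpdate.isPositive {k : ℕ} (hd : 1 ≤ d) {rule : UpwindRule} {τ : ℝ} (hτ : 0 < τ)
    {u : M.cells → Eu d → Eu d} (hu : u ∈ M.Vh k) {ρ ρ' : M.cells → Eu d → ℝ} (hρ : ρ ∈ M.Qh 1)
    (hpos : M.IsPositive ρ) (h : M.IsDensityUpdate 1 rule τ u ρ ρ') : M.IsPositive ρ' := by
  have huc := fun T => continuous_of_mem_vecPoly (hu.1 T)
  obtain ⟨r, rfl⟩ := M.exists_eq_const_of_mem_Qh hρ
  obtain ⟨r', rfl⟩ := M.exists_eq_const_of_mem_Qh h.1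
  refine fun T _ _ => pos_of_mulVec_pos (M.densityMatrix_nonpos_of_ne rule τ huc)
    (M.sum_densityMatrix_pos hd rule hτ hu) (fun S => ?_) T
  obtain ⟨y, hy⟩ := (M.isCell S).interior_nonempty
  rw [(M.isDensityUpdate_const_iff rule τ huc r r').1 h]
  exact mul_pos (inv_pos.2 hτ) (mul_pos (M.measureReal_hull_pos S) (hpos S y (interior_subset hy)))

theorem IsDensityUpdate.mass_eq {k : ℕ} (hd : 1 ≤ d) {rule : UpwindRule} {τ : ℝ} (hτ : τ ≠ 0)
    {u : M.cells → Eu d → Eu d} (hu : u ∈ M.Vh k) {ρ ρ' : M.cells → Eu d → ℝ}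
    (h : M.IsDensityUpdate 1 rule τ u ρ ρ') : M.mass ρ' = M.mass ρ := by
  obtain ⟨r', rfl⟩ := M.exists_eq_const_of_mem_Qh h.1
  have hone := h.2 _ (M.const_mem_Qh 1 fun _ => 1)
  rw [M.ch_const rule fun T => continuous_of_mem_vecPoly (hu.1 T)] at hone
  simp only [one_mul, M.sum_upwindDivergence hd rule hu, add_zero] at hone
  exact mul_left_cancel₀ (inv_ne_zero hτ) hone

end Mesh

/-! ### The discrete spaces -/

section HdivZero

variable {d : ℕ}

lemma integrable_inner_gradient {μ : Measure (Eu d)} [IsFiniteMeasureOnCompacts μ]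
    {w : Eu d → Eu d} (hw : MemLp w 2 μ) {φ : Eu d → ℝ} (hφ : ContDiff ℝ 1 φ)
    (hs : HasCompactSupport φ) : Integrable (fun x => inner ℝ (w x) (gradient φ x)) μ := by
  have hcont : Continuous (gradient φ) :=
    (InnerProductSpace.toDual ℝ (Eu d)).symm.continuous.comp (hφ.continuous_fderiv one_ne_zero)
  have hmem : MemLp (gradient φ) 2 μ :=
    hcont.memLp_of_hasCompactSupport ((hs.fderiv ℝ).comp_left (map_zero _))
  refine (hw.norm.integrable_mul hmem.norm).mono' (hw.1.inner hmem.1) ?_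
  exact Filter.Eventually.of_forall fun x => norm_inner_le_norm _ _

/-- `H_0(div, Ω)` as a submodule. -/
def HdivZeroSubmodule (Ω : Set (Eu d)) : Submodule ℝ (Eu d → Eu d) where
  carrier := HdivZero Ω
  zero_mem' := ⟨MemLp.zero, 0, MemLp.zero, fun φ _ _ => by simp⟩
  add_mem' := by
    rintro w w' ⟨hw, q, hq, h⟩ ⟨hw', q', hq', h'⟩
    refine ⟨hw.add hw', q + q', hq.add hq', fun φ hφ hs => ?_⟩
    have hmem : MemLp φ 2 (volume.restrict Ω) := hφ.continuous.memLp_of_hasCompactSupport hs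
    have hφ' : ContDiff ℝ 1 φ := hφ.of_le (by simp)
    have h_int : Integrable (fun x => q x * φ x) (volume.restrict Ω) := hq.integrable_mul hmem
    have h_int' : Integrable (fun x => q' x * φ x) (volume.restrict Ω) := hq'.integrable_mul hmem
    simp only [Pi.add_apply, inner_add_left, add_mul]
    rw [integral_add (integrable_inner_gradient hw hφ' hs) (integrable_inner_gradient hw' hφ' hs),
      integral_add h_int h_int', h φ hφ hs, h' φ hφ hs, neg_add]
  smul_mem' := by
    rintro c w ⟨hw, q, hq, h⟩
    refine ⟨hw.const_smul c, c • q, hq.const_smul c, fun φ hφ hs => ?_⟩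
    simp only [Pi.smul_apply, real_inner_smul_left, smul_eq_mul, mul_assoc, integral_const_mul]
    rw [h φ hφ hs, mul_neg]

end HdivZero

namespace Mesh

variable {d : ℕ} {Ω : Set (Eu d)} (M : Mesh d Ω) (k : ℕ)

/-- `glue` as a linear map. -/
def glueₗ : (M.cells → Eu d → Eu d) →ₗ[ℝ] (Eu d → Eu d) where
  toFun := M.glue
  map_add' u v := by
    ext1 x
    simp only [glue, Pi.add_apply, ← Finset.sum_add_distrib, Set.indicator_add']
  map_smul' c u := by
    ext1 x
    simp only [glue, Pi.smul_apply, Finset.smul_sum, RingHom.id_apply]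
    exact Finset.sum_congr rfl fun T _ => congrFun (Set.indicator_const_smul _ c (u T)) x

/-- `V_h` as a submodule. -/
def VhSubmodule : Submodule ℝ (M.cells → Eu d → Eu d) :=
  ((Submodule.pi Set.univ fun _ => vecPolySubmodule d k) ⊓
    (HdivZeroSubmodule Ω).comap M.glueₗ).copy (M.Vh k) <| by
      ext u
      exact and_congr_left' ⟨fun h T _ => h T, fun h T => h T trivial⟩

/-- The space of facet unknowns as a submodule. -/
def VhatSubmodule : Submodule ℝ (M.faces → Eu d → Eu d) where
  carrier := M.Vhat k
  zero_mem' := ⟨fun _ => ⟨0, (vecPolySubmodule d k).zero_mem, by simp⟩, by simp, fun _ _ => rfl⟩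
  add_mem' := by
    rintro u v ⟨hu, hu_tangential, hu_boundary⟩ ⟨hv, hv_tangential, hv_boundary⟩
    refine ⟨fun F => ?_, fun T F hF x hx => ?_, fun F hF => ?_⟩
    · obtain ⟨p, hp, hup⟩ := hu F
      obtain ⟨q, hq, hvq⟩ := hv F
      exact ⟨p + q, (vecPolySubmodule d k).add_mem hp hq, by
        rw [Pi.add_apply, hup, hvq, Set.indicator_add']⟩
    · rw [Pi.add_apply, Pi.add_apply, inner_add_left, hu_tangential T F hF x hx,
        hv_tangential T F hF x hx, add_zero]
    · rw [Pi.add_apply, hu_boundary F hF, hv_boundary F hF, add_zero]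
  smul_mem' := by
    rintro c u ⟨hu, hu_tangential, hu_boundary⟩
    refine ⟨fun F => ?_, fun T F hF x hx => ?_, fun F hF => ?_⟩
    · obtain ⟨p, hp, hup⟩ := hu F
      exact ⟨c • p, (vecPolySubmodule d k).smul_mem c hp, by
        rw [Pi.smul_apply, hup]; exact (Set.indicator_const_smul _ c p).symm⟩
    · rw [Pi.smul_apply, Pi.smul_apply, real_inner_smul_left, hu_tangential T F hF x hx, mul_zero]
    · rw [Pi.smul_apply, hu_boundary F hF, smul_zero]

/-- The space `V_h × V̂_h` of cell and facet unknowns. -/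
abbrev HDGSpace : Type := M.VhSubmodule k × M.VhatSubmodule k

variable {k}

instance finiteDimensional_VhSubmodule : FiniteDimensional ℝ (M.VhSubmodule k) := by
  let restrict : M.VhSubmodule k →ₗ[ℝ] (M.cells → vecPolySubmodule d k) :=
    { toFun := fun u T => ⟨u.1 T, u.2.1 T⟩
      map_add' := fun _ _ => rfl
      map_smul' := fun _ _ => rfl }
  refine FiniteDimensional.of_injective restrict fun u v h => ?_
  ext1
  funext T
  exact congrArg Subtype.val (congrFun h T)

instance finiteDimensional_VhatSubmodule : FiniteDimensional ℝ (M.VhatSubmodule k) := by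
  let truncate : (M.faces → vecPolySubmodule d k) →ₗ[ℝ] (M.faces → Eu d → Eu d) :=
    { toFun := fun p F => (hull (F : Finset (Eu d))).indicator (p F)
      map_add' := fun p q => funext fun F => Set.indicator_add' _ _ _
      map_smul' := fun c p => funext fun F => Set.indicator_const_smul _ c _ }
  have hle : M.VhatSubmodule k ≤ LinearMap.range truncate := by
    intro v hv
    choose p hp h using hv.1
    exact ⟨fun F => ⟨p F, hp F⟩, funext fun F => (h F).symm⟩
  exact Submodule.finiteDimensional_of_le hle

lemma continuousOn_of_mem_Vhat {v : M.faces → Eu d → Eu d} (h : v ∈ M.Vhat k) (F : M.faces) :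
    ContinuousOn (v F) (hull (F : Finset (Eu d))) := by
  obtain ⟨p, hp, hvp⟩ := h.1 F
  rw [hvp, continuousOn_congr (Set.eqOn_indicator)]
  exact (continuous_of_mem_vecPoly hp).continuousOn

end Mesh

/-! ### The form `a_h` and the right-hand side -/

section IntegralInner

variable {X E V W : Type*} [MeasurableSpace X] [NormedAddCommGroup E] [InnerProductSpace ℝ E]
  [AddCommGroup V] [Module ℝ V] [AddCommGroup W] [Module ℝ W] (μ : Measure X)

/-- The linear functional `w ↦ ∫ f · B w`. -/
def integralInnerRight (f : X → E) (B : W →ₗ[ℝ] X → E)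
    (h : ∀ w, Integrable (fun x => inner ℝ (f x) (B w x)) μ) : W →ₗ[ℝ] ℝ where
  toFun w := ∫ x, inner ℝ (f x) (B w x) ∂μ
  map_add' w w' := by
    simp only [map_add, Pi.add_apply, inner_add_right]
    exact integral_add (h w) (h w')
  map_smul' c w := by
    simp only [map_smul, Pi.smul_apply, real_inner_smul_right, integral_const_mul, smul_eq_mul,
      RingHom.id_apply]

/-- The bilinear form `(v, w) ↦ ∫ A v · B w`. -/
def integralInner (A : V →ₗ[ℝ] X → E) (B : W →ₗ[ℝ] X → E)
    (h : ∀ v w, Integrable (fun x => inner ℝ (A v x) (B w x)) μ) : V →ₗ[ℝ] W →ₗ[ℝ] ℝ where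
  toFun v := integralInnerRight μ (A v) B (h v)
  map_add' v v' := by
    ext w
    change ∫ x, inner ℝ (A (v + v') x) (B w x) ∂μ = _
    simp only [map_add, Pi.add_apply, inner_add_left]
    exact integral_add (h v w) (h v' w)
  map_smul' c v := by
    ext w
    change ∫ x, inner ℝ (A (c • v) x) (B w x) ∂μ = _
    simp only [map_smul, Pi.smul_apply, real_inner_smul_left, integral_const_mul]
    rfl

end IntegralInner

section LinearOperators

variable {d k : ℕ}

/-- The tangential projection `tang n` as a continuous linear map. -/
def tangL (n : Eu d) : Eu d →L[ℝ] Eu d :=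
  ContinuousLinearMap.id ℝ (Eu d) - (innerSL ℝ n).smulRight n

lemma tangL_apply (n v : Eu d) : tangL n v = tang n v := by
  simp [tangL, tang, real_inner_comm]

/-- The derivative of polynomial vector fields in the direction `n`, as a linear map. -/
def directionalDerivₗ (n : Eu d) : vecPolySubmodule d k →ₗ[ℝ] (Eu d → Eu d) where
  toFun u x := fderiv ℝ u x n
  map_add' u v := by
    ext1 x
    simp [fderiv_add (differentiable_of_mem_vecPoly u.2 x) (differentiable_of_mem_vecPoly v.2 x)]
  map_smul' c u := by
    ext1 x
    simp [fderiv_const_smul (differentiable_of_mem_vecPoly u.2 x)]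

/-- The divergence of polynomial vector fields, as a linear map. -/
def divergenceₗ : vecPolySubmodule d k →ₗ[ℝ] (Eu d → ℝ) where
  toFun u := divergence u
  map_add' u v := by
    ext1 x
    simp [divergence, Finset.sum_add_distrib,
      fderiv_add (differentiable_of_mem_vecPoly u.2 x) (differentiable_of_mem_vecPoly v.2 x)]
  map_smul' c u := by
    ext1 x
    simp [divergence, Finset.mul_sum, fderiv_const_smul (differentiable_of_mem_vecPoly u.2 x)]

lemma continuous_fderiv_apply_of_mem_vecPoly {u : Eu d → Eu d} (hu : u ∈ vecPoly d k) (n : Eu d) :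
    Continuous fun x => fderiv ℝ u x n := by
  have := continuous_fderiv_of_mem_vecPoly hu
  fun_prop

lemma integrableOn_inner {E : Type*} [NormedAddCommGroup E] [InnerProductSpace ℝ E] {K : Set (Eu d)}
    (hK : IsCompact K) {f v : Eu d → E} (hf : IntegrableOn f K) (hv : Continuous v) :
    IntegrableOn (fun x => inner ℝ (f x) (v x)) K := by
  obtain ⟨C, hC⟩ := hK.exists_bound_of_continuousOn hv.continuousOn
  refine Integrable.mono' (hf.norm.mul_const C)
    (hf.aestronglyMeasurable.inner hv.aestronglyMeasurable) ?_
  refine (ae_restrict_iff' hK.measurableSet).2 (Filter.Eventually.of_forall fun x hx => ?_)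
  exact (norm_inner_le_norm _ _).trans (by gcongr; exact hC x hx)

end LinearOperators

namespace Mesh

variable {d : ℕ} {Ω : Set (Eu d)} (M : Mesh d Ω) {k : ℕ}

/-- The tangential jump across the face `F` of `T`, from the cell unknown to the facet unknown. -/
def jump (u : M.cells → Eu d → Eu d) (uh : M.faces → Eu d → Eu d) (T : M.cells) (F : M.faces)
    (x : Eu d) : Eu d :=
  tang (outwardNormal (T : Finset (Eu d)) F) (uh F x - u T x)

lemma continuousOn_jump {u : M.cells → Eu d → Eu d} {uh : M.faces → Eu d → Eu d} (T : M.cells)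
    (hu : u T ∈ vecPoly d k) (huh : uh ∈ M.Vhat k) (F : M.faces) :
    ContinuousOn (M.jump u uh T F) (hull (F : Finset (Eu d))) := by
  have := M.continuousOn_of_mem_Vhat huh F
  have := continuous_of_mem_vecPoly hu
  unfold jump
  simp only [← tangL_apply]
  fun_prop

lemma integrableOn_inner_face (F : M.faces) {f g : Eu d → Eu d}
    (hf : ContinuousOn f (hull (F : Finset (Eu d))))
    (hg : ContinuousOn g (hull (F : Finset (Eu d)))) :
    IntegrableOn (fun x => inner ℝ (f x) (g x)) (hull (F : Finset (Eu d))) μHE[d - 1] :=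
  M.integrableOn_face F (hf.inner hg)

/-- The restriction of the cell unknown to `T`. -/
def cellPart (T : M.cells) : M.HDGSpace k →ₗ[ℝ] vecPolySubmodule d k where
  toFun w := ⟨w.1.1 T, w.1.2.1 T⟩
  map_add' _ _ := rfl
  map_smul' _ _ := rfl

/-- The tangential jump as a linear map. -/
def jumpₗ (T : M.cells) (F : M.faces) : M.HDGSpace k →ₗ[ℝ] (Eu d → Eu d) where
  toFun w := M.jump w.1 w.2 T F
  map_add' w z := by
    ext1 x
    have hdiff : (w + z).2.1 F x - (w + z).1.1 T x =
        (w.2.1 F x - w.1.1 T x) + (z.2.1 F x - z.1.1 T x) := add_sub_add_comm _ _ _ _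
    simp only [jump, ← tangL_apply, hdiff, map_add, Pi.add_apply]
  map_smul' c w := by
    ext1 x
    have hdiff : (c • w).2.1 F x - (c • w).1.1 T x = c • (w.2.1 F x - w.1.1 T x) :=
      (smul_sub c _ _).symm
    simp only [jump, ← tangL_apply, hdiff, map_smul, Pi.smul_apply, RingHom.id_apply]

/-- The bilinear form `(∇u, ∇v)_T`. -/
def gradForm (T : M.cells) : LinearMap.BilinForm ℝ (M.HDGSpace k) :=
  integralInner (volume.restrict (hull (T : Finset (Eu d)))) (jacobianₗ ∘ₗ M.cellPart T)
    (jacobianₗ ∘ₗ M.cellPart T) fun w z => by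
      have hcont := continuous_gradProd (w.1.2.1 T) (z.1.2.1 T)
      rw [funext (gradProd_eq_inner _ _)] at hcont
      exact hcont.continuousOn.integrableOn_compact (isCompact_hull _)

/-- The bilinear form `(∇u n, (v̂ - v)_t)_F` on the face `F` of `T`. -/
def consistencyForm (T : M.cells) (F : M.faces) : LinearMap.BilinForm ℝ (M.HDGSpace k) :=
  integralInner (μHE[d - 1].restrict (hull (F : Finset (Eu d))))
    (directionalDerivₗ (outwardNormal (T : Finset (Eu d)) F) ∘ₗ M.cellPart T) (M.jumpₗ T F)
    fun w z => M.integrableOn_inner_face F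
      (continuous_fderiv_apply_of_mem_vecPoly (w.1.2.1 T) _).continuousOn
      (M.continuousOn_jump T (z.1.2.1 T) z.2.2 F)

/-- The bilinear form `((û - u)_t, (v̂ - v)_t)_F` on the face `F` of `T`. -/
def penaltyForm (T : M.cells) (F : M.faces) : LinearMap.BilinForm ℝ (M.HDGSpace k) :=
  integralInner (μHE[d - 1].restrict (hull (F : Finset (Eu d)))) (M.jumpₗ T F) (M.jumpₗ T F)
    fun w z => M.integrableOn_inner_face F (M.continuousOn_jump T (w.1.2.1 T) w.2.2 F)
      (M.continuousOn_jump T (z.1.2.1 T) z.2.2 F)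

/-- The contribution of the cell `T` to the form `a_h`, with weight `c` in front of the penalty
terms. -/
def cellForm (c : ℝ) (T : M.cells) : LinearMap.BilinForm ℝ (M.HDGSpace k) :=
  M.gradForm T + ∑ F ∈ M.facesOf T,
    (M.consistencyForm T F + (M.consistencyForm T F).flip + c • M.penaltyForm T F)

/-- The form `a_h` as a bilinear form on `V_h × V̂_h`. -/
def ahBilin (α : ℝ) : LinearMap.BilinForm ℝ (M.HDGSpace k) :=
  ∑ T : M.cells, M.cellForm (α * (k : ℝ) ^ 2 / M.meshSize) T

lemma cellForm_apply (c : ℝ) (T : M.cells) (w z : M.HDGSpace k) :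
    M.cellForm c T w z = M.gradForm T w z + ∑ F ∈ M.facesOf T,
      (M.consistencyForm T F w z + M.consistencyForm T F z w + c * M.penaltyForm T F w z) := by
  simp [cellForm, LinearMap.sum_apply]

lemma ahBilin_apply (α : ℝ) (w z : M.HDGSpace k) :
    M.ahBilin α w z = M.ah k α w.1 w.2 z.1 z.2 := by
  simp only [ahBilin, LinearMap.sum_apply, cellForm_apply]
  rfl

lemma gradForm_self (T : M.cells) (w : M.HDGSpace k) :
    M.gradForm T w w = ∫ x in hull (T : Finset (Eu d)), gradProd (w.1.1 T) (w.1.1 T) x := rfl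

lemma penaltyForm_self (T : M.cells) (F : M.faces) (w : M.HDGSpace k) :
    M.penaltyForm T F w w =
      ∫ x in hull (F : Finset (Eu d)), ‖M.jump w.1 w.2 T F x‖ ^ 2 ∂μHE[d - 1] := by
  simp_rw [← real_inner_self_eq_norm_sq]
  rfl

lemma integrableOn_inner_hull {E : Type*} [NormedAddCommGroup E] [InnerProductSpace ℝ E]
    {f v : Eu d → E} (hf : IntegrableOn f Ω) (hv : Continuous v) (T : M.cells) :
    IntegrableOn (fun x => inner ℝ (f x) (v x)) (hull (T : Finset (Eu d))) :=
  integrableOn_inner (isCompact_hull _) (hf.mono_set_ae (M.hull_ae_le_domain T)) hv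

/-- The right-hand side of the velocity update, as a linear functional. -/
def velocityRhs (cM : ℝ) {f g : Eu d → Eu d} (hf : IntegrableOn f Ω) (hg : IntegrableOn g Ω)
    {ρ : M.cells → Eu d → ℝ} (hρ : ∀ T, Continuous (ρ T)) : M.HDGSpace k →ₗ[ℝ] ℝ :=
  ∑ T : M.cells, (
    integralInnerRight (volume.restrict (hull (T : Finset (Eu d)))) f
      ((vecPolySubmodule d k).subtype ∘ₗ M.cellPart T)
      (fun w => M.integrableOn_inner_hull hf (continuous_of_mem_vecPoly (w.1.2.1 T)) T) +
    integralInnerRight (volume.restrict (hull (T : Finset (Eu d)))) g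
      (ρ T • ((vecPolySubmodule d k).subtype ∘ₗ M.cellPart T))
      (fun w => M.integrableOn_inner_hull hg
        ((hρ T).smul (continuous_of_mem_vecPoly (w.1.2.1 T))) T) +
    integralInnerRight (volume.restrict (hull (T : Finset (Eu d)))) (fun x => cM * ρ T x)
      (divergenceₗ ∘ₗ M.cellPart T)
      (fun w => integrableOn_inner (isCompact_hull _)
        ((continuous_const.mul (hρ T)).continuousOn.integrableOn_compact (isCompact_hull _))
        (continuous_divergence ((contDiff_of_mem_vecPoly (w.1.2.1 T)).of_le (by simp)))))

lemma velocityRhs_apply (cM : ℝ) {f g : Eu d → Eu d} (hf : IntegrableOn f Ω)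
    (hg : IntegrableOn g Ω) {ρ : M.cells → Eu d → ℝ} (hρ : ∀ T, Continuous (ρ T))
    (w : M.HDGSpace k) :
    M.velocityRhs cM hf hg hρ w =
      M.Fform f w.1 + M.Gform g ρ w.1 - M.bform (fun T x => cM * ρ T x) w.1 := by
  simp only [velocityRhs, LinearMap.sum_apply, LinearMap.add_apply, Finset.sum_add_distrib, bform,
    sub_neg_eq_add]
  congr 2
  exact funext fun T => integral_congr_ae (.of_forall fun x => mul_comm _ _)

end Mesh

/-! ### Coercivity of `a_h` -/

lemma neg_integral_norm_sq_le_two_mul_integral_inner {X E : Type*} [MeasurableSpace X]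
    {μ : Measure X} [NormedAddCommGroup E] [InnerProductSpace ℝ E] {f g : X → E}
    (hf : Integrable (fun x => ‖f x‖ ^ 2) μ) (hg : Integrable (fun x => ‖g x‖ ^ 2) μ)
    (hfg : Integrable (fun x => inner ℝ (f x) (g x)) μ) {s : ℝ} (hs : 0 < s) :
    -(s * ∫ x, ‖f x‖ ^ 2 ∂μ + s⁻¹ * ∫ x, ‖g x‖ ^ 2 ∂μ) ≤ 2 * ∫ x, inner ℝ (f x) (g x) ∂μ := by
  have hsquare : ∀ x, s⁻¹ * ‖s • f x + g x‖ ^ 2 =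
      s * ‖f x‖ ^ 2 + s⁻¹ * ‖g x‖ ^ 2 + 2 * inner ℝ (f x) (g x) := fun x => by
    rw [norm_add_sq_real, norm_smul, Real.norm_of_nonneg hs.le, real_inner_smul_left]
    field_simp
    ring
  have hnonneg : 0 ≤ ∫ x, s⁻¹ * ‖s • f x + g x‖ ^ 2 ∂μ := integral_nonneg fun x => by positivity
  have hsum : Integrable (fun x => s * ‖f x‖ ^ 2 + s⁻¹ * ‖g x‖ ^ 2) μ :=
    (hf.const_mul s).add (hg.const_mul s⁻¹)
  simp_rw [hsquare] at hnonneg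
  rw [integral_add hsum (hfg.const_mul 2),
    integral_add (hf.const_mul s) (hg.const_mul s⁻¹), integral_const_mul, integral_const_mul,
    integral_const_mul] at hnonneg
  linarith

namespace Mesh

variable {d : ℕ} {Ω : Set (Eu d)} (M : Mesh d Ω)

lemma diam_le_meshSize (T : M.cells) : Metric.diam (hull (T : Finset (Eu d))) ≤ M.meshSize :=
  le_ciSup (f := fun T : M.cells => Metric.diam (hull (T : Finset (Eu d))))
    (Set.finite_range _).bddAbove T

lemma dist_le_meshSize {T : M.cells} {x y : Eu d} (hx : x ∈ hull (T : Finset (Eu d)))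
    (hy : y ∈ hull (T : Finset (Eu d))) : dist x y ≤ M.meshSize :=
  (Metric.dist_le_diam_of_mem (isCompact_hull _).isBounded hx hy).trans (M.diam_le_meshSize T)

lemma meshSize_pos (hd : 1 ≤ d) (T : M.cells) : 0 < M.meshSize := by
  obtain ⟨a, ha, b, hb, hab⟩ := Finset.one_lt_card.1
    (show 1 < (T : Finset (Eu d)).card by rw [(M.isCell T).card_eq]; omega)
  exact (dist_pos.2 hab).trans_le (M.dist_le_meshSize (subset_hull _ ha) (subset_hull _ hb))

lemma card_facesOf_le (T : M.cells) : (M.facesOf T).card ≤ d + 1 := by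
  have hle : (M.facesOf T).card ≤ ((T : Finset (Eu d)).powersetCard d).card :=
    Finset.card_le_card_of_injOn (fun F => (F : Finset (Eu d)))
      (fun F hF => Finset.mem_coe.2 (Finset.mem_powersetCard.2 ⟨M.mem_facesOf.1 hF, M.card_face F⟩))
      Subtype.val_injective.injOn
  rwa [Finset.card_powersetCard, (M.isCell T).card_eq, Nat.choose_succ_self_right] at hle

lemma norm_outwardNormal (hd : 1 ≤ d) {T : M.cells} {F : M.faces} (hF : F ∈ M.facesOf T) :
    ‖outwardNormal (T : Finset (Eu d)) F‖ = 1 := by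
  obtain ⟨v, hv⟩ := M.exists_isFace hd hF
  exact hv.norm_outwardNormal (M.isCell T)

lemma measureReal_hull_face_le (hd : 1 ≤ d) {T : M.cells} {F : M.faces} (hF : F ∈ M.facesOf T) :
    (μHE[d - 1] : Measure (Eu d)).real (hull (F : Finset (Eu d))) ≤
      M.meshSize ^ (d - 1) * volume.real (Metric.closedBall (0 : Eu (d - 1)) 1) := by
  obtain ⟨v, hv⟩ := M.exists_isFace hd hF
  have hdiam : Metric.diam (hull (F : Finset (Eu d))) ≤ M.meshSize :=
    (Metric.diam_mono (hull_mono (M.mem_facesOf.1 hF)) (isCompact_hull _).isBounded).trans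
      (M.diam_le_meshSize T)
  calc (μHE[d - 1] : Measure (Eu d)).real (hull (F : Finset (Eu d)))
      ≤ volume.real (Metric.closedBall (0 : Eu (d - 1)) M.meshSize) :=
        ENNReal.toReal_mono measure_closedBall_lt_top.ne ((hv.measure_hull_le (M.isCell T)).trans
          (measure_mono (Metric.closedBall_subset_closedBall hdiam)))
    _ = _ := by
        rw [Measure.addHaar_real_closedBall' _ _ (M.meshSize_pos hd T).le,
          finrank_euclideanSpace_fin]

lemma exists_gradProd_le_integral_hull (hd : 1 ≤ d) (k : ℕ) {σ : ℝ} (hσ : 0 < σ) :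
    ∃ C : ℝ, 0 ≤ C ∧ ∀ (Ω : Set (Eu d)) (M : Mesh d Ω), M.IsQuasiUniform σ →
      ∀ (T : M.cells), ∀ u ∈ vecPoly d k, ∀ x ∈ hull (T : Finset (Eu d)),
        gradProd u u x ≤ C / M.meshSize ^ d * ∫ y in hull (T : Finset (Eu d)), gradProd u u y := by
  obtain ⟨C, hC0, hC⟩ := exists_gradProd_le_integral_closedBall d k hσ
  refine ⟨C, hC0, fun Ω M hM T u hu x hx => ?_⟩
  have hpos := M.meshSize_pos hd T
  obtain ⟨c, hc⟩ := hM T T.2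
  have hcT : c ∈ hull (T : Finset (Eu d)) :=
    hc (Metric.mem_closedBall_self (div_nonneg hpos.le hσ.le))
  refine (hC u hu c M.meshSize hpos x (M.dist_le_meshSize hx hcT)).trans
    (mul_le_mul_of_nonneg_left ?_ (by positivity))
  exact setIntegral_mono_set
    ((continuous_gradProd hu hu).continuousOn.integrableOn_compact (isCompact_hull _))
    (.of_forall (gradProd_self_nonneg u)) hc.eventuallyLE

/-- `C` is a constant for the discrete trace inequality `‖∇u n‖²_F ≤ C / h ‖∇u‖²_T` on the mesh. -/
def IsTraceConstant (k : ℕ) (C : ℝ) : Prop :=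
  ∀ (T : M.cells), ∀ F ∈ M.facesOf T, ∀ u ∈ vecPoly d k,
    ∫ x in hull (F : Finset (Eu d)),
      ‖fderiv ℝ u x (outwardNormal (T : Finset (Eu d)) F)‖ ^ 2 ∂μHE[d - 1] ≤
    C / M.meshSize * ∫ x in hull (T : Finset (Eu d)), gradProd u u x

theorem exists_isTraceConstant (hd : 1 ≤ d) (k : ℕ) {σ : ℝ} (hσ : 0 < σ) :
    ∃ C : ℝ, 0 < C ∧ ∀ (Ω : Set (Eu d)) (M : Mesh d Ω), M.IsQuasiUniform σ →
      M.IsTraceConstant k C := by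
  obtain ⟨C, hC0, hC⟩ := exists_gradProd_le_integral_hull hd k hσ
  set b := volume.real (Metric.closedBall (0 : Eu (d - 1)) 1)
  refine ⟨C * b + 1, by positivity, fun Ω M hM T F hF u hu => ?_⟩
  obtain ⟨v, hv⟩ := M.exists_isFace hd hF
  have hpos := M.meshSize_pos hd T
  set h := M.meshSize
  set I := ∫ x in hull (T : Finset (Eu d)), gradProd u u x
  have hI : 0 ≤ I := integral_nonneg (gradProd_self_nonneg u)
  have hpointwise : ∀ x ∈ hull (F : Finset (Eu d)),
      ‖‖fderiv ℝ u x (outwardNormal (T : Finset (Eu d)) F)‖ ^ 2‖ ≤ C / h ^ d * I := fun x hx => by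
    rw [Real.norm_of_nonneg (by positivity)]
    exact (norm_fderiv_apply_sq_le u x (M.norm_outwardNormal hd hF)).trans
      (hC Ω M hM T u hu x (hull_mono (M.mem_facesOf.1 hF) hx))
  have hpow : h ^ d = h ^ (d - 1) * h := by rw [← pow_succ, Nat.sub_add_cancel hd]
  calc _ ≤ C / h ^ d * I * (μHE[d - 1] : Measure (Eu d)).real (hull (F : Finset (Eu d))) :=
        (Real.le_norm_self _).trans (norm_setIntegral_le_of_norm_le_const
          (hv.measure_hull_lt_top (M.isCell T)) hpointwise)
    _ ≤ C / h ^ d * I * (h ^ (d - 1) * b) := by gcongr; exact M.measureReal_hull_face_le hd hF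
    _ = C * b / h * I := by rw [hpow]; field_simp
    _ ≤ (C * b + 1) / h * I := by gcongr; linarith

variable {M} {k : ℕ} {C : ℝ}

lemma gradForm_self_nonneg (T : M.cells) (w : M.HDGSpace k) : 0 ≤ M.gradForm T w w := by
  rw [gradForm_self]
  exact integral_nonneg (gradProd_self_nonneg _)

lemma penaltyForm_self_nonneg (T : M.cells) (F : M.faces) (w : M.HDGSpace k) :
    0 ≤ M.penaltyForm T F w w := by
  rw [penaltyForm_self]
  exact integral_nonneg fun x => by positivity

lemma IsTraceConstant.neg_le_two_mul_consistencyForm_self (hM : M.IsTraceConstant k C)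
    (hd : 1 ≤ d) (hC : 0 < C) {ε : ℝ} (hε : 0 < ε) {T : M.cells} {F : M.faces}
    (hF : F ∈ M.facesOf T) (w : M.HDGSpace k) :
    -(ε * M.gradForm T w w + C / (ε * M.meshSize) * M.penaltyForm T F w w) ≤
      2 * M.consistencyForm T F w w := by
  have hpos := M.meshSize_pos hd T
  have hfderiv : ContinuousOn (fun x => fderiv ℝ (w.1.1 T) x (outwardNormal (T : Finset (Eu d)) F))
      (hull (F : Finset (Eu d))) :=
    (continuous_fderiv_apply_of_mem_vecPoly (w.1.2.1 T) _).continuousOn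
  have hjump := M.continuousOn_jump T (w.1.2.1 T) w.2.2 F
  have hyoung := neg_integral_norm_sq_le_two_mul_integral_inner
    (M.integrableOn_face F (hfderiv.norm.pow 2)) (M.integrableOn_face F (hjump.norm.pow 2))
    (M.integrableOn_inner_face F hfderiv hjump) (s := ε * M.meshSize / C) (by positivity)
  have htrace := mul_le_mul_of_nonneg_left (hM T F hF _ (w.1.2.1 T))
    (show 0 ≤ ε * M.meshSize / C by positivity)
  rw [← gradForm_self, show ε * M.meshSize / C * (C / M.meshSize * M.gradForm T w w) =
    ε * M.gradForm T w w by field_simp] at htrace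
  rw [← penaltyForm_self, inv_div] at hyoung
  exact (neg_le_neg (add_le_add_left htrace _)).trans hyoung

lemma IsTraceConstant.le_cellForm_self (hM : M.IsTraceConstant k C) (hd : 1 ≤ d) (hC : 0 < C)
    {c : ℝ} {T : M.cells} (hc : (2 * C * (d + 1) + 1) / M.meshSize ≤ c) (w : M.HDGSpace k) :
    1 / 2 * M.gradForm T w w + M.meshSize⁻¹ * ∑ F ∈ M.facesOf T, M.penaltyForm T F w w ≤
      M.cellForm c T w w := by
  have hface : ∀ F ∈ M.facesOf T,
      M.meshSize⁻¹ * M.penaltyForm T F w w - 1 / (2 * (d + 1)) * M.gradForm T w w ≤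
      M.consistencyForm T F w w + M.consistencyForm T F w w + c * M.penaltyForm T F w w := by
    intro F hF
    have hcons := hM.neg_le_two_mul_consistencyForm_self hd hC
      (ε := 1 / (2 * ((d : ℝ) + 1))) (by positivity) hF w
    have hpen := mul_le_mul_of_nonneg_right hc (penaltyForm_self_nonneg T F w)
    rw [show (2 * C * (d + 1) + 1) / M.meshSize =
      C / (1 / (2 * ((d : ℝ) + 1)) * M.meshSize) + M.meshSize⁻¹ by field_simp, add_mul] at hpen
    linarith
  have hcard : (M.facesOf T).card * (1 / (2 * ((d : ℝ) + 1)) * M.gradForm T w w) ≤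
      1 / 2 * M.gradForm T w w :=
    calc (M.facesOf T).card * (1 / (2 * ((d : ℝ) + 1)) * M.gradForm T w w)
        ≤ (d + 1) * (1 / (2 * ((d : ℝ) + 1)) * M.gradForm T w w) := by
          gcongr
          · exact mul_nonneg (by positivity) (gradForm_self_nonneg T w)
          · exact_mod_cast M.card_facesOf_le T
      _ = 1 / 2 * M.gradForm T w w := by field_simp
  have hsum := Finset.sum_le_sum hface
  rw [Finset.sum_sub_distrib, Finset.sum_const, nsmul_eq_mul, ← Finset.mul_sum] at hsum
  rw [cellForm_apply]
  linarith

theorem IsTraceConstant.le_ahBilin_self (hM : M.IsTraceConstant k C) (hd : 1 ≤ d) (hk : 1 ≤ k)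
    (hC : 0 < C) {α : ℝ} (hα : 2 * C * (d + 1) + 1 ≤ α) (w : M.HDGSpace k) :
    ∑ T : M.cells, (1 / 2 * M.gradForm T w w +
      M.meshSize⁻¹ * ∑ F ∈ M.facesOf T, M.penaltyForm T F w w) ≤ M.ahBilin α w w := by
  simp only [ahBilin, LinearMap.sum_apply]
  refine Finset.sum_le_sum fun T _ => hM.le_cellForm_self hd hC ?_ w
  have hpos := M.meshSize_pos hd T
  have hk' : (1 : ℝ) ≤ (k : ℝ) ^ 2 := one_le_pow₀ (by exact_mod_cast hk)
  have hα' : 0 ≤ α := le_trans (by positivity) hα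
  gcongr
  exact hα.trans (le_mul_of_one_le_right hα' hk')

lemma IsTraceConstant.gradForm_self_eq_zero_and_penaltyForm_self_eq_zero
    (hM : M.IsTraceConstant k C) (hd : 1 ≤ d) (hk : 1 ≤ k) (hC : 0 < C) {α : ℝ}
    (hα : 2 * C * (d + 1) + 1 ≤ α) {w : M.HDGSpace k} (hw : M.ahBilin α w w = 0) (T : M.cells) :
    M.gradForm T w w = 0 ∧ ∀ F ∈ M.facesOf T, M.penaltyForm T F w w = 0 := by
  have hpos := M.meshSize_pos hd T
  have hgrad : ∀ T, 0 ≤ 1 / 2 * M.gradForm T w w := fun T =>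
    mul_nonneg (by norm_num) (gradForm_self_nonneg T w)
  have hpen : ∀ T, 0 ≤ M.meshSize⁻¹ * ∑ F ∈ M.facesOf T, M.penaltyForm T F w w := fun T =>
    mul_nonneg (inv_nonneg.2 hpos.le) (Finset.sum_nonneg fun F _ => penaltyForm_self_nonneg T F w)
  have hnonneg := fun T (_ : T ∈ Finset.univ) => add_nonneg (hgrad T) (hpen T)
  have hsum := le_antisymm (hw ▸ hM.le_ahBilin_self hd hk hC hα w) (Finset.sum_nonneg hnonneg)
  have hzero := (Finset.sum_eq_zero_iff_of_nonneg hnonneg).1 hsum T (Finset.mem_univ T)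
  obtain ⟨hgrad_zero, hpen_zero⟩ := (add_eq_zero_iff_of_nonneg (hgrad T) (hpen T)).1 hzero
  refine ⟨(mul_eq_zero.1 hgrad_zero).resolve_left (by norm_num), ?_⟩
  exact (Finset.sum_eq_zero_iff_of_nonneg fun F _ => penaltyForm_self_nonneg T F w).1
    ((mul_eq_zero.1 hpen_zero).resolve_left (inv_ne_zero hpos.ne'))

end Mesh

/-! ### Unique solvability of the velocity update -/

lemma existsUnique_forall_eq_of_apply_self_eq_zero {K V : Type*} [Field K] [AddCommGroup V]
    [Module K V] [FiniteDimensional K V] {B : LinearMap.BilinForm K V}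
    (hB : ∀ v, B v v = 0 → v = 0) (ℓ : Module.Dual K V) : ∃! v, ∀ w, B v w = ℓ w := by
  have hnondeg : B.Nondegenerate := ⟨fun v hv => hB v (hv v), fun v hv => hB v (hv v)⟩
  simp only [← LinearMap.ext_iff]
  exact (B.toDual hnondeg).bijective.existsUnique ℓ

section Tang

variable {d : ℕ}

lemma tang_neg (n v : Eu d) : tang (-n) v = tang n v := by
  simp [tang]

lemma tang_eq_self {n v : Eu d} (h : inner ℝ v n = 0) : tang n v = v := by
  simp [tang, h]

end Tang

lemma eq_const_of_integral_gradProd_eq_zero {d k : ℕ} {u : Eu d → Eu d} (hu : u ∈ vecPoly d k)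
    {K : Set (Eu d)} (hK : IsCompact K) (h_int : (interior K).Nonempty)
    (h : ∫ x in K, gradProd u u x = 0) : ∃ c : Eu d, u = fun _ => c := by
  have hgrad : gradProd u u =ᵐ[volume.restrict K] 0 :=
    (integral_eq_zero_iff_of_nonneg (gradProd_self_nonneg u)
      ((continuous_gradProd hu hu).continuousOn.integrableOn_compact hK)).1 h
  have hjac : jacobian u = 0 := eq_zero_of_analyticOnNhd_of_ae_eq_zero h_int
    (analyticOnNhd_jacobian hu) <| hgrad.mono fun x hx => by
      rw [gradProd_self_eq_norm_sq] at hx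
      exact norm_eq_zero.1 (pow_eq_zero_iff two_ne_zero |>.1 hx)
  have hfderiv : ∀ x, fderiv ℝ u x = 0 := fun x =>
    ContinuousLinearMap.coe_injective <| (EuclideanSpace.basisFun (Fin d) ℝ).toBasis.ext fun i => by
      simpa [jacobian] using congrFun (congrArg WithLp.ofLp (congrFun hjac x)) i
  exact ⟨u 0, funext fun x =>
    is_const_of_fderiv_eq_zero (differentiable_of_mem_vecPoly hu) hfderiv x 0⟩

namespace Mesh

variable {d : ℕ} {Ω : Set (Eu d)} {M : Mesh d Ω} {k : ℕ}

lemma eq_tang_of_jump_eq_zero {u : M.cells → Eu d → Eu d} {uh : M.faces → Eu d → Eu d}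
    (huh : uh ∈ M.Vhat k) {T : M.cells} {F : M.faces} (hF : F ∈ M.facesOf T) {x : Eu d}
    (hx : x ∈ hull (F : Finset (Eu d))) (h : M.jump u uh T F x = 0) :
    uh F x = tang (outwardNormal (T : Finset (Eu d)) F) (u T x) := by
  rw [jump, ← tangL_apply, map_sub, tangL_apply, tangL_apply,
    tang_eq_self (huh.2.1 T F hF x hx)] at h
  exact sub_eq_zero.1 h

lemma eq_of_jump_eq_zero (hd : 1 ≤ d) {u : M.cells → Eu d → Eu d} {uh : M.faces → Eu d → Eu d}
    (hu : u ∈ M.Vh k) (huh : uh ∈ M.Vhat k) {S T : M.cells} (hne : S ≠ T) {F : M.faces}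
    (hS : F ∈ M.facesOf S) (hT : F ∈ M.facesOf T) {x : Eu d} (hx : x ∈ hull (F : Finset (Eu d)))
    (hjS : M.jump u uh S F x = 0) (hjT : M.jump u uh T F x = 0) : u S x = u T x := by
  have htang := (eq_tang_of_jump_eq_zero huh hS hx hjS).symm.trans
    (eq_tang_of_jump_eq_zero huh hT hx hjT)
  have hnormal := M.inner_outwardNormal_eq_neg hd hu hne hS hT hx
  rw [M.outwardNormal_eq_neg hd hne hS hT] at htang hnormal
  rw [inner_neg_right, neg_inj] at hnormal
  rw [tang_neg, tang, tang, hnormal] at htang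
  exact sub_left_inj.1 htang

lemma eq_zero_of_jump_eq_zero (hd : 1 ≤ d) {u : M.cells → Eu d → Eu d}
    {uh : M.faces → Eu d → Eu d} (hu : u ∈ M.Vh k) (huh : uh ∈ M.Vhat k) {T : M.cells}
    {F : M.faces} (hF : F ∈ M.facesOf T) (hone : ∀ S : M.cells, F ∈ M.facesOf S → S = T)
    {x : Eu d} (hx : x ∈ hull (F : Finset (Eu d))) (h : M.jump u uh T F x = 0) : u T x = 0 := by
  have htang := eq_tang_of_jump_eq_zero huh hF hx h
  rw [tang_eq_self (M.inner_outwardNormal_eq_zero hd hu hF hone hx),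
    huh.2.2 F (M.hull_face_subset_frontier hd hF hone)] at htang
  exact htang.symm

lemma eq_zero_of_const_of_jump_eq_zero (hd : 1 ≤ d) {u : M.cells → Eu d → Eu d}
    {uh : M.faces → Eu d → Eu d} (hu : u ∈ M.Vh k) (huh : uh ∈ M.Vhat k) {c : M.cells → Eu d}
    (hc : ∀ T, u T = fun _ => c T)
    (hjump : ∀ T, ∀ F ∈ M.facesOf T, ∀ x ∈ hull (F : Finset (Eu d)), M.jump u uh T F x = 0) :
    u = 0 := by
  suffices hzero : ∀ T, c T = 0 from funext fun T => (hc T).trans (funext fun _ => hzero T)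
  intro T₀
  -- The cells with velocity `c T₀` own a face `F` that no other of them shares.
  obtain ⟨T, hT, F, hF, hfree⟩ := M.exists_facesOf_forall_eq hd (C := {T | c T = c T₀}) ⟨T₀, rfl⟩
  obtain ⟨x, hx⟩ : (hull (F : Finset (Eu d))).Nonempty :=
    (M.face_nonempty hd F).to_set.mono (subset_hull _)
  have hval : ∀ S : M.cells, u S x = c S := fun S => congrFun (hc S) x
  have hone : ∀ S : M.cells, F ∈ M.facesOf S → S = T := by
    intro S hS
    by_contra hne
    have heq := eq_of_jump_eq_zero hd hu huh hne hS hF hx (hjump S F hS x hx) (hjump T F hF x hx)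
    rw [hval, hval] at heq
    exact hne (hfree S (heq.trans hT) hS)
  rw [← show c T = c T₀ from hT, ← hval]
  exact eq_zero_of_jump_eq_zero hd hu huh hF hone hx (hjump T F hF x hx)

lemma eq_zero_of_jump_zero_eq_zero {uh : M.faces → Eu d → Eu d} (huh : uh ∈ M.Vhat k)
    (hjump : ∀ T, ∀ F ∈ M.facesOf T, ∀ x ∈ hull (F : Finset (Eu d)), M.jump 0 uh T F x = 0) :
    uh = 0 := by
  funext F x
  obtain ⟨T, hT⟩ := M.exists_cell F
  by_cases hx : x ∈ hull (F : Finset (Eu d))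
  · rw [eq_tang_of_jump_eq_zero huh hT hx (hjump T F hT x hx)]
    simp [tang]
  · obtain ⟨p, -, hp⟩ := huh.1 F
    rw [hp, Set.indicator_of_notMem hx, Pi.zero_apply, Pi.zero_apply]

lemma jump_eq_zero_of_penaltyForm_self_eq_zero (hd : 1 ≤ d) {w : M.HDGSpace k} {T : M.cells}
    {F : M.faces} (hF : F ∈ M.facesOf T) (h : M.penaltyForm T F w w = 0) {x : Eu d}
    (hx : x ∈ hull (F : Finset (Eu d))) : M.jump w.1 w.2 T F x = 0 := by
  obtain ⟨v, hv⟩ := M.exists_isFace hd hF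
  rw [penaltyForm_self] at h
  have hsq := hv.eqOn_zero_of_integral_eq_zero (M.isCell T)
    ((M.continuousOn_jump T (w.1.2.1 T) w.2.2 F).norm.pow 2) (fun x _ => sq_nonneg _) h hx
  exact norm_eq_zero.1 (pow_eq_zero_iff two_ne_zero |>.1 hsq)

theorem IsTraceConstant.eq_zero_of_ahBilin_self_eq_zero {C : ℝ} (hM : M.IsTraceConstant k C)
    (hd : 1 ≤ d) (hk : 1 ≤ k) (hC : 0 < C) {α : ℝ} (hα : 2 * C * (d + 1) + 1 ≤ α)
    {w : M.HDGSpace k} (hw : M.ahBilin α w w = 0) : w = 0 := by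
  have hforms := hM.gradForm_self_eq_zero_and_penaltyForm_self_eq_zero hd hk hC hα hw
  have hjump : ∀ T, ∀ F ∈ M.facesOf T, ∀ x ∈ hull (F : Finset (Eu d)),
      M.jump w.1 w.2 T F x = 0 := fun T F hF x hx =>
    jump_eq_zero_of_penaltyForm_self_eq_zero hd hF ((hforms T).2 F hF) hx
  choose c hc using fun T => eq_const_of_integral_gradProd_eq_zero (w.1.2.1 T)
    (isCompact_hull _) (M.isCell T).interior_nonempty (hforms T).1
  have hcell : w.1.1 = 0 := eq_zero_of_const_of_jump_eq_zero hd w.1.2 w.2.2 hc hjump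
  rw [hcell] at hjump
  exact Prod.ext (Subtype.ext hcell) (Subtype.ext (eq_zero_of_jump_zero_eq_zero w.2.2 hjump))

theorem IsTraceConstant.existsUnique_velocityUpdate {C : ℝ} (hM : M.IsTraceConstant k C)
    (hd : 1 ≤ d) (hk : 1 ≤ k) (hC : 0 < C) {α : ℝ} (hα : 2 * C * (d + 1) + 1 ≤ α) {ν : ℝ}
    (hν : ν ≠ 0) (cM : ℝ) {f g : Eu d → Eu d} (hf : IntegrableOn f Ω) (hg : IntegrableOn g Ω)
    {ρ : M.cells → Eu d → ℝ} (hρ : ∀ T, Continuous (ρ T)) :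
    ∃! w : (M.cells → Eu d → Eu d) × (M.faces → Eu d → Eu d),
      M.IsVelocityUpdate k α ν cM f g ρ w.1 w.2 := by
  have hdef : ∀ w, (ν • M.ahBilin (k := k) α) w w = 0 → w = 0 := fun w hw =>
    hM.eq_zero_of_ahBilin_self_eq_zero hd hk hC hα ((mul_eq_zero.1 hw).resolve_left hν)
  have hupdate : ∀ w : M.HDGSpace k, M.IsVelocityUpdate k α ν cM f g ρ w.1 w.2 ↔
      ∀ z, (ν • M.ahBilin α) w z = M.velocityRhs cM hf hg hρ z := fun w => by
    simp only [velocityRhs_apply, LinearMap.smul_apply, ahBilin_apply, smul_eq_mul]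
    exact ⟨fun h z => h.2.2 z.1 z.1.2 z.2 z.2.2,
      fun h => ⟨w.1.2, w.2.2, fun v hv vh hvh => h (⟨v, hv⟩, ⟨vh, hvh⟩)⟩⟩
  obtain ⟨w, hw, hunique⟩ :=
    existsUnique_forall_eq_of_apply_self_eq_zero hdef (M.velocityRhs cM hf hg hρ)
  refine ⟨(w.1, w.2), (hupdate w).2 hw, ?_⟩
  rintro ⟨u, uh⟩ h
  rw [← hunique (⟨u, h.1⟩, ⟨uh, h.2.1⟩) ((hupdate _).1 h)]

lemma integrableOn_domain_of_memLp {E : Type*} [NormedAddCommGroup E] (M : Mesh d Ω)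
    {f : Eu d → E} {p : ENNReal} (hp : 1 ≤ p) (hf : MemLp f p (volume.restrict Ω)) :
    IntegrableOn f Ω := by
  have : IsFiniteMeasure (volume.restrict Ω) := isFiniteMeasure_restrict.2 M.volume_domain_lt_top.ne
  exact hf.integrable hp

end Mesh

end HDG

end

theorem mainTheorem5_general {d : ℕ} (hd : 1 ≤ d) :
    (∀ k : ℕ, 1 ≤ k → ∀ σ : ℝ, 0 < σ → ∃ α₀ : ℝ, 0 < α₀ ∧
      ∀ (Ω : Set (HDG.Eu d)) (M : HDG.Mesh d Ω), M.IsQuasiUniform σ →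
      ∀ α : ℝ, α₀ ≤ α → ∀ ν : ℝ, ν ≠ 0 → ∀ cM : ℝ,
      ∀ f : HDG.Eu d → HDG.Eu d, IntegrableOn f Ω → ∀ g : HDG.Eu d → HDG.Eu d, IntegrableOn g Ω →
      ∀ ρ : M.cells → HDG.Eu d → ℝ, (∀ T, Continuous (ρ T)) →
        ∃! w : (M.cells → HDG.Eu d → HDG.Eu d) × (M.faces → HDG.Eu d → HDG.Eu d),
          M.IsVelocityUpdate k α ν cM f g ρ w.1 w.2) ∧
    (∀ (Ω : Set (HDG.Eu d)) (M : HDG.Mesh d Ω) (rule : HDG.UpwindRule) (τ : ℝ), 0 < τ →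
      ∀ k : ℕ, ∀ u ∈ M.Vh k,
        HDG.IsMMatrix (M.densityMatrix rule τ u) ∧
        ∀ ρ ∈ M.Qh 1,
          (∃! ρ' : M.cells → HDG.Eu d → ℝ, M.IsDensityUpdate 1 rule τ u ρ ρ') ∧
          ∀ ρ' : M.cells → HDG.Eu d → ℝ, M.IsDensityUpdate 1 rule τ u ρ ρ' →
            (M.IsPositive ρ → M.IsPositive ρ') ∧ M.mass ρ' = M.mass ρ) := by
  refine ⟨fun k hk σ hσ => ?_, fun Ω M rule τ hτ k u hu => ?_⟩
  · obtain ⟨C, hC, htrace⟩ := HDG.Mesh.exists_isTraceConstant hd k hσ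
    exact ⟨2 * C * (d + 1) + 1, by positivity, fun Ω M hM α hα ν hν cM f hf g hg ρ hρ =>
      (htrace Ω M hM).existsUnique_velocityUpdate hd hk hC hα hν cM hf hg hρ⟩
  · exact ⟨M.isMMatrix_densityMatrix hd rule hτ hu, fun ρ hρ =>
      ⟨M.existsUnique_densityUpdate hd rule hτ hu hρ, fun ρ' h =>
        ⟨fun hpos => h.isPositive hd hτ hu hρ hpos, h.mass_eq hd hτ.ne' hu⟩⟩⟩

theorem mainTheorem5 (d : ℕ) (hd : d = 2 ∨ d = 3) :
    -- the velocity update is uniquely solvable for sufficiently large penalty parameter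
    (∀ k : ℕ, 1 ≤ k → ∀ σ : ℝ, 0 < σ → ∃ α₀ : ℝ, 0 < α₀ ∧
      ∀ (Ω : Set (HDG.Eu d)) (M : HDG.Mesh d Ω), M.IsQuasiUniform σ →
      ∀ α : ℝ, α₀ ≤ α → ∀ ν : ℝ, 0 < ν → ∀ cM : ℝ,
      ∀ f : HDG.Eu d → HDG.Eu d, MeasureTheory.MemLp f 2 (MeasureTheory.volume.restrict Ω) →
      ∀ g : HDG.Eu d → HDG.Eu d, MeasureTheory.MemLp g ⊤ (MeasureTheory.volume.restrict Ω) →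
      ∀ ρ ∈ M.Qh k,
        ∃! w : (M.cells → HDG.Eu d → HDG.Eu d) × (M.faces → HDG.Eu d → HDG.Eu d),
          M.IsVelocityUpdate k α ν cM f g ρ w.1 w.2) ∧
    -- lowest order density update
    (∀ (Ω : Set (HDG.Eu d)) (M : HDG.Mesh d Ω) (rule : HDG.UpwindRule) (τ : ℝ), 0 < τ →
      ∀ u ∈ M.Vh 1,
        HDG.IsMMatrix (M.densityMatrix rule τ u) ∧
        ∀ ρ ∈ M.Qh 1,
          (∃! ρ' : M.cells → HDG.Eu d → ℝ, M.IsDensityUpdate 1 rule τ u ρ ρ') ∧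
          ∀ ρ' : M.cells → HDG.Eu d → ℝ, M.IsDensityUpdate 1 rule τ u ρ ρ' →
            (M.IsPositive ρ → M.IsPositive ρ') ∧
            ∀ mass : ℝ, M.mass ρ = mass → M.mass ρ' = mass) := by
  obtain ⟨hvelocity, hdensity⟩ := mainTheorem5_general (d := d) (by omega)
  refine ⟨fun k hk σ hσ => ?_, fun Ω M rule τ hτ u hu => ?_⟩
  · obtain ⟨α₀, hα₀, hsolve⟩ := hvelocity k hk σ hσ
    exact ⟨α₀, hα₀, fun Ω M hM α hα ν hν cM f hf g hg ρ hρ =>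
      hsolve Ω M hM α hα ν hν.ne' cM f (M.integrableOn_domain_of_memLp one_le_two hf)
        g (M.integrableOn_domain_of_memLp le_top hg) ρ
        fun T => (HDG.contDiff_of_mem_polySpace (hρ T)).continuous⟩
  · obtain ⟨hMmatrix, hsolve⟩ := hdensity Ω M rule τ hτ 1 u hu
    refine ⟨hMmatrix, fun ρ hρ => ⟨(hsolve ρ hρ).1, fun ρ' h => ?_⟩⟩
    obtain ⟨hpos, hmass⟩ := (hsolve ρ hρ).2 ρ' h
    exact ⟨hpos, fun mass hρmass => hmass.trans hρmass⟩
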